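/- **Setting.** Let $d,K,T\ge 1$, $B,\kappa,L_\mu>0$, $\lambda\ge 1/\kappa$ (in particular $\lambda=1$ is allowed), $\delta\in(0,1)$, and let $\mu(z)=(1+e^{-z})^{-1}$. In each round $t\in[T]$ an agent observes an arm set $\mathcal X_t=\{x_{t,a}\}_{a\in[K]}\subset\mathbb R^d$, pulls an arm $a_t\in[K]$ and receives a reward $r_t\in\{0,1\}$ which, conditionally on $\mathcal F_t=\sigma(\{\mathcal X_i,a_i\}_{i\le t},\{r_i\}_{i<t})$, is Bernoulli with mean $\mu(x_{t,a_t}^\top\theta^*)$. Assume: (i) $\|x_{t,a}\|_2\le1$ for all $t,a$, and $\theta^*\in\Theta=\{\theta\in\mathbb R^d:\|\theta\|_2\le B\}$; (ii) $1/\kappa\le\dot\mu(x_{t,a}^\top\theta)\le L_\mu$ for all $t,a$ and all $\theta\in\Theta$; (iii) the contexts are generated independently of the agent's past actions and rewards: for every $t$, the conditional law of $(\mathcal X_1,\dots,\mathcal X_T)$ given $\{\mathcal X_i,a_i,r_i\}_{i\le t}$ equals its conditional law given $\{\mathcal X_i\}_{i\le t}$. **Algorithm (SupSplitLog).** Put $S=\lfloor\tfrac12\log_2T\rfloor$,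 $D=d\log(1+T/(\kappa\lambda d))$, $$\alpha=2(\alpha_1+\alpha_2),\quad \alpha_1=\sqrt{2L_\mu\kappa^2\log(4TSK/\delta)}+\sqrt{\kappa/(9\lambda)}\,\log(4TSK/\delta),\quad \alpha_2=B\sqrt{\kappa\lambda},$$ $$\beta=\kappa\sqrt{\tfrac12D+\tfrac12\log(2S/\delta)}+B\sqrt{\kappa\lambda},\qquad \tau^{(s)}=\frac1{\beta^2}\min\Big\{1,\frac{2^{-s}}{\sqrt{32L_\mu\kappa D}}\Big\}.$$ For every level $s\ge1$ the algorithm keeps a pilot set $P^{(s)}$ and an estimation set $E^{(s)}$ of rounds, both initially empty; $P^{(s)}(t)$, $E^{(s)}(t)$ denote these sets at the end of round $t$. With $V_{Q,t}^{(s)}=\kappa\lambda I+\sum_{i\in Q^{(s)}(t)}x_{i,a_i}x_{i,a_i}^\top$ for $Q\in\{P,E\}$, define $$\bar\theta_t^{(s)}=\operatorname*{arg\,min}_{\theta\in\Theta}\Big\{\sum_{i\in P^{(s)}(t)}\big[-r_i\log\mu(x_{i,a_i}^\top\theta)-(1-r_i)\log(1-\mu(x_{i,a_i}^\top\theta))\big]+\tfrac\lambda2\|\theta\|_2^2\Big\},$$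 $$\hat\theta_t^{(s)}=\bar\theta_t^{(s)}+H^{-1}\Big(\sum_{i\in E^{(s)}(t)}\big(r_i-\mu(x_{i,a_i}^\top\bar\theta_t^{(s)})\big)x_{i,a_i}-\lambda\bar\theta_t^{(s)}\Big),\qquad H=\lambda I+\sum_{i\in E^{(s)}(t)}\dot\mu(x_{i,a_i}^\top\bar\theta_t^{(s)})\,x_{i,a_i}x_{i,a_i}^\top,$$ and, for all $t\in[T]$, $s\ge1$, $a\in[K]$, $$m_{t,a}^{(s)}=x_{t,a}^\top\hat\theta_{t-1}^{(s)},\qquad w_{t,a}^{(s)}=\alpha\,\|x_{t,a}\|_{(V_{E,t-1}^{(s)})^{-1}},\qquad \|x\|_A=\sqrt{x^\top Ax}.$$ In round $t$ start with $s=1$, $A^{(1)}=[K]$ and repeat until an arm is pulled. (a) If $w_{t,a}^{(s)}>2^{-s}$ for some $a\in A^{(s)}$, pull $a_t\in\arg\max_{a\in A^{(s)}}w_{t,a}^{(s)}$ and add $t$ to $P^{(s)}$ if $\|x_{t,a_t}\|^2_{(V_{P,t-1}^{(s)})^{-1}}>\tau^{(s)}$, and to $E^{(s)}$ otherwise. (b)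 Otherwise, if $w_{t,a}^{(s)}\le1/\sqrt T$ for all $a\in A^{(s)}$, pull $a_t\in\arg\max_{a\in A^{(s)}}m_{t,a}^{(s)}$. (c) Otherwise put $A^{(s+1)}=\{a\in A^{(s)}:m_{t,a}^{(s)}\ge\max_{b\in A^{(s)}}m_{t,b}^{(s)}-2\cdot2^{-s}\}$ and replace $s$ by $s+1$. (This loop stops at level $S+1$ at the latest.) Ties in an argmax are broken by a fixed deterministic rule, which depends only on the round and the set of maximizers. **Theorem.** With probability at least $1-\delta$, simultaneously for all $t\in[T]$, $s\in[S]$ and $a\in[K]$, $$\big|m_{t,a}^{(s)}-x_{t,a}^\top\theta^*\big|\le w_{t,a}^{(s)}=\alpha\,\|x_{t,a}\|_{(V_{E,t-1}^{(s)})^{-1}},$$ where the multiplier $\alpha$ does not depend on $d$. -/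

import Mathlib

open MeasureTheory ProbabilityTheory Finset
open scoped RealInnerProductSpace

noncomputable section

namespace SupSplitLog

/-- Feature vectors and parameters live in `ℝ^d` with the Euclidean norm. -/
abbrev Vec (d : ℕ) := EuclideanSpace ℝ (Fin d)

/-- The numerical inputs: horizon `T`, radius `B` of the parameter ball, curvature constants
`κ`, `Lmu`, regularization `lam`, confidence `δ`. -/
structure Params where
  T : ℕ
  B : ℝ
  κ : ℝ
  Lmu : ℝ
  lam : ℝ
  δ : ℝ

namespace Params

/-- The number of levels `S = ⌊0.5 log₂ T⌋`. -/
def S (p : Params) : ℕ := ⌊(1 / 2 : ℝ) * Real.logb 2 (p.T : ℝ)⌋₊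

/-- `log (4 T S K / δ)`. -/
def logTerm (p : Params) (K : ℕ) : ℝ :=
  Real.log (4 * (p.T : ℝ) * (p.S : ℝ) * (K : ℝ) / p.δ)

def alpha1 (p : Params) (K : ℕ) : ℝ :=
  √(2 * p.Lmu * p.κ ^ 2 * p.logTerm K) + √(p.κ / (9 * p.lam)) * p.logTerm K

def alpha2 (p : Params) : ℝ := p.B * √(p.κ * p.lam)

/-- The width multiplier `α = 2 (α₁ + α₂)`; it does not involve the dimension. -/
def alpha (p : Params) (K : ℕ) : ℝ := 2 * (p.alpha1 K + p.alpha2)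

/-- `d log (1 + T / (κ λ d))`. -/
def dimTerm (p : Params) (d : ℕ) : ℝ :=
  (d : ℝ) * Real.log (1 + (p.T : ℝ) / (p.κ * p.lam * (d : ℝ)))

def beta (p : Params) (d : ℕ) : ℝ :=
  p.κ * √((1 / 2) * p.dimTerm d + (1 / 2) * Real.log (2 * (p.S : ℝ) / p.δ))
    + p.B * √(p.κ * p.lam)

/-- The splitting threshold `τ^{(s)}`. -/
def tau (p : Params) (d s : ℕ) : ℝ :=
  1 / p.beta d ^ 2 * min 1 ((1 / 2) ^ s / √(32 * p.Lmu * p.κ * p.dimTerm d))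

end Params

/-! ### Estimators built from selected features `z i`, rewards `r i` and an index set `I` -/

/-- The outer product `v vᵀ`. -/
def outer {d : ℕ} (v : Vec d) : Matrix (Fin d) (Fin d) ℝ := Matrix.vecMulVec v.ofLp v.ofLp

/-- `‖v‖_A = √(vᵀ A v)`. -/
def matNorm {d : ℕ} (A : Matrix (Fin d) (Fin d) ℝ) (v : Vec d) : ℝ :=
  √(v.ofLp ⬝ᵥ A.mulVec v.ofLp)

/-- `κ λ I + ∑_{i ∈ I} z_i z_iᵀ`. -/
def design {d : ℕ} (p : Params) (z : ℕ → Vec d) (I : Finset ℕ) : Matrix (Fin d) (Fin d) ℝ :=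
  (p.κ * p.lam) • (1 : Matrix (Fin d) (Fin d) ℝ) + ∑ i ∈ I, outer (z i)

/-- The regularized logistic loss. -/
def pilotLoss {d : ℕ} (p : Params) (z : ℕ → Vec d) (r : ℕ → ℝ) (I : Finset ℕ) (θ : Vec d) : ℝ :=
  ∑ i ∈ I, (-(r i) * Real.log (Real.sigmoid ⟪z i, θ⟫)
      - (1 - r i) * Real.log (1 - Real.sigmoid ⟪z i, θ⟫))
    + p.lam / 2 * ‖θ‖ ^ 2

/-- `θ` minimizes the regularized logistic loss over the ball `Θ = {‖θ‖ ≤ B}`. -/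
def IsPilotMin {d : ℕ} (p : Params) (z : ℕ → Vec d) (r : ℕ → ℝ) (I : Finset ℕ) (θ : Vec d) :
    Prop :=
  ‖θ‖ ≤ p.B ∧ ∀ θ' : Vec d, ‖θ'‖ ≤ p.B → pilotLoss p z r I θ ≤ pilotLoss p z r I θ'

/-- The initial-point estimator: the minimizer of the regularized logistic loss over the ball. -/
def pilotEstimator {d : ℕ} (p : Params) (z : ℕ → Vec d) (r : ℕ → ℝ) (I : Finset ℕ) : Vec d :=
  Classical.epsilon (IsPilotMin p z r I)

/-- The minimum is attained, so `pilotEstimator` is indeed a minimizer. -/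
theorem isPilotMin_pilotEstimator {d : ℕ} (p : Params) (hB : 0 ≤ p.B) (z : ℕ → Vec d)
    (r : ℕ → ℝ) (I : Finset ℕ) : IsPilotMin p z r I (pilotEstimator p z r I) := by
  apply Classical.epsilon_spec (p := IsPilotMin p z r I)
  have hc : Continuous (pilotLoss p z r I) := by
    unfold pilotLoss
    have hs : ∀ i, Continuous fun θ : Vec d => Real.sigmoid ⟪z i, θ⟫ := fun i =>
      continuous_sigmoid.comp (continuous_const.inner continuous_id)
    refine Continuous.add (continuous_finsetSum _ fun i _ => ?_) (by fun_prop)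
    refine (continuous_const.mul ((hs i).log fun θ => (Real.sigmoid_pos _).ne')).sub
      (continuous_const.mul ((continuous_const.sub (hs i)).log fun θ => ?_))
    exact (sub_pos.2 (Real.sigmoid_lt_one _)).ne'
  obtain ⟨θ, hθ, hmin⟩ := (isCompact_closedBall (0 : Vec d) p.B).exists_isMinOn
    ⟨0, by simpa using hB⟩ hc.continuousOn
  exact ⟨θ, by simpa using hθ, fun θ' h' => hmin (by simpa using h')⟩

/-- `g(θ) = ∑_{i ∈ I} (r_i - μ(z_iᵀ θ)) z_i - λ θ`. -/
def gradTerm {d : ℕ} (p : Params) (z : ℕ → Vec d) (r : ℕ → ℝ) (I : Finset ℕ) (θ : Vec d) :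
    Vec d :=
  ∑ i ∈ I, (r i - Real.sigmoid ⟪z i, θ⟫) • z i - p.lam • θ

/-- `H(θ) = λ I + ∑_{i ∈ I} μ'(z_iᵀ θ) z_i z_iᵀ`. -/
def hessian {d : ℕ} (p : Params) (z : ℕ → Vec d) (I : Finset ℕ) (θ : Vec d) :
    Matrix (Fin d) (Fin d) ℝ :=
  p.lam • (1 : Matrix (Fin d) (Fin d) ℝ) + ∑ i ∈ I, deriv Real.sigmoid ⟪z i, θ⟫ • outer (z i)

/-- The one-step corrected estimator `θ̄ + H(θ̄)⁻¹ g(θ̄)`, with `θ̄` computed from the pilot set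
`I` and the correction from the estimation set `J`. -/
def oneStep {d : ℕ} (p : Params) (z : ℕ → Vec d) (r : ℕ → ℝ) (I J : Finset ℕ) : Vec d :=
  pilotEstimator p z r I +
    WithLp.toLp 2 ((hessian p z J (pilotEstimator p z r I))⁻¹.mulVec
      (gradTerm p z r J (pilotEstimator p z r I)).ofLp)

/-! ### The algorithm -/

/-- What the algorithm has stored: the arms pulled so far, and for every level `s` the pilot set
`P^{(s)}` and the estimation set `E^{(s)}`. The bucket `Ψ^{(s)}` is their (disjoint) union. -/
structure State (K : ℕ) where
  act : ℕ → Fin K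
  pilot : ℕ → Finset ℕ
  est : ℕ → Finset ℕ

/-- All sets empty; the arms stored for rounds that have not been played are never read. -/
def State.init (K : ℕ) [NeZero K] : State K :=
  ⟨fun _ => 0, fun _ => ∅, fun _ => ∅⟩

section Round

/-- The features `x_{i, a_i}` selected so far. -/
def State.feat {d K : ℕ} (st : State K) (x : ℕ → Fin K → Vec d) : ℕ → Vec d :=
  fun i => x i (st.act i)

/-- `m^{(s)}_{t,a}`, from the state `st` at the end of round `t - 1`. -/
def State.m {d K : ℕ} (st : State K) (p : Params) (x : ℕ → Fin K → Vec d) (r : ℕ → ℝ)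
    (t s : ℕ) (a : Fin K) : ℝ :=
  ⟪x t a, oneStep p (st.feat x) r (st.pilot s) (st.est s)⟫

/-- `w^{(s)}_{t,a}`, from the state `st` at the end of round `t - 1`. -/
def State.w {d K : ℕ} (st : State K) (p : Params) (x : ℕ → Fin K → Vec d)
    (t s : ℕ) (a : Fin K) : ℝ :=
  p.alpha K * matNorm (design p (st.feat x) (st.est s))⁻¹ (x t a)

open Classical in
/-- The set of maximizers of `f` on `A`. -/
def argmaxSet {K : ℕ} (A : Finset (Fin K)) (f : Fin K → ℝ) : Finset (Fin K) :=
  A.filter fun a => ∀ b ∈ A, f b ≤ f a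

open Classical in
/-- The arm sets `A^{(s)}` of one round (levels start at `1`, index `0` is not used): `A^{(1)}` is
the set of all arms, and `A^{(s+1)}` keeps the arms with
`m^{(s)}_a ≥ max_{b ∈ A^{(s)}} m^{(s)}_b - 2 · 2^{-s}`. -/
def armSet {K : ℕ} (m : ℕ → Fin K → ℝ) : ℕ → Finset (Fin K)
  | 0 => Finset.univ
  | 1 => Finset.univ
  | s + 2 => (armSet m (s + 1)).filter fun a =>
      ∀ b ∈ armSet m (s + 1), m (s + 1) b - 2 * (1 / 2) ^ (s + 1) ≤ m (s + 1) a

/-- Condition (a) at level `s`: some active arm has width larger than `2^{-s}`. -/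
def condA {K : ℕ} (m w : ℕ → Fin K → ℝ) (s : ℕ) : Prop :=
  ∃ a ∈ armSet m s, (1 / 2) ^ s < w s a

/-- Condition (b) at level `s`: all active arms have width at most `1 / √T`. -/
def condB {K : ℕ} (T : ℕ) (m w : ℕ → Fin K → ℝ) (s : ℕ) : Prop :=
  ∀ a ∈ armSet m s, w s a ≤ 1 / √(T : ℝ)

/-- The level at which the while loop of one round stops: the first level `s ≥ 1` at which
condition (a) or condition (b) holds; otherwise (condition (c)) the loop goes on to `s + 1`. -/
def stopLevel {K : ℕ} (T : ℕ) (m w : ℕ → Fin K → ℝ) : ℕ :=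
  sInf {s | 1 ≤ s ∧ (condA m w s ∨ condB T m w s)}

/-- The while loop stops, at level `S + 1` at the latest. -/
theorem loop_stops {K : ℕ} (p : Params) (hT : 1 ≤ p.T) (m w : ℕ → Fin K → ℝ) :
    condA m w (p.S + 1) ∨ condB p.T m w (p.S + 1) := by
  by_cases h : condA m w (p.S + 1)
  · exact Or.inl h
  · refine Or.inr fun a ha => ?_
    have h1 : w (p.S + 1) a ≤ (1 / 2) ^ (p.S + 1) := by
      by_contra hlt
      exact h ⟨a, ha, not_le.1 hlt⟩
    refine h1.trans ?_
    have hT0 : (0 : ℝ) < p.T := by exact_mod_cast hT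
    have h2 : (1 / 2 : ℝ) * Real.logb 2 (p.T : ℝ) < ((p.S + 1 : ℕ) : ℝ) := by
      have := Nat.lt_floor_add_one ((1 / 2 : ℝ) * Real.logb 2 (p.T : ℝ))
      simpa [Params.S] using this
    have h3 : (p.T : ℝ) < ((2 : ℝ) ^ (p.S + 1)) ^ 2 := by
      have h4 : Real.logb 2 (p.T : ℝ) < (((p.S + 1) * 2 : ℕ) : ℝ) := by
        push_cast at h2 ⊢
        linarith
      rw [Real.logb_lt_iff_lt_rpow (by norm_num) hT0, Real.rpow_natCast, pow_mul] at h4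
      exact h4
    rw [one_div_pow]
    apply one_div_le_one_div_of_le (Real.sqrt_pos.2 hT0)
    rw [Real.sqrt_le_left (by positivity)]
    exact h3.le

open Classical in
/-- Round `t`, started from the state `st`. Ties in an argmax are broken by `tie t`. -/
def State.step {d K : ℕ} (p : Params) (tie : ℕ → Finset (Fin K) → Fin K)
    (x : ℕ → Fin K → Vec d) (r : ℕ → ℝ) (t : ℕ) (st : State K) : State K :=
  let m := st.m p x r t
  let w := st.w p x t
  let s := stopLevel p.T m w
  if condA m w s then
    let a := tie t (argmaxSet (armSet m s) (w s))
    if p.tau d s < matNorm (design p (st.feat x) (st.pilot s))⁻¹ (x t a) ^ 2 then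
      ⟨Function.update st.act t a, Function.update st.pilot s (insert t (st.pilot s)), st.est⟩
    else
      ⟨Function.update st.act t a, st.pilot, Function.update st.est s (insert t (st.est s))⟩
  else
    ⟨Function.update st.act t (tie t (argmaxSet (armSet m s) (m s))), st.pilot, st.est⟩

end Round

/-- The state at the end of round `t`, on the contexts `x` and rewards `r`. -/
def run {d K : ℕ} [NeZero K] (p : Params) (tie : ℕ → Finset (Fin K) → Fin K)
    (x : ℕ → Fin K → Vec d) (r : ℕ → ℝ) : ℕ → State K
  | 0 => State.init K
  | t + 1 => State.step p tie x r (t + 1) (run p tie x r t)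

/-- The arm `a_t` pulled in round `t`. -/
def action {d K : ℕ} [NeZero K] (p : Params) (tie : ℕ → Finset (Fin K) → Fin K)
    (x : ℕ → Fin K → Vec d) (r : ℕ → ℝ) (t : ℕ) : Fin K :=
  (run p tie x r t).act t

/-- The estimate `m^{(s)}_{t,a} = x_{t,a}ᵀ θ̂^{(s)}_{t-1}` (for `t ≥ 1`, every level, every arm). -/
def estimate {d K : ℕ} [NeZero K] (p : Params) (tie : ℕ → Finset (Fin K) → Fin K)
    (x : ℕ → Fin K → Vec d) (r : ℕ → ℝ) (t s : ℕ) (a : Fin K) : ℝ :=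
  (run p tie x r (t - 1)).m p x r t s a

/-- The width `w^{(s)}_{t,a} = α ‖x_{t,a}‖_{(V^{(s)}_{E,t-1})⁻¹}` (for `t ≥ 1`, every level, every
arm). -/
def width {d K : ℕ} [NeZero K] (p : Params) (tie : ℕ → Finset (Fin K) → Fin K)
    (x : ℕ → Fin K → Vec d) (r : ℕ → ℝ) (t s : ℕ) (a : Fin K) : ℝ :=
  (run p tie x r (t - 1)).w p x t s a

/-! ### The stochastic environment -/

/-- `σ(𝒳_1, …, 𝒳_n)`, for the arm sets `𝒳_i = {x_{i,a}}_a`. -/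
@[reducible] def contextSigma {Ω : Type*} {d K : ℕ} (x : ℕ → Fin K → Ω → Vec d) (n : ℕ) : MeasurableSpace Ω :=
  ⨆ i ∈ Finset.Icc 1 n, ⨆ a, MeasurableSpace.comap (x i a) inferInstance

/-- `σ(a_1, …, a_n)`. -/
@[reducible] def actionSigma {Ω : Type*} {K : ℕ} (act : ℕ → Ω → Fin K) (n : ℕ) : MeasurableSpace Ω :=
  ⨆ i ∈ Finset.Icc 1 n, MeasurableSpace.comap (act i) ⊤

/-- `σ(r_1, …, r_n)`. -/
@[reducible] def rewardSigma {Ω : Type*} (r : ℕ → Ω → ℝ) (n : ℕ) : MeasurableSpace Ω :=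
  ⨆ i ∈ Finset.Icc 1 n, MeasurableSpace.comap (r i) inferInstance

/-- The rewards `r_1, …, r_T` take values in `{0, 1}` and, conditionally on
`𝓕_t = σ({𝒳_i, a_i}_{i ≤ t}, {r_i}_{i < t})`, the reward `r_t` is Bernoulli with mean
`μ(x_{t,a_t}ᵀ θ*)`. -/
def BernoulliRewards {Ω : Type*} [MeasurableSpace Ω] {d K : ℕ} (P : Measure Ω) (T : ℕ)
    (x : ℕ → Fin K → Ω → Vec d) (act : ℕ → Ω → Fin K) (r : ℕ → Ω → ℝ) (θstar : Vec d) : Prop :=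
  ∀ t ∈ Finset.Icc 1 T, (∀ ω, r t ω = 0 ∨ r t ω = 1) ∧
    P[r t | contextSigma x t ⊔ actionSigma act t ⊔ rewardSigma r (t - 1)]
      =ᵐ[P] fun ω => Real.sigmoid ⟪x t (act t ω) ω, θstar⟫

/-- The context sequence is generated independently of the past actions and realized rewards:
after every round `t`, the conditional law of the context sequence `𝒳_1, …, 𝒳_T` given the
contexts, actions and rewards of the rounds up to `t` is its conditional law given
`𝒳_1, …, 𝒳_t` alone. -/
def ObliviousContexts {Ω : Type*} [MeasurableSpace Ω] {d K : ℕ} (P : Measure Ω) (T : ℕ)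
    (x : ℕ → Fin K → Ω → Vec d) (act : ℕ → Ω → Fin K) (r : ℕ → Ω → ℝ) : Prop :=
  ∀ t ∈ Finset.Icc 1 T, ∀ C : Set Ω, MeasurableSet[contextSigma x T] C →
    P[C.indicator (fun _ => (1 : ℝ)) | contextSigma x t ⊔ actionSigma act t ⊔ rewardSigma r t]
      =ᵐ[P] P[C.indicator (fun _ => (1 : ℝ)) | contextSigma x t]

end SupSplitLog

end

/-! The multiplier is free of `d` because the noise of an estimate is bounded only along the single
direction `x = x_{t,a}`, by Bernstein's inequality with weights that may be treated as
deterministic. This rests on decoupling. Elimination up to level `s` uses the estimates of the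
levels below `s`, and whether a round enters `P^{(s)}` or `E^{(s)}`, and with which arm, is then
read off from features and widths. So the contexts and the rewards of the lower levels fix the
level-`s` sets and features (`run_agreeUpTo`); the rewards of `P^{(s)}` then fix the pilot
estimator, `H` and `y = H⁻¹ x`. Given all these, the rewards of `E^{(s)}` still have their Bernoulli
exponential moments (`isDecoupled_rewardMean`, `treeSum_prod_le_one`).

Let `N = ‖x‖_{V_E⁻¹}`. The error splits (`inner_oneStep_sub`) into the noise `∑ ⟨z_i, y⟩ (r_i -
μ_i)`, a second-order Taylor remainder, and a ridge term. As `V_E ≤ κ H`, the noise is at most `α₁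
N` with high probability and the ridge term at most `α₂ N`. By self-concordance the remainder is
controlled by the squares of `z_iᵀ(θ̄ - θ*)`. The entry test `‖z_i‖²_{V_P⁻¹} ≤ τ` and the pilot
ellipsoid of radius `β` bound these by `τ β²`, so the dimension-dependent `β` cancels. Rounds of
`E^{(s)}` have width above `2^{-s}`, so the elliptic potential bounds `|E^{(s)}| 4^{-s}` by `2 α²
D`, and `τ` is tuned to make the remainder at most `α N / 4`. In total `α/2 + α/4 ≤ α`.

The pilot ellipsoid comes from the method of mixtures: `exp (2 ‖S_k‖²_{V_k⁻¹}) det V_0 / det V_k` is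
a nonnegative supermartingale (`Admissible.mixture_supermartingale`), to which Ville's inequality
applies.

All this is done for a fixed context sequence, as a finite computation on binary reward sequences
(`Admissible.treeSum_bad_le`). Obliviousness of the contexts shows that, given all contexts, the
rewards have exactly the law of that computation (`condExp_history`), and integration over the
contexts finishes the proof. -/

noncomputable section

namespace SupSplitLog

/-! ### Quadratic forms, inverses and rank-one updates. -/

section QuadraticForms

variable {n : Type*} [Fintype n]

theorem dotProduct_mulVec_comm_of_isHermitian {A : Matrix n n ℝ} (hA : A.IsHermitian)
    (u v : n → ℝ) : u ⬝ᵥ A.mulVec v = v ⬝ᵥ A.mulVec u := by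
  have h : A.transpose = A := by rw [← Matrix.conjTranspose_eq_transpose_of_trivial]; exact hA
  rw [Matrix.dotProduct_mulVec, ← Matrix.mulVec_transpose, h, dotProduct_comm]

theorem quadForm_nonneg {A : Matrix n n ℝ} (hA : A.PosSemidef) (v : n → ℝ) :
    0 ≤ v ⬝ᵥ A.mulVec v := by
  simpa using hA.dotProduct_mulVec_nonneg v

theorem quadForm_pos {A : Matrix n n ℝ} (hA : A.PosDef) {v : n → ℝ} (hv : v ≠ 0) :
    0 < v ⬝ᵥ A.mulVec v := by
  simpa using hA.dotProduct_mulVec_pos hv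

/-- Cauchy–Schwarz for the form of a positive semidefinite matrix. -/
theorem sq_dotProduct_mulVec_le {A : Matrix n n ℝ} (hA : A.PosSemidef) (u v : n → ℝ) :
    (u ⬝ᵥ A.mulVec v) ^ 2 ≤ (u ⬝ᵥ A.mulVec u) * (v ⬝ᵥ A.mulVec v) := by
  -- The form at `u + t v` is a nonnegative quadratic polynomial in `t`, so its discriminant is
  -- nonpositive.
  have h : ∀ t : ℝ, 0 ≤ (v ⬝ᵥ A.mulVec v) * (t * t) + (2 * (u ⬝ᵥ A.mulVec v)) * t
      + u ⬝ᵥ A.mulVec u := by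
    intro t
    have h1 := quadForm_nonneg hA (u + t • v)
    have h2 := dotProduct_mulVec_comm_of_isHermitian hA.1 u v
    simp only [Matrix.mulVec_add, Matrix.mulVec_smul, dotProduct_add, add_dotProduct,
      dotProduct_smul, smul_dotProduct, smul_eq_mul, ← h2] at h1
    linarith
  have := discrim_le_zero h
  simp only [discrim] at this
  nlinarith

theorem quadForm_vecMulVec (z u v : n → ℝ) :
    u ⬝ᵥ (Matrix.vecMulVec z z).mulVec v = (z ⬝ᵥ u) * (z ⬝ᵥ v) := by
  rw [Matrix.vecMulVec_mulVec]
  simp [dotProduct_smul, dotProduct_comm u z, mul_comm]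

theorem posSemidef_vecMulVec_self (z : n → ℝ) : (Matrix.vecMulVec z z).PosSemidef := by
  simpa using Matrix.posSemidef_vecMulVec_self_star z

variable [DecidableEq n]

theorem mulVec_inv_mulVec {A : Matrix n n ℝ} (hA : A.PosDef) (v : n → ℝ) :
    A.mulVec (A⁻¹.mulVec v) = v := by
  rw [Matrix.mulVec_mulVec, Matrix.mul_nonsing_inv _ ((Matrix.isUnit_iff_isUnit_det _).1 hA.isUnit),
    Matrix.one_mulVec]

theorem inv_mulVec_mulVec {A : Matrix n n ℝ} (hA : A.PosDef) (v : n → ℝ) :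
    A⁻¹.mulVec (A.mulVec v) = v := by
  rw [Matrix.mulVec_mulVec, Matrix.nonsing_inv_mul _ ((Matrix.isUnit_iff_isUnit_det _).1 hA.isUnit),
    Matrix.one_mulVec]

/-- The dual form of Cauchy–Schwarz: `(uᵀv)² ≤ ‖u‖²_{A⁻¹} ‖v‖²_A`. -/
theorem sq_dotProduct_le {A : Matrix n n ℝ} (hA : A.PosDef) (u v : n → ℝ) :
    (u ⬝ᵥ v) ^ 2 ≤ (u ⬝ᵥ A⁻¹.mulVec u) * (v ⬝ᵥ A.mulVec v) := by
  have h := sq_dotProduct_mulVec_le hA.posSemidef v (A⁻¹.mulVec u)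
  rw [mulVec_inv_mulVec hA, dotProduct_comm v u, dotProduct_comm (A⁻¹.mulVec u)] at h
  rwa [mul_comm]

/-- Inversion reverses the order of quadratic forms, with a scaling factor. -/
theorem quadForm_inv_le {A B : Matrix n n ℝ} (hA : A.PosDef) (hB : B.PosDef) {c : ℝ} (hc : 0 ≤ c)
    (h : ∀ v : n → ℝ, v ⬝ᵥ A.mulVec v ≤ c * (v ⬝ᵥ B.mulVec v)) (u : n → ℝ) :
    u ⬝ᵥ B⁻¹.mulVec u ≤ c * (u ⬝ᵥ A⁻¹.mulVec u) := by
  -- For this `y` one has `yᵀBy = uᵀy`, so dual Cauchy–Schwarz for `A` gives `(uᵀy)² ≤ c ‖u‖²_{A⁻¹}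
  -- (uᵀy)`, and one factor `uᵀy` cancels.
  set y := B⁻¹.mulVec u with hy
  have h0 : 0 ≤ u ⬝ᵥ A⁻¹.mulVec u := quadForm_nonneg hA.inv.posSemidef u
  have h1 : y ⬝ᵥ B.mulVec y = u ⬝ᵥ y := by
    rw [hy, mulVec_inv_mulVec hB, dotProduct_comm]
  have h2 := sq_dotProduct_le hA u y
  have h3 := h y
  rw [h1] at h3
  have h4 : 0 ≤ u ⬝ᵥ y := quadForm_nonneg hB.inv.posSemidef u
  rcases h4.eq_or_lt with h5 | h5
  · rw [← h5]; positivity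
  · have : (u ⬝ᵥ y) * (u ⬝ᵥ y) ≤ (c * (u ⬝ᵥ A⁻¹.mulVec u)) * (u ⬝ᵥ y) := by
      nlinarith [mul_le_mul_of_nonneg_left h3 h0]
    exact le_of_mul_le_mul_right this h5

/-- The matrix determinant lemma. -/
theorem det_add_vecMulVec_self {A : Matrix n n ℝ} (hA : A.PosDef) (z : n → ℝ) :
    (A + Matrix.vecMulVec z z).det = A.det * (1 + z ⬝ᵥ A⁻¹.mulVec z) := by
  have hu := (Matrix.isUnit_iff_isUnit_det _).1 hA.isUnit
  have h := Matrix.det_add_replicateCol_mul_replicateRow (ι := Unit) hu z z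
  rw [Matrix.vecMulVec_eq Unit, h]
  congr 1
  rw [← Matrix.replicateRow_vecMul]
  simp [Matrix.dotProduct_mulVec]

/-- The Sherman–Morrison formula, applied to a vector. -/
theorem inv_add_vecMulVec_mulVec {A : Matrix n n ℝ} (hA : A.PosDef) (z v : n → ℝ) :
    (A + Matrix.vecMulVec z z)⁻¹.mulVec v
      = A⁻¹.mulVec v - ((z ⬝ᵥ A⁻¹.mulVec v) / (1 + z ⬝ᵥ A⁻¹.mulVec z)) • A⁻¹.mulVec z := by
  have hB : (A + Matrix.vecMulVec z z).PosDef := hA.add_posSemidef (posSemidef_vecMulVec_self z)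
  have hh : 0 ≤ z ⬝ᵥ A⁻¹.mulVec z := quadForm_nonneg hA.inv.posSemidef z
  set y := A⁻¹.mulVec v - ((z ⬝ᵥ A⁻¹.mulVec v) / (1 + z ⬝ᵥ A⁻¹.mulVec z)) • A⁻¹.mulVec z with hy
  have h : (A + Matrix.vecMulVec z z).mulVec y = v := by
    rw [hy, Matrix.add_mulVec, Matrix.mulVec_sub, Matrix.mulVec_smul, mulVec_inv_mulVec hA,
      mulVec_inv_mulVec hA, Matrix.vecMulVec_mulVec]
    ext i
    simp only [dotProduct_sub, dotProduct_smul, smul_eq_mul, Pi.add_apply, Pi.sub_apply,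
      Pi.smul_apply, MulOpposite.smul_eq_mul_unop, MulOpposite.unop_op]
    field_simp
    ring
  rw [← h, inv_mulVec_mulVec hB]

/-- Update of `‖S‖²_{V⁻¹}` when `S` becomes `S + ε z` and `V` becomes `V + z zᵀ`. -/
theorem quadForm_inv_update {A : Matrix n n ℝ} (hA : A.PosDef) (z S : n → ℝ) (ε : ℝ) :
    (S + ε • z) ⬝ᵥ (A + Matrix.vecMulVec z z)⁻¹.mulVec (S + ε • z)
      = S ⬝ᵥ A⁻¹.mulVec S
        + (2 * ε * (z ⬝ᵥ A⁻¹.mulVec S) + ε ^ 2 * (z ⬝ᵥ A⁻¹.mulVec z) - (z ⬝ᵥ A⁻¹.mulVec S) ^ 2)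
          / (1 + z ⬝ᵥ A⁻¹.mulVec z) := by
  have hh : 0 ≤ z ⬝ᵥ A⁻¹.mulVec z := quadForm_nonneg hA.inv.posSemidef z
  have hc := dotProduct_mulVec_comm_of_isHermitian hA.inv.1 S z
  rw [inv_add_vecMulVec_mulVec hA]
  simp only [Matrix.mulVec_add, Matrix.mulVec_smul, dotProduct_add, add_dotProduct,
      dotProduct_smul, smul_dotProduct, smul_eq_mul, dotProduct_sub, hc]
  field_simp
  ring

/-- AM–GM for the eigenvalues of a positive semidefinite matrix. -/
theorem det_le_trace_div_pow [Nonempty n] {A : Matrix n n ℝ} (hA : A.PosSemidef) :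
    A.det ≤ (A.trace / Fintype.card n) ^ Fintype.card n := by
  have hc : (0 : ℝ) < Fintype.card n := by exact_mod_cast Fintype.card_pos
  have h1 := hA.1.det_eq_prod_eigenvalues
  have h2 := hA.1.trace_eq_sum_eigenvalues
  simp only [RCLike.ofReal_real_eq_id, id_eq] at h1 h2
  have h3 := Real.geom_mean_le_arith_mean_weighted univ
    (fun _ => (Fintype.card n : ℝ)⁻¹) hA.1.eigenvalues (fun _ _ => by positivity)
    (by simp) (fun i _ => hA.eigenvalues_nonneg i)
  rw [Real.finsetProd_rpow _ _ fun i _ => hA.eigenvalues_nonneg i, ← h1, ← Finset.mul_sum,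
    ← h2] at h3
  have h4 := pow_le_pow_left₀ (Real.rpow_nonneg hA.det_nonneg _) h3 (Fintype.card n)
  rw [← Real.rpow_natCast, ← Real.rpow_mul hA.det_nonneg, inv_mul_cancel₀ hc.ne',
    Real.rpow_one] at h4
  rwa [div_eq_inv_mul]

end QuadraticForms

/-! ### Design matrices, log-determinants and the elliptic potential. -/

section Design

variable {d : ℕ}

theorem inner_eq_dotProduct (u v : Vec d) : ⟪u, v⟫ = u.ofLp ⬝ᵥ v.ofLp := by
  rw [EuclideanSpace.inner_eq_star_dotProduct, star_trivial, dotProduct_comm]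

theorem dotProduct_self_eq_norm_sq (u : Vec d) : u.ofLp ⬝ᵥ u.ofLp = ‖u‖ ^ 2 := by
  rw [← inner_eq_dotProduct, real_inner_self_eq_norm_sq]

theorem posSemidef_smul_outer {c : ℝ} (hc : 0 ≤ c) (v : Vec d) : (c • outer v).PosSemidef :=
  (posSemidef_vecMulVec_self _).smul hc

/-- `c I + ∑ γ_i z_i z_iᵀ` is positive definite for `c > 0`, `γ ≥ 0`. -/
theorem posDef_smul_one_add_sum {c : ℝ} (hc : 0 < c) (γ : ℕ → ℝ) (z : ℕ → Vec d) (I : Finset ℕ)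
    (hγ : ∀ i ∈ I, 0 ≤ γ i) :
    (c • (1 : Matrix (Fin d) (Fin d) ℝ) + ∑ i ∈ I, γ i • outer (z i)).PosDef :=
  (Matrix.PosDef.one.smul hc).add_posSemidef
    (Matrix.posSemidef_sum _ fun i hi => posSemidef_smul_outer (hγ i hi) _)

theorem quadForm_smul_one_add_sum (c : ℝ) (γ : ℕ → ℝ) (z : ℕ → Vec d) (I : Finset ℕ)
    (v : Fin d → ℝ) :
    v ⬝ᵥ (c • (1 : Matrix (Fin d) (Fin d) ℝ) + ∑ i ∈ I, γ i • outer (z i)).mulVec v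
      = c * (v ⬝ᵥ v) + ∑ i ∈ I, γ i * ((z i).ofLp ⬝ᵥ v) ^ 2 := by
  rw [Matrix.add_mulVec, dotProduct_add, Matrix.sum_mulVec, dotProduct_sum, Matrix.smul_mulVec,
    Matrix.one_mulVec, dotProduct_smul, smul_eq_mul]
  congr 1
  refine sum_congr rfl fun i _ => ?_
  rw [Matrix.smul_mulVec, dotProduct_smul, outer, quadForm_vecMulVec, smul_eq_mul, sq]

theorem design_posDef {p : Params} (hp : 0 < p.κ * p.lam) (z : ℕ → Vec d) (I : Finset ℕ) :
    (design p z I).PosDef := by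
  simpa [design] using posDef_smul_one_add_sum hp (fun _ => 1) z I (by simp)

theorem quadForm_design (p : Params) (z : ℕ → Vec d) (I : Finset ℕ) (v : Fin d → ℝ) :
    v ⬝ᵥ (design p z I).mulVec v = p.κ * p.lam * (v ⬝ᵥ v) + ∑ i ∈ I, ((z i).ofLp ⬝ᵥ v) ^ 2 := by
  simpa [design] using quadForm_smul_one_add_sum (p.κ * p.lam) (fun _ => 1) z I v

theorem design_insert (p : Params) (z : ℕ → Vec d) {I : Finset ℕ} {i : ℕ} (hi : i ∉ I) :
    design p z (insert i I) = design p z I + Matrix.vecMulVec (z i).ofLp (z i).ofLp := by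
  rw [design, sum_insert hi, design, outer]
  abel

theorem design_congr (p : Params) {z z' : ℕ → Vec d} {I : Finset ℕ} (h : ∀ i ∈ I, z i = z' i) :
    design p z I = design p z' I := by
  rw [design, design, sum_congr rfl fun i hi => by rw [h i hi]]

theorem matNorm_sq {A : Matrix (Fin d) (Fin d) ℝ} (hA : A.PosSemidef) (v : Vec d) :
    matNorm A v ^ 2 = v.ofLp ⬝ᵥ A.mulVec v.ofLp :=
  Real.sq_sqrt (quadForm_nonneg hA _)

theorem matNorm_nonneg (A : Matrix (Fin d) (Fin d) ℝ) (v : Vec d) : 0 ≤ matNorm A v :=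
  Real.sqrt_nonneg _

theorem matNorm_pos {A : Matrix (Fin d) (Fin d) ℝ} (hA : A.PosDef) {v : Vec d} (hv : v ≠ 0) :
    0 < matNorm A v :=
  Real.sqrt_pos.2 (quadForm_pos hA fun h => hv (by ext i; simpa using congrFun h i))

/-- The inverse design form decreases when the index set grows. -/
theorem quadForm_design_inv_anti {p : Params} (hp : 0 < p.κ * p.lam) (z : ℕ → Vec d)
    {I J : Finset ℕ} (h : I ⊆ J) (u : Fin d → ℝ) :
    u ⬝ᵥ (design p z J)⁻¹.mulVec u ≤ u ⬝ᵥ (design p z I)⁻¹.mulVec u := by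
  have := quadForm_inv_le (design_posDef hp z I) (design_posDef hp z J) zero_le_one
    (fun v => ?_) u
  · simpa using this
  · rw [one_mul, quadForm_design, quadForm_design]
    gcongr

theorem det_design_empty (p : Params) (z : ℕ → Vec d) :
    (design p z ∅).det = (p.κ * p.lam) ^ d := by
  simp [design]

theorem quadForm_design_inv_le {p : Params} (hp : 0 < p.κ * p.lam) (z : ℕ → Vec d)
    (I : Finset ℕ) (u : Fin d → ℝ) :
    u ⬝ᵥ (design p z I)⁻¹.mulVec u ≤ (u ⬝ᵥ u) / (p.κ * p.lam) := by
  have := quadForm_inv_le (A := (1 : Matrix (Fin d) (Fin d) ℝ)) Matrix.PosDef.one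
    (design_posDef hp z I) (c := 1 / (p.κ * p.lam)) (by positivity) (fun v => ?_) u
  · simpa [div_eq_inv_mul] using this
  · rw [quadForm_design, Matrix.one_mulVec, mul_add, ← mul_assoc, one_div_mul_cancel hp.ne',
      one_mul]
    have : 0 ≤ ∑ i ∈ I, ((z i).ofLp ⬝ᵥ v) ^ 2 := sum_nonneg fun i _ => sq_nonneg _
    have h2 : 0 ≤ 1 / (p.κ * p.lam) * ∑ i ∈ I, ((z i).ofLp ⬝ᵥ v) ^ 2 := by positivity
    linarith

/-- `log (det V / det V₀) ≤ d log (1 + T / (κ λ d))`. -/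
theorem log_det_design_sub_le [NeZero d] {p : Params} (hp : 0 < p.κ * p.lam) (z : ℕ → Vec d)
    (I : Finset ℕ) (hz : ∀ i ∈ I, ‖z i‖ ≤ 1) (hI : I.card ≤ p.T) :
    Real.log (design p z I).det - Real.log (design p z ∅).det ≤ p.dimTerm d := by
  have hd : (0 : ℝ) < d := by exact_mod_cast Nat.pos_of_ne_zero (NeZero.ne d)
  have h1 := det_le_trace_div_pow (design_posDef hp z I).posSemidef
  have htr : (design p z I).trace ≤ p.κ * p.lam * d + p.T := by
    rw [design, Matrix.trace_add, Matrix.trace_smul, Matrix.trace_one, Matrix.trace_sum]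
    have : ∑ i ∈ I, (outer (z i)).trace ≤ ∑ i ∈ I, (1 : ℝ) := by
      refine sum_le_sum fun i hi => ?_
      rw [outer, Matrix.trace_vecMulVec, dotProduct_self_eq_norm_sq]
      exact pow_le_one₀ (norm_nonneg _) (hz i hi)
    have h2 : ((I.card : ℕ) : ℝ) ≤ p.T := by exact_mod_cast hI
    simp only [sum_const, nsmul_eq_mul, mul_one] at this
    simp only [Fintype.card_fin, smul_eq_mul]
    linarith
  have hpos := (design_posDef hp z I).det_pos
  have h0 : 0 ≤ (design p z I).trace := (design_posDef hp z I).posSemidef.trace_nonneg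
  rw [Fintype.card_fin] at h1
  have h3 : (design p z I).det ≤ ((p.κ * p.lam) * (1 + p.T / (p.κ * p.lam * d))) ^ d := by
    refine h1.trans (pow_le_pow_left₀ (by positivity) ?_ d)
    rw [div_le_iff₀ hd]
    have hκ := left_ne_zero_of_mul hp.ne'
    have hl := right_ne_zero_of_mul hp.ne'
    refine htr.trans (le_of_eq ?_)
    field_simp
  have h4 := Real.log_le_log hpos h3
  rw [Real.log_pow, Real.log_mul hp.ne' (by positivity)] at h4
  rw [det_design_empty, Real.log_pow, Params.dimTerm]
  linarith

/-- Turns the squared norm of a new feature into the increment `log (1 + h)` of the log-determinant;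
`h ≤ 1` is what yields the constant 2. -/
theorem le_two_mul_log_one_add {h : ℝ} (h0 : 0 ≤ h) (h1 : h ≤ 1) : h ≤ 2 * Real.log (1 + h) := by
  have := Real.one_sub_inv_le_log_of_pos (show 0 < 1 + h by linarith)
  have h2 : h / 2 ≤ 1 - (1 + h)⁻¹ := by
    rw [show 1 - (1 + h)⁻¹ = h / (1 + h) by field_simp; ring]
    exact div_le_div_of_nonneg_left h0 (by linarith) (by linarith)
  linarith

/-- The elliptic potential bound. -/
theorem sum_quadForm_design_inv_le {p : Params} (hp : 1 ≤ p.κ * p.lam) (z : ℕ → Vec d)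
    (J : Finset ℕ) (hz : ∀ i ∈ J, ‖z i‖ ≤ 1) :
    ∑ i ∈ J, (z i).ofLp ⬝ᵥ (design p z (J.filter (· < i)))⁻¹.mulVec (z i).ofLp
      ≤ 2 * (Real.log (design p z J).det - Real.log (design p z ∅).det) := by
  have hp0 : 0 < p.κ * p.lam := by linarith
  -- The inserted index is the latest round, so `filter (· < a)` recovers `J` and leaves the
  -- matrices of the earlier rounds unchanged.
  induction J using Finset.induction_on_max with
  | empty => simp
  | insert a J ha ih =>
    have haJ : a ∉ J := fun h => lt_irrefl _ (ha a h)
    rw [sum_insert haJ, design_insert p z haJ, det_add_vecMulVec_self (design_posDef hp0 z J)]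
    have hf : (insert a J).filter (· < a) = J := by
      ext i
      simp only [mem_filter, mem_insert]
      exact ⟨fun ⟨h1, h2⟩ => h1.resolve_left h2.ne, fun h => ⟨Or.inr h, ha i h⟩⟩
    have hg : ∀ i ∈ J, (insert a J).filter (· < i) = J.filter (· < i) := by
      intro i hi
      rw [filter_insert, if_neg (not_lt.2 (ha i hi).le)]
    rw [hf, sum_congr rfl fun i hi => by rw [hg i hi]]
    have ih' := ih fun i hi => hz i (mem_insert_of_mem hi)
    set h := (z a).ofLp ⬝ᵥ (design p z J)⁻¹.mulVec (z a).ofLp with hh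
    have h0 : 0 ≤ h := quadForm_nonneg (design_posDef hp0 z J).inv.posSemidef _
    -- This is where `κ λ ≥ 1` enters.
    have h1 : h ≤ 1 := by
      refine (quadForm_design_inv_le hp0 z J _).trans ?_
      rw [dotProduct_self_eq_norm_sq, div_le_one hp0]
      exact (pow_le_one₀ (norm_nonneg _) (hz a (mem_insert_self _ _))).trans hp
    rw [Real.log_mul (design_posDef hp0 z J).det_pos.ne' (by positivity)]
    have := le_two_mul_log_one_add h0 h1
    linarith

end Design

/-! ### Inequalities for the sigmoid and for Bernoulli exponential moments. -/

section Scalar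

/-- `(μ(b) - μ(a)) (b - a) ≥ m (b - a)²` when `μ' ≥ m` at both end points. -/
theorem mul_sq_le_sigmoid_sub_mul {m a b : ℝ} (ha : m ≤ deriv Real.sigmoid a)
    (hb : m ≤ deriv Real.sigmoid b) :
    m * (b - a) ^ 2 ≤ (Real.sigmoid b - Real.sigmoid a) * (b - a) := by
  wlog hab : a < b generalizing a b
  · rcases (not_lt.1 hab).eq_or_lt with h | h
    · simp [h]
    · have := this hb ha h
      nlinarith
  obtain ⟨c, ⟨hac, hcb⟩, hc⟩ := exists_deriv_eq_slope Real.sigmoid hab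
    continuous_sigmoid.continuousOn differentiable_sigmoid.differentiableOn
  -- `μ' = μ (1 - μ)` is concave in `μ`, and `μ(c)` lies between `μ(a)` and `μ(b)`. If `μ(c) + μ(a)
  -- ≤ 1` then `μ'(c) ≥ μ'(a)`; otherwise `μ'(c) ≥ μ'(b)`.
  have hm : m ≤ deriv Real.sigmoid c := by
    rw [Real.deriv_sigmoid] at *
    have h1 := Real.sigmoid_monotone hac.le
    have h2 := Real.sigmoid_monotone hcb.le
    simp only at ha hb ⊢
    rcases le_total (Real.sigmoid c + Real.sigmoid a) 1 with h | h
    · nlinarith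
    · nlinarith
  rw [hc, le_div_iff₀ (by linarith)] at hm
  nlinarith [mul_le_mul_of_nonneg_right hm (sub_nonneg.2 hab.le)]

/-- Self-concordance: a second-order expansion with remainder relative to `μ'(a)`. -/
theorem abs_sigmoid_sub_sub_le {a b : ℝ} (h : |b - a| ≤ 1) :
    |Real.sigmoid b - Real.sigmoid a - deriv Real.sigmoid a * (b - a)|
      ≤ deriv Real.sigmoid a * (b - a) ^ 2 := by
  obtain ⟨u, rfl⟩ : ∃ u, b = a + u := ⟨b - a, by ring⟩
  rw [add_sub_cancel_left] at *
  rw [Real.deriv_sigmoid]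
  simp only
  set q := Real.sigmoid a with hq
  have hq0 : 0 < q := Real.sigmoid_pos a
  have hq1 : q < 1 := Real.sigmoid_lt_one a
  set E := Real.exp u with hE
  have hE0 : 0 < E := Real.exp_pos u
  have hden : 0 < 1 - q + q * E := by nlinarith [mul_pos hq0 hE0]
  -- A shift by `u` multiplies the odds by `exp u`.
  have hσ : Real.sigmoid (a + u) = q * E / (1 - q + q * E) := by
    have hF := Real.exp_pos (-a)
    rw [eq_div_iff hden.ne', hq, Real.sigmoid_def, Real.sigmoid_def, neg_add, Real.exp_add,
      Real.exp_neg u, ← hE]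
    have h1 : 1 + Real.exp (-a) ≠ 0 := by positivity
    have h2 : E + Real.exp (-a) ≠ 0 := by positivity
    have h3 : 1 + Real.exp (-a) * E⁻¹ = (E + Real.exp (-a)) / E := by field_simp
    rw [h3, inv_div]
    field_simp
    ring
  have h1 := abs_le.1 (Real.abs_exp_sub_one_sub_id_le h)
  have h2 := abs_le.1 (Real.abs_exp_sub_one_sub_id_le (x := -u) (by rwa [abs_neg]))
  rw [← hE] at h1
  rw [Real.exp_neg, ← hE] at h2
  -- The factor `q (1 - q) = μ'(a)` comes out. The denominator is a convex combination of `1` and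
  -- `E`, so the fraction lies between `1 - E⁻¹` and `E - 1`, both within `u²` of `u`.
  have hkey : Real.sigmoid (a + u) - q - q * (1 - q) * u
      = q * (1 - q) * ((E - 1) / (1 - q + q * E) - u) := by
    rw [hσ]; field_simp; ring
  rw [hkey, abs_mul, abs_of_pos (mul_pos hq0 (by linarith))]
  refine mul_le_mul_of_nonneg_left (abs_le.2 ⟨?_, ?_⟩) (mul_pos hq0 (by linarith)).le
  · have : 1 - E⁻¹ ≤ (E - 1) / (1 - q + q * E) := by
      rw [le_div_iff₀ hden, show 1 - E⁻¹ = (E - 1) / E by field_simp, div_mul_eq_mul_div,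
        div_le_iff₀ hE0]
      nlinarith [mul_nonneg (sub_nonneg.2 hq1.le) (sq_nonneg (E - 1))]
    nlinarith
  · have : (E - 1) / (1 - q + q * E) ≤ E - 1 := by
      rw [div_le_iff₀ hden]
      nlinarith [mul_nonneg hq0.le (sq_nonneg (E - 1))]
    linarith

/-- Makes the tail of the exponential series geometric of ratio `y / 3`; the 3 of Bernstein's
inequality comes from here. -/
theorem two_mul_three_pow_le_factorial (m : ℕ) : 2 * 3 ^ m ≤ (m + 2).factorial := by
  induction m with
  | zero => simp
  | succ m ih =>
    rw [Nat.factorial_succ, pow_succ]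
    nlinarith

/-- For `y ≥ 0` the series from degree two on is dominated termwise by `(y² / 2) k^m`. For `y ≤ 0`
the bound `1 + y + y² / 2` already suffices. It is applied with `k = η b / 3`. -/
theorem exp_le_one_add_add_sq_div {k y : ℝ} (hk0 : 0 ≤ k) (hk1 : k < 1) (hy : y ≤ 3 * k) :
    Real.exp y ≤ 1 + y + y ^ 2 / (2 * (1 - k)) := by
  rcases le_total 0 y with h0 | h0
  · have h1 : HasSum (fun m : ℕ => y ^ (m + 2) / (m + 2).factorial)
        (Real.exp y - (1 + y)) := by
      have := NormedSpace.expSeries_div_hasSum_exp (𝔸 := ℝ) y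
      rw [← Real.exp_eq_exp_ℝ] at this
      have h := (hasSum_nat_add_iff' 2).2 this
      simpa [sum_range_succ] using h
    have h2 : HasSum (fun m : ℕ => y ^ 2 / 2 * k ^ m) (y ^ 2 / 2 * (1 - k)⁻¹) :=
      (hasSum_geometric_of_lt_one hk0 hk1).mul_left _
    have h3 := hasSum_le (fun m => ?_) h1 h2
    · have : y ^ 2 / (2 * (1 - k)) = y ^ 2 / 2 * (1 - k)⁻¹ := by
        rw [div_mul_eq_div_div, div_eq_mul_inv (y ^ 2 / 2)]
      linarith
    · have hf : (2 * 3 ^ m : ℝ) ≤ (m + 2).factorial := by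
        exact_mod_cast two_mul_three_pow_le_factorial m
      calc y ^ (m + 2) / (m + 2).factorial ≤ y ^ (m + 2) / (2 * 3 ^ m) := by gcongr
        _ = y ^ 2 / 2 * (y / 3) ^ m := by rw [div_pow, pow_add]; field_simp
        _ ≤ y ^ 2 / 2 * k ^ m := by
          gcongr
          linarith
  · have h1 := Real.quadratic_le_exp_of_nonneg (x := -y) (by linarith)
    have h2 : Real.exp y ≤ 1 + y + y ^ 2 / 2 := by
      rw [← neg_neg y, Real.exp_neg]
      have hpos : 0 < 1 + -y + (-y) ^ 2 / 2 := by nlinarith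
      refine (inv_anti₀ hpos h1).trans ?_
      rw [inv_le_iff_one_le_mul₀ hpos]
      nlinarith [sq_nonneg (y ^ 2)]
    have h3 : y ^ 2 / 2 ≤ y ^ 2 / (2 * (1 - k)) :=
      div_le_div_of_nonneg_left (sq_nonneg _) (by linarith) (by linarith)
    linarith

/-- Bernstein's bound for the exponential moment of a centred Bernoulli variable. -/
theorem bernoulli_bernstein {q c η b : ℝ} (hq0 : 0 ≤ q) (hq1 : q ≤ 1) (hη : 0 ≤ η)
    (hc : |c| ≤ b) (hb : η * b < 3) :
    q * Real.exp (η * (c * (1 - q))) + (1 - q) * Real.exp (η * (c * (0 - q)))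
      ≤ Real.exp (η ^ 2 * (c ^ 2 * (q * (1 - q))) / (2 * (1 - η * b / 3))) := by
  have hb0 : 0 ≤ b := (abs_nonneg c).trans hc
  obtain ⟨hc1, hc2⟩ := abs_le.1 hc
  have hk0 : 0 ≤ η * b / 3 := by positivity
  have hk1 : η * b / 3 < 1 := by linarith
  have hA := exp_le_one_add_add_sq_div hk0 hk1 (y := η * (c * (1 - q))) (by
    rw [mul_div_cancel₀ _ (by norm_num : (3 : ℝ) ≠ 0)]
    refine mul_le_mul_of_nonneg_left ?_ hη
    nlinarith)
  have hB := exp_le_one_add_add_sq_div hk0 hk1 (y := η * (c * (0 - q))) (by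
    rw [mul_div_cancel₀ _ (by norm_num : (3 : ℝ) ≠ 0)]
    refine mul_le_mul_of_nonneg_left ?_ hη
    nlinarith)
  have hC := mul_le_mul_of_nonneg_left hA hq0
  have hD := mul_le_mul_of_nonneg_left hB (sub_nonneg.2 hq1)
  -- On averaging over the two outcomes the linear terms cancel and the squares add up to the
  -- variance `c² q (1 - q)`; then `1 + u ≤ exp u`.
  refine le_trans (add_le_add hC hD) (le_trans (le_of_eq ?_) (Real.add_one_le_exp _))
  have : 1 - η * b / 3 ≠ 0 := by linarith
  field_simp
  ring

/-- Hoeffding's lemma for a Bernoulli variable. -/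
theorem bernoulli_hoeffding {q : ℝ} (hq0 : 0 ≤ q) (hq1 : q ≤ 1) (u : ℝ) :
    q * Real.exp (u * (1 - q)) + (1 - q) * Real.exp (u * (0 - q)) ≤ Real.exp (u ^ 2 / 8) := by
  -- Both sides are expressed through this two-point law so that the general Hoeffding lemma
  -- applies.
  let ν : Measure ℝ := ENNReal.ofReal q • Measure.dirac 1 + ENNReal.ofReal (1 - q) • Measure.dirac 0
  have hν : IsProbabilityMeasure ν := ⟨by
    simp only [ν, Measure.add_apply, Measure.smul_apply, measure_univ, smul_eq_mul, mul_one]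
    rw [← ENNReal.ofReal_add hq0 (by linarith)]
    simp⟩
  have hint : ∀ f : ℝ → ℝ, ∫ x, f x ∂ν = q * f 1 + (1 - q) * f 0 := by
    intro f
    rw [integral_add_measure]
    · simp [integral_smul_measure, hq0, hq1]
    · exact (integrable_dirac (by simp)).smul_measure (by simp)
    · exact (integrable_dirac (by simp)).smul_measure (by simp)
  have hX : ∀ᵐ x ∂ν, (fun x : ℝ => x - q) x ∈ Set.Icc (-q) (1 - q) := by
    rw [ae_add_measure_iff]
    constructor <;> refine Measure.ae_smul_measure ?_ _ <;>
      · rw [ae_dirac_eq]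
        simp
        try linarith
  have h := hasSubgaussianMGF_of_mem_Icc_of_integral_eq_zero (μ := ν) (X := fun x => x - q)
    (by fun_prop) hX (by rw [hint]; ring)
  have h2 := h.mgf_le u
  rw [mgf, hint] at h2
  refine h2.trans (le_of_eq ?_)
  congr 1
  norm_num
  ring

theorem integral_exp_neg_mul_sub_sq (b c : ℝ) :
    ∫ x : ℝ, Real.exp (-b * (x - c) ^ 2) = √(Real.pi / b) := by
  rw [integral_sub_right_eq_self (fun x => Real.exp (-b * x ^ 2)) c, integral_gaussian]

theorem integrable_exp_neg_mul_sub_sq {b : ℝ} (hb : 0 < b) (c : ℝ) :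
    Integrable fun x : ℝ => Real.exp (-b * (x - c) ^ 2) :=
  (integrable_exp_neg_mul_sq hb).comp_sub_right c

/-- One step of the method of mixtures for a centred Bernoulli variable. -/
theorem bernoulli_mixture {q a h : ℝ} (hq0 : 0 ≤ q) (hq1 : q ≤ 1) (hh : 0 ≤ h) :
    q * Real.exp (2 * ((2 * (1 - q) * a + (1 - q) ^ 2 * h - a ^ 2) / (1 + h)))
      + (1 - q) * Real.exp (2 * ((2 * (0 - q) * a + (0 - q) ^ 2 * h - a ^ 2) / (1 + h)))
      ≤ √(1 + h) := by
  have h1 : 0 < 1 + h := by linarith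
  -- `u` and `v` linearize the square: the exponent equals `u ε + v² ε² / 2 - 2a² / (1 + h)`, and
  -- `exp (v² ε² / 2)` is the mean of `exp (v x ε)` over a standard Gaussian `x`. Hoeffding's lemma
  -- can then be used for each fixed `x`.
  set v := √(4 * h / (1 + h)) with hv
  have hv2 : v ^ 2 = 4 * h / (1 + h) := Real.sq_sqrt (by positivity)
  set u := 4 * a / (1 + h) with hu
  have hG : ∀ ε : ℝ, Real.exp (2 * ((2 * ε * a + ε ^ 2 * h - a ^ 2) / (1 + h))) * √(2 * Real.pi)
      = ∫ x, Real.exp (-(2 * a ^ 2 / (1 + h))) *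
          (Real.exp (-(1 / 2) * x ^ 2) * Real.exp ((u + v * x) * ε)) := by
    intro ε
    have : ∀ x, Real.exp (-(2 * a ^ 2 / (1 + h))) *
          (Real.exp (-(1 / 2) * x ^ 2) * Real.exp ((u + v * x) * ε))
        = Real.exp (2 * ((2 * ε * a + ε ^ 2 * h - a ^ 2) / (1 + h)))
          * Real.exp (-(1 / 2) * (x - v * ε) ^ 2) := by
      intro x
      rw [← Real.exp_add, ← Real.exp_add, ← Real.exp_add]
      congr 1
      have : v ^ 2 * ε ^ 2 = 4 * h / (1 + h) * ε ^ 2 := by rw [hv2]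
      have e : -(2 * a ^ 2 / (1 + h)) + (-(1 / 2) * x ^ 2 + (u + v * x) * ε)
        = -(2 * a ^ 2 / (1 + h)) + u * ε + (4 * h / (1 + h)) * ε ^ 2 / 2
          + -(1 / 2) * (x - v * ε) ^ 2 := by linear_combination (1 / 2) * this
      rw [e, hu]
      field_simp
      ring
    simp_rw [this]
    rw [integral_const_mul, integral_exp_neg_mul_sub_sq]
    congr 2
    ring
  have hI : ∀ ε : ℝ, Integrable fun x => Real.exp (-(2 * a ^ 2 / (1 + h))) *
          (Real.exp (-(1 / 2) * x ^ 2) * Real.exp ((u + v * x) * ε)) := by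
    intro ε
    refine Integrable.const_mul ?_ _
    refine ((integrable_exp_neg_mul_sub_sq (b := 1 / 2) (by norm_num) (v * ε)).const_mul
      (Real.exp (u * ε + v ^ 2 * ε ^ 2 / 2))).congr (.of_forall fun x => ?_)
    simp only
    rw [← Real.exp_add, ← Real.exp_add]
    congr 1
    ring
  -- After Hoeffding the exponent is a perfect square with no constant left, that of a Gaussian of
  -- variance `1 + h`. This is the source of `√(1 + h)`.
  have hR : ∀ x, Real.exp (-(2 * a ^ 2 / (1 + h))) *
          (Real.exp (-(1 / 2) * x ^ 2) * Real.exp ((u + v * x) ^ 2 / 8))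
        = Real.exp (-(1 / (2 * (1 + h))) * (x - u * v * (1 + h) / 4) ^ 2) := by
    intro x
    rw [← Real.exp_add, ← Real.exp_add]
    congr 1
    have e : -(2 * a ^ 2 / (1 + h)) + (-(1 / 2) * x ^ 2 + (u + v * x) ^ 2 / 8)
        - -(1 / (2 * (1 + h))) * (x - u * v * (1 + h) / 4) ^ 2
        = -(2 * a ^ 2 / (1 + h)) - x ^ 2 / 2 + x ^ 2 / (2 * (1 + h)) + u ^ 2 / 8
          + v ^ 2 * (x ^ 2 / 8 + u ^ 2 * (1 + h) / 32) := by
      field_simp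
      ring
    rw [← sub_eq_zero, e, hv2, hu]
    field_simp
    ring
  have hpi : 0 < √(2 * Real.pi) := Real.sqrt_pos.2 (by positivity)
  rw [← mul_le_mul_iff_of_pos_right hpi, add_mul, mul_assoc q, mul_assoc (1 - q), hG, hG,
    ← integral_const_mul, ← integral_const_mul, ← integral_add ((hI _).const_mul _)
      ((hI _).const_mul _)]
  have hfin : √(1 + h) * √(2 * Real.pi)
      = ∫ x, Real.exp (-(2 * a ^ 2 / (1 + h))) *
          (Real.exp (-(1 / 2) * x ^ 2) * Real.exp ((u + v * x) ^ 2 / 8)) := by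
    simp_rw [hR]
    rw [integral_exp_neg_mul_sub_sq, ← Real.sqrt_mul h1.le]
    congr 1
    field_simp
  rw [hfin]
  refine integral_mono (((hI _).const_mul _).add ((hI _).const_mul _)) ?_ fun x => ?_
  · simp_rw [hR]
    exact integrable_exp_neg_mul_sub_sq (by positivity) _
  · have := bernoulli_hoeffding hq0 hq1 (u + v * x)
    have h3 : 0 ≤ Real.exp (-(2 * a ^ 2 / (1 + h))) * Real.exp (-(1 / 2) * x ^ 2) := by positivity
    have := mul_le_mul_of_nonneg_left this h3
    simp only
    nlinarith

end Scalar

/-! ### Deterministic analysis of the pilot and the one-step estimator. -/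

section Estimators

variable {d : ℕ}

theorem hasDerivAt_logistic_loss (r v : ℝ) :
    HasDerivAt (fun v => -r * Real.log (Real.sigmoid v) - (1 - r) * Real.log (1 - Real.sigmoid v))
      (Real.sigmoid v - r) v := by
  have h := Real.hasDerivAt_sigmoid v
  have h0 := (Real.sigmoid_pos v).ne'
  have h1 := (sub_pos.2 (Real.sigmoid_lt_one v)).ne'
  have h2 := ((h.log h0).const_mul (-r)).sub (((h.const_sub 1).log h1).const_mul (1 - r))
  refine h2.congr_deriv ?_
  field_simp
  ring

/-- The variational inequality satisfied by the constrained minimizer. -/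
theorem IsPilotMin.variational {p : Params} {z : ℕ → Vec d} {r : ℕ → ℝ} {I : Finset ℕ}
    {θ θ' : Vec d} (h : IsPilotMin p z r I θ) (hθ' : ‖θ'‖ ≤ p.B) :
    0 ≤ ∑ i ∈ I, (Real.sigmoid ⟪z i, θ⟫ - r i) * ⟪z i, θ' - θ⟫ + p.lam * ⟪θ, θ' - θ⟫ := by
  set φ : ℝ → ℝ := fun t => pilotLoss p z r I (θ + t • (θ' - θ)) with hφ
  have hd : HasDerivAt φ
      (∑ i ∈ I, (Real.sigmoid ⟪z i, θ⟫ - r i) * ⟪z i, θ' - θ⟫ + p.lam * ⟪θ, θ' - θ⟫) 0 := by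
    have hline : HasDerivAt (fun t : ℝ => θ + t • (θ' - θ)) (θ' - θ) 0 := by
      simpa using ((hasDerivAt_id (0 : ℝ)).smul_const (θ' - θ)).const_add θ
    unfold pilotLoss at hφ
    refine HasDerivAt.add (HasDerivAt.fun_sum fun i _ => ?_) ?_
    · have h1 : HasDerivAt (fun t : ℝ => ⟪z i, θ + t • (θ' - θ)⟫) ⟪z i, θ' - θ⟫ 0 := by
        simpa using (hasDerivAt_const (0 : ℝ) (z i)).inner ℝ hline
      have h2 := hasDerivAt_logistic_loss (r i) ⟪z i, θ + (0 : ℝ) • (θ' - θ)⟫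
      have h3 := h2.comp (0 : ℝ) h1
      simp only [zero_smul, add_zero] at h3
      exact h3
    · have h1 := (hline.norm_sq).const_mul (p.lam / 2)
      refine h1.congr_deriv ?_
      simp
      ring
  -- By convexity the segment stays in the ball, so the difference quotients from the right are
  -- nonnegative.
  refine ge_of_tendsto hd.tendsto_slope_zero_right ?_
  have : Set.Ioc (0 : ℝ) 1 ∈ nhdsWithin (0 : ℝ) (Set.Ioi 0) := Ioc_mem_nhdsGT one_pos
  filter_upwards [this] with t ht
  have hmem : ‖θ + t • (θ' - θ)‖ ≤ p.B := by
    have := (convex_closedBall (0 : Vec d) p.B).add_smul_sub_mem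
      (by simpa using h.1) (by simpa using hθ') ⟨ht.1.le, ht.2⟩
    simpa using this
  have hle := h.2 _ hmem
  have h0 : φ 0 = pilotLoss p z r I θ := by simp [hφ]
  simp only [smul_eq_mul, zero_add]
  refine mul_nonneg (inv_nonneg.2 ht.1.le) (sub_nonneg.2 ?_)
  rw [h0]
  exact hle

/-- Add the two variational inequalities: monotonicity of the sigmoid makes the data terms
nonpositive, and the ridge term leaves `-λ ‖θ - θ'‖² ≥ 0`. Uniqueness later gives continuity, hence
measurability, of the minimizer. -/
theorem IsPilotMin.unique {p : Params} (hlam : 0 < p.lam) {z : ℕ → Vec d} {r : ℕ → ℝ}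
    {I : Finset ℕ} {θ θ' : Vec d} (h : IsPilotMin p z r I θ) (h' : IsPilotMin p z r I θ') :
    θ = θ' := by
  have h1 := h.variational h'.1
  have h2 := h'.variational h.1
  have h3 : ∀ i ∈ I, (Real.sigmoid ⟪z i, θ⟫ - r i) * ⟪z i, θ' - θ⟫
      + (Real.sigmoid ⟪z i, θ'⟫ - r i) * ⟪z i, θ - θ'⟫ ≤ 0 := by
    intro i _
    have hm := Real.sigmoid_monotone.monovary (g := id) monotone_id
    rw [inner_sub_right, inner_sub_right]
    have : 0 ≤ (Real.sigmoid ⟪z i, θ'⟫ - Real.sigmoid ⟪z i, θ⟫) * (⟪z i, θ'⟫ - ⟪z i, θ⟫) := by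
      rcases le_total ⟪z i, θ⟫ ⟪z i, θ'⟫ with hl | hl
      · exact mul_nonneg (sub_nonneg.2 (Real.sigmoid_monotone hl)) (sub_nonneg.2 hl)
      · exact mul_nonneg_of_nonpos_of_nonpos (sub_nonpos.2 (Real.sigmoid_monotone hl))
          (sub_nonpos.2 hl)
    linarith
  have h4 := sum_nonpos h3
  rw [sum_add_distrib] at h4
  have h5 : ⟪θ, θ' - θ⟫ + ⟪θ', θ - θ'⟫ = -‖θ - θ'‖ ^ 2 := by
    rw [← real_inner_self_eq_norm_sq]
    simp only [inner_sub_left, inner_sub_right, real_inner_comm θ' θ]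
    ring
  have h6 : 0 ≤ p.lam * (⟪θ, θ' - θ⟫ + ⟪θ', θ - θ'⟫) := by linarith
  rw [h5] at h6
  have h7 : ‖θ - θ'‖ ^ 2 ≤ 0 := by nlinarith
  have h8 : ‖θ - θ'‖ = 0 := by nlinarith [norm_nonneg (θ - θ')]
  exact sub_eq_zero.1 (norm_eq_zero.1 h8)

/-- The score `∑_{i ∈ I} (r_i - μ(z_iᵀ θ)) z_i`. -/
def score (z : ℕ → Vec d) (r : ℕ → ℝ) (θ : Vec d) (I : Finset ℕ) : Vec d :=
  ∑ i ∈ I, (r i - Real.sigmoid ⟪z i, θ⟫) • z i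

/-- Confidence ellipsoid for the pilot estimator in terms of the score at the true parameter. -/
theorem IsPilotMin.error_le {p : Params} (hB : 0 ≤ p.B) (hκ : 0 < p.κ) (hlam : 0 < p.lam)
    {z : ℕ → Vec d} {r : ℕ → ℝ}
    {I : Finset ℕ} {θ θs : Vec d} (h : IsPilotMin p z r I θ) (hθs : ‖θs‖ ≤ p.B)
    (hc : ∀ i ∈ I, ∀ θ : Vec d, ‖θ‖ ≤ p.B → 1 / p.κ ≤ deriv Real.sigmoid ⟪z i, θ⟫) :
    √((θ - θs).ofLp ⬝ᵥ (design p z I).mulVec (θ - θs).ofLp)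
      ≤ p.κ * √((score z r θs I).ofLp ⬝ᵥ (design p z I)⁻¹.mulVec (score z r θs I).ofLp)
        + p.B * √(p.κ * p.lam) := by
  have hkl : 0 < p.κ * p.lam := mul_pos hκ hlam
  have hV := design_posDef hkl z I
  set Δ := θ - θs with hΔ
  set N := √(Δ.ofLp ⬝ᵥ (design p z I).mulVec Δ.ofLp) with hN
  set M := √((score z r θs I).ofLp ⬝ᵥ (design p z I)⁻¹.mulVec (score z r θs I).ofLp) with hM
  have hN0 : 0 ≤ N := Real.sqrt_nonneg _
  have hM0 : 0 ≤ M := Real.sqrt_nonneg _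
  have hNsq : N ^ 2 = Δ.ofLp ⬝ᵥ (design p z I).mulVec Δ.ofLp :=
    Real.sq_sqrt (quadForm_nonneg hV.posSemidef _)
  have hNform : N ^ 2 = p.κ * p.lam * ‖Δ‖ ^ 2 + ∑ i ∈ I, ⟪z i, Δ⟫ ^ 2 := by
    rw [hNsq, quadForm_design, dotProduct_self_eq_norm_sq]
    simp_rw [inner_eq_dotProduct]
  have hMsq : M ^ 2 = (score z r θs I).ofLp ⬝ᵥ (design p z I)⁻¹.mulVec (score z r θs I).ofLp :=
    Real.sq_sqrt (quadForm_nonneg hV.inv.posSemidef _)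
  have hvar := h.variational hθs
  have hrev : θs - θ = -Δ := by rw [hΔ]; abel
  rw [hrev] at hvar
  simp only [inner_neg_right, mul_neg, sum_neg_distrib] at hvar
  -- Strong monotonicity of the score along the features, from the curvature bound at `θ` and at
  -- `θs`.
  have hmono : (1 / p.κ) * ∑ i ∈ I, ⟪z i, Δ⟫ ^ 2
      ≤ ∑ i ∈ I, (Real.sigmoid ⟪z i, θ⟫ - Real.sigmoid ⟪z i, θs⟫) * ⟪z i, Δ⟫ := by
    rw [mul_sum]
    refine sum_le_sum fun i hi => ?_
    have := mul_sq_le_sigmoid_sub_mul (hc i hi θs hθs) (hc i hi θ h.1)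
    rwa [← inner_sub_right, ← hΔ] at this
  have hsc : ⟪score z r θs I, Δ⟫ = ∑ i ∈ I, (r i - Real.sigmoid ⟪z i, θs⟫) * ⟪z i, Δ⟫ := by
    rw [score, sum_inner]
    simp_rw [real_inner_smul_left]
  have hsplit : ∑ i ∈ I, (Real.sigmoid ⟪z i, θ⟫ - Real.sigmoid ⟪z i, θs⟫) * ⟪z i, Δ⟫
      = ∑ i ∈ I, (Real.sigmoid ⟪z i, θ⟫ - r i) * ⟪z i, Δ⟫ + ⟪score z r θs I, Δ⟫ := by
    rw [hsc, ← sum_add_distrib]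
    exact sum_congr rfl fun i _ => by ring
  have hcs : ⟪score z r θs I, Δ⟫ ≤ M * N := by
    refine abs_le_of_sq_le_sq' ?_ (by positivity) |>.2
    rw [mul_pow, hMsq, hNsq, inner_eq_dotProduct]
    exact sq_dotProduct_le hV _ _
  have hθΔ : ⟪θ, Δ⟫ = ‖Δ‖ ^ 2 + ⟪θs, Δ⟫ := by
    rw [← real_inner_self_eq_norm_sq, ← inner_add_left, hΔ]
    simp
  have hb : -⟪θs, Δ⟫ ≤ p.B * ‖Δ‖ := by
    have h1 := abs_real_inner_le_norm θs Δ
    have h2 := mul_le_mul_of_nonneg_right hθs (norm_nonneg Δ)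
    linarith [neg_abs_le ⟪θs, Δ⟫]
  set R := √(p.κ * p.lam) with hR
  have hR0 : 0 < R := Real.sqrt_pos.2 hkl
  have hRsq : R ^ 2 = p.κ * p.lam := Real.sq_sqrt hkl.le
  have hRΔ : R * ‖Δ‖ ≤ N := by
    refine abs_le_of_sq_le_sq' ?_ hN0 |>.2
    rw [mul_pow, hRsq, hNform]
    have : 0 ≤ ∑ i ∈ I, ⟪z i, Δ⟫ ^ 2 := sum_nonneg fun i _ => sq_nonneg _
    linarith
  have hmain : (1 / p.κ) * N ^ 2 ≤ M * N + p.lam * (p.B * ‖Δ‖) := by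
    have e : (1 / p.κ) * N ^ 2 = p.lam * ‖Δ‖ ^ 2 + (1 / p.κ) * ∑ i ∈ I, ⟪z i, Δ⟫ ^ 2 := by
      rw [hNform]; field_simp
    have := mul_le_mul_of_nonneg_left hb hlam.le
    rw [e]
    nlinarith
  -- The ridge term `κ λ B ‖Δ‖` equals `B R (R ‖Δ‖)` with `R ‖Δ‖ ≤ N`, so every term on the right
  -- carries a factor `N`, which is divided out below.
  have hmain2 : N ^ 2 ≤ (p.κ * M + p.B * R) * N := by
    have h1 := mul_le_mul_of_nonneg_left hmain hκ.le
    have h2 : p.κ * ((1 / p.κ) * N ^ 2) = N ^ 2 := by field_simp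
    have h3 : p.κ * (p.lam * (p.B * ‖Δ‖)) = p.B * R * (R * ‖Δ‖) := by
      rw [show p.B * R * (R * ‖Δ‖) = p.B * R ^ 2 * ‖Δ‖ by ring, hRsq]; ring
    have h4 := mul_le_mul_of_nonneg_left hRΔ (mul_nonneg hB hR0.le)
    rw [h2, mul_add, h3] at h1
    linarith
  rcases hN0.eq_or_lt with h0 | h0
  · rw [← h0]; positivity
  · rw [sq] at hmain2
    exact le_of_mul_le_mul_right hmain2 h0

theorem hessian_posDef {p : Params} (hlam : 0 < p.lam) (z : ℕ → Vec d) (J : Finset ℕ) (θ : Vec d) :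
    (hessian p z J θ).PosDef := by
  refine posDef_smul_one_add_sum hlam _ z J fun i _ => ?_
  rw [Real.deriv_sigmoid]
  exact mul_nonneg (Real.sigmoid_nonneg _) (sub_nonneg.2 (Real.sigmoid_le_one _))

theorem quadForm_hessian (p : Params) (z : ℕ → Vec d) (J : Finset ℕ) (θ : Vec d)
    (v : Fin d → ℝ) :
    v ⬝ᵥ (hessian p z J θ).mulVec v
      = p.lam * (v ⬝ᵥ v) + ∑ i ∈ J, deriv Real.sigmoid ⟪z i, θ⟫ * ((z i).ofLp ⬝ᵥ v) ^ 2 :=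
  quadForm_smul_one_add_sum _ _ _ _ _

/-- `H(θ)⁻¹ x`. -/
def hessianInvVec (p : Params) (z : ℕ → Vec d) (J : Finset ℕ) (θ x : Vec d) : Vec d :=
  WithLp.toLp 2 ((hessian p z J θ)⁻¹.mulVec x.ofLp)

/-- Since `κ μ' ≥ 1`, the design matrix is at most `κ H` in the order of quadratic forms, and
inversion reverses this. -/
theorem hessian_inv_le {p : Params} (hκ : 0 < p.κ) (hlam : 0 < p.lam) {z : ℕ → Vec d}
    {J : Finset ℕ} {θ : Vec d} (hc : ∀ i ∈ J, 1 / p.κ ≤ deriv Real.sigmoid ⟪z i, θ⟫)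
    (x : Vec d) :
    x.ofLp ⬝ᵥ (hessian p z J θ)⁻¹.mulVec x.ofLp ≤ p.κ * matNorm (design p z J)⁻¹ x ^ 2 := by
  have hV := design_posDef (mul_pos hκ hlam) z J
  rw [matNorm_sq hV.inv.posSemidef]
  refine quadForm_inv_le hV (hessian_posDef hlam z J θ) hκ.le (fun v => ?_) _
  rw [quadForm_design, quadForm_hessian, mul_add, mul_sum, ← mul_assoc]
  gcongr with i hi
  have := mul_le_mul_of_nonneg_left (hc i hi) hκ.le
  rw [mul_one_div_cancel hκ.ne'] at this
  nlinarith [sq_nonneg ((z i).ofLp ⬝ᵥ v)]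

/-- `λ ‖y‖² + ∑ μ'_i (z_iᵀ y)² ≤ κ ‖x‖²_{V⁻¹}` for `y = H⁻¹ x`. -/
theorem hessianInvVec_form_le {p : Params} (hκ : 0 < p.κ) (hlam : 0 < p.lam) {z : ℕ → Vec d}
    {J : Finset ℕ} {θ : Vec d} (hc : ∀ i ∈ J, 1 / p.κ ≤ deriv Real.sigmoid ⟪z i, θ⟫)
    (x : Vec d) :
    p.lam * ‖hessianInvVec p z J θ x‖ ^ 2
        + ∑ i ∈ J, deriv Real.sigmoid ⟪z i, θ⟫ * ⟪z i, hessianInvVec p z J θ x⟫ ^ 2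
      ≤ p.κ * matNorm (design p z J)⁻¹ x ^ 2 := by
  refine le_trans (le_of_eq ?_) (hessian_inv_le hκ hlam hc x)
  have h := quadForm_hessian p z J θ (hessianInvVec p z J θ x).ofLp
  rw [dotProduct_self_eq_norm_sq] at h
  simp_rw [← inner_eq_dotProduct] at h
  rw [← h, hessianInvVec, mulVec_inv_mulVec (hessian_posDef hlam z J θ), dotProduct_comm]

/-- Error decomposition of the one-step estimator. -/
theorem inner_oneStep_sub {p : Params} (hlam : 0 < p.lam) (z : ℕ → Vec d) (r : ℕ → ℝ)
    (I J : Finset ℕ) (θs x : Vec d) :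
    ⟪x, oneStep p z r I J⟫ - ⟪x, θs⟫
      = ∑ i ∈ J, ⟪z i, hessianInvVec p z J (pilotEstimator p z r I) x⟫
            * (r i - Real.sigmoid ⟪z i, θs⟫)
        + ∑ i ∈ J, ⟪z i, hessianInvVec p z J (pilotEstimator p z r I) x⟫
            * (Real.sigmoid ⟪z i, θs⟫ - Real.sigmoid ⟪z i, pilotEstimator p z r I⟫
              - deriv Real.sigmoid ⟪z i, pilotEstimator p z r I⟫
                * (⟪z i, θs⟫ - ⟪z i, pilotEstimator p z r I⟫))
        - p.lam * ⟪θs, hessianInvVec p z J (pilotEstimator p z r I) x⟫ := by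
  set θ := pilotEstimator p z r I with hθ
  set y := hessianInvVec p z J θ x with hy
  have hH := hessian_posDef hlam z J θ
  have h1 : ⟪x, WithLp.toLp 2 ((hessian p z J θ)⁻¹.mulVec (gradTerm p z r J θ).ofLp)⟫
      = ⟪gradTerm p z r J θ, y⟫ := by
    rw [inner_eq_dotProduct, inner_eq_dotProduct, hy, hessianInvVec]
    exact dotProduct_mulVec_comm_of_isHermitian hH.inv.1 _ _
  -- Writing `x = H y` exposes the first-order part of the error, which the Newton correction
  -- cancels up to the Taylor remainder.
  have h2 : ⟪x, θ - θs⟫ = p.lam * ⟪θ - θs, y⟫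
      + ∑ i ∈ J, deriv Real.sigmoid ⟪z i, θ⟫ * ⟪z i, y⟫ * ⟪z i, θ - θs⟫ := by
    have hx : x.ofLp = (hessian p z J θ).mulVec y.ofLp := by
      rw [hy, hessianInvVec, mulVec_inv_mulVec hH]
    rw [inner_eq_dotProduct, hx, dotProduct_comm, hessian, Matrix.add_mulVec, dotProduct_add,
      Matrix.sum_mulVec, dotProduct_sum, Matrix.smul_mulVec, Matrix.one_mulVec, dotProduct_smul,
      smul_eq_mul, inner_eq_dotProduct]
    congr 1
    refine sum_congr rfl fun i _ => ?_
    rw [Matrix.smul_mulVec, dotProduct_smul, outer, quadForm_vecMulVec, smul_eq_mul,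
      inner_eq_dotProduct, inner_eq_dotProduct (z i) (θ - θs), inner_eq_dotProduct (z i) y]
    ring
  have h3 : ⟪gradTerm p z r J θ, y⟫
      = ∑ i ∈ J, (r i - Real.sigmoid ⟪z i, θ⟫) * ⟪z i, y⟫ - p.lam * ⟪θ, y⟫ := by
    rw [gradTerm, inner_sub_left, sum_inner]
    simp_rw [real_inner_smul_left]
  rw [oneStep, ← hθ, inner_add_right, h1, h3, add_sub_right_comm, ← inner_sub_right, h2,
    inner_sub_left, mul_sub]
  have h4 : ∀ A B C D E F : ℝ, A + B = C + D → E - F + A + (B - E) = C + D - F := by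
    intros; linarith
  refine h4 _ _ _ _ _ _ ?_
  rw [← sum_add_distrib, ← sum_add_distrib]
  refine sum_congr rfl fun i _ => ?_
  rw [inner_sub_right]
  ring

/-- Deterministic error bound for the one-step estimator. -/
theorem abs_inner_oneStep_sub_le {p : Params} (hκ : 0 < p.κ) (hlam : 0 < p.lam)
    (hB : 0 ≤ p.B) {z : ℕ → Vec d} {r : ℕ → ℝ}
    {I J : Finset ℕ} {θs x : Vec d} (hθs : ‖θs‖ ≤ p.B)
    (hc : ∀ i ∈ J, ∀ θ : Vec d, ‖θ‖ ≤ p.B →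
      1 / p.κ ≤ deriv Real.sigmoid ⟪z i, θ⟫ ∧ deriv Real.sigmoid ⟪z i, θ⟫ ≤ p.Lmu)
    {e A a : ℝ} (he1 : e ≤ 1) (hA : 0 ≤ A)
    (hpil : ∀ i ∈ J, ⟪z i, pilotEstimator p z r I - θs⟫ ^ 2 ≤ e)
    (hcard : p.κ * (p.Lmu * J.card * e ^ 2) ≤ A ^ 2)
    (hnoise : |∑ i ∈ J, ⟪z i, hessianInvVec p z J (pilotEstimator p z r I) x⟫
            * (r i - Real.sigmoid ⟪z i, θs⟫)| ≤ a * matNorm (design p z J)⁻¹ x) :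
    |⟪x, oneStep p z r I J⟫ - ⟪x, θs⟫|
      ≤ (a + A + p.B * √(p.κ * p.lam)) * matNorm (design p z J)⁻¹ x := by
  have hθ := (isPilotMin_pilotEstimator p hB z r I).1
  set θ := pilotEstimator p z r I
  have hform := hessianInvVec_form_le hκ hlam (fun i hi => (hc i hi θ hθ).1) x
  rw [inner_oneStep_sub hlam]
  set y := hessianInvVec p z J θ x
  set N := matNorm (design p z J)⁻¹ x
  have hN : 0 ≤ N := matNorm_nonneg _ _
  have hderiv : ∀ i ∈ J, 0 ≤ deriv Real.sigmoid ⟪z i, θ⟫ := fun i hi =>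
    (one_div_nonneg.2 hκ.le).trans (hc i hi θ hθ).1
  have hsum0 : 0 ≤ ∑ i ∈ J, deriv Real.sigmoid ⟪z i, θ⟫ * ⟪z i, y⟫ ^ 2 :=
    sum_nonneg fun i hi => mul_nonneg (hderiv i hi) (sq_nonneg _)
  -- Cauchy–Schwarz together with `λ ‖y‖² ≤ κ N²`.
  have hreg : |p.lam * ⟪θs, y⟫| ≤ p.B * √(p.κ * p.lam) * N := by
    refine abs_le_of_sq_le_sq ?_ (by positivity)
    have h1 : ⟪θs, y⟫ ^ 2 ≤ p.B ^ 2 * ‖y‖ ^ 2 := by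
      rw [← mul_pow, ← sq_abs]
      exact pow_le_pow_left₀ (abs_nonneg _) ((abs_real_inner_le_norm _ _).trans
        (mul_le_mul_of_nonneg_right hθs (norm_nonneg _))) 2
    rw [mul_pow, mul_pow, mul_pow, Real.sq_sqrt (by positivity)]
    have h2 : p.lam * ‖y‖ ^ 2 ≤ p.κ * N ^ 2 := by linarith
    calc p.lam ^ 2 * ⟪θs, y⟫ ^ 2 ≤ p.lam ^ 2 * (p.B ^ 2 * ‖y‖ ^ 2) := by gcongr
      _ = p.B ^ 2 * p.lam * (p.lam * ‖y‖ ^ 2) := by ring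
      _ ≤ p.B ^ 2 * p.lam * (p.κ * N ^ 2) := by gcongr
      _ = _ := by ring
  have hbias : |∑ i ∈ J, ⟪z i, y⟫ * (Real.sigmoid ⟪z i, θs⟫ - Real.sigmoid ⟪z i, θ⟫
      - deriv Real.sigmoid ⟪z i, θ⟫ * (⟪z i, θs⟫ - ⟪z i, θ⟫))| ≤ A * N := by
    -- `μ'` is split into two square roots for Cauchy–Schwarz: one factor builds the `H`-form of
    -- `y`, at most `κ N²`; the other gives `Lmu |J| e²`.
    have h1 : ∀ i ∈ J, |⟪z i, y⟫ * (Real.sigmoid ⟪z i, θs⟫ - Real.sigmoid ⟪z i, θ⟫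
      - deriv Real.sigmoid ⟪z i, θ⟫ * (⟪z i, θs⟫ - ⟪z i, θ⟫))|
        ≤ (√(deriv Real.sigmoid ⟪z i, θ⟫) * |⟪z i, y⟫|) * (√(deriv Real.sigmoid ⟪z i, θ⟫) * e) := by
      intro i hi
      have hsq : (⟪z i, θs⟫ - ⟪z i, θ⟫) ^ 2 ≤ e := by
        have := hpil i hi
        rw [inner_sub_right] at this
        linarith [sub_sq_comm ⟪z i, θs⟫ ⟪z i, θ⟫]
      have habs : |⟪z i, θs⟫ - ⟪z i, θ⟫| ≤ 1 := by
        refine abs_le_of_sq_le_sq ?_ zero_le_one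
        rw [one_pow]; exact hsq.trans he1
      have h2 := abs_sigmoid_sub_sub_le habs
      have h3 : deriv Real.sigmoid ⟪z i, θ⟫ * (⟪z i, θs⟫ - ⟪z i, θ⟫) ^ 2
          ≤ deriv Real.sigmoid ⟪z i, θ⟫ * e := mul_le_mul_of_nonneg_left hsq (hderiv i hi)
      rw [abs_mul]
      calc _ ≤ |⟪z i, y⟫| * (deriv Real.sigmoid ⟪z i, θ⟫ * e) :=
            mul_le_mul_of_nonneg_left (h2.trans h3) (abs_nonneg _)
        _ = |⟪z i, y⟫| * (√(deriv Real.sigmoid ⟪z i, θ⟫) ^ 2 * e) := by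
            rw [Real.sq_sqrt (hderiv i hi)]
        _ = _ := by ring
    refine (abs_sum_le_sum_abs _ _).trans ((sum_le_sum h1).trans ?_)
    refine abs_le_of_sq_le_sq' ?_ (by positivity) |>.2
    refine (sum_mul_sq_le_sq_mul_sq _ _ _).trans ?_
    have h4 : ∑ i ∈ J, (√(deriv Real.sigmoid ⟪z i, θ⟫) * |⟪z i, y⟫|) ^ 2 ≤ p.κ * N ^ 2 := by
      have : ∀ i ∈ J, (√(deriv Real.sigmoid ⟪z i, θ⟫) * |⟪z i, y⟫|) ^ 2
          = deriv Real.sigmoid ⟪z i, θ⟫ * ⟪z i, y⟫ ^ 2 := fun i hi => by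
        rw [mul_pow, Real.sq_sqrt (hderiv i hi), sq_abs]
      rw [sum_congr rfl this]
      have : 0 ≤ p.lam * ‖y‖ ^ 2 := by positivity
      linarith
    have h5 : ∑ i ∈ J, (√(deriv Real.sigmoid ⟪z i, θ⟫) * e) ^ 2 ≤ p.Lmu * J.card * e ^ 2 := by
      have : ∀ i ∈ J, (√(deriv Real.sigmoid ⟪z i, θ⟫) * e) ^ 2 ≤ p.Lmu * e ^ 2 := fun i hi => by
        rw [mul_pow, Real.sq_sqrt (hderiv i hi)]
        exact mul_le_mul_of_nonneg_right (hc i hi θ hθ).2 (sq_nonneg _)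
      refine (sum_le_sum this).trans (le_of_eq ?_)
      rw [sum_const, nsmul_eq_mul]; ring
    have h6 : 0 ≤ ∑ i ∈ J, (√(deriv Real.sigmoid ⟪z i, θ⟫) * e) ^ 2 :=
      sum_nonneg fun i _ => sq_nonneg _
    calc _ ≤ p.κ * N ^ 2 * (p.Lmu * J.card * e ^ 2) := mul_le_mul h4 h5 h6 (by positivity)
      _ = p.κ * (p.Lmu * J.card * e ^ 2) * N ^ 2 := by ring
      _ ≤ A ^ 2 * N ^ 2 := mul_le_mul_of_nonneg_right hcard (sq_nonneg _)
      _ = (A * N) ^ 2 := by ring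
  refine (abs_sub _ _).trans ((add_le_add_left (abs_add_le _ _) _).trans ?_)
  rw [add_mul, add_mul]
  exact add_le_add (add_le_add hnoise hbias) hreg

end Estimators

/-! ### What estimates, widths and stopping levels depend on. -/

section Congruence

variable {d K : ℕ}

theorem pilotEstimator_congr (p : Params) {z z' : ℕ → Vec d} {r r' : ℕ → ℝ} {I : Finset ℕ}
    (hz : ∀ i ∈ I, z i = z' i) (hr : ∀ i ∈ I, r i = r' i) :
    pilotEstimator p z r I = pilotEstimator p z' r' I := by
  have h : pilotLoss p z r I = pilotLoss p z' r' I := by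
    funext θ
    rw [pilotLoss, pilotLoss, sum_congr rfl fun i hi => by rw [hz i hi, hr i hi]]
  rw [pilotEstimator, pilotEstimator]
  congr 1
  funext θ
  rw [IsPilotMin, IsPilotMin, h]

theorem hessian_congr (p : Params) {z z' : ℕ → Vec d} {J : Finset ℕ}
    (hz : ∀ i ∈ J, z i = z' i) (θ : Vec d) : hessian p z J θ = hessian p z' J θ := by
  rw [hessian, hessian, sum_congr rfl fun i hi => by rw [hz i hi]]

theorem oneStep_congr (p : Params) {z z' : ℕ → Vec d} {r r' : ℕ → ℝ} {I J : Finset ℕ}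
    (hz : ∀ i ∈ I ∪ J, z i = z' i) (hr : ∀ i ∈ I ∪ J, r i = r' i) :
    oneStep p z r I J = oneStep p z' r' I J := by
  have hg : ∀ θ, gradTerm p z r J θ = gradTerm p z' r' J θ := fun θ => by
    rw [gradTerm, gradTerm, sum_congr rfl fun i hi => by
      rw [hz i (mem_union_right _ hi), hr i (mem_union_right _ hi)]]
  rw [oneStep, oneStep, pilotEstimator_congr p (fun i hi => hz i (mem_union_left _ hi))
    (fun i hi => hr i (mem_union_left _ hi)), hg,
    hessian_congr p fun i hi => hz i (mem_union_right _ hi)]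

theorem State.m_congr {p : Params} {st st' : State K} {x x' : ℕ → Fin K → Vec d} {r r' : ℕ → ℝ}
    {t s : ℕ} (hP : st.pilot s = st'.pilot s) (hE : st.est s = st'.est s)
    (hf : ∀ i ∈ st.pilot s ∪ st.est s, st.feat x i = st'.feat x' i)
    (hr : ∀ i ∈ st.pilot s ∪ st.est s, r i = r' i) (hx : x t = x' t) :
    st.m p x r t s = st'.m p x' r' t s := by
  funext a
  rw [State.m, State.m, ← hP, ← hE, oneStep_congr p hf hr, hx]

theorem State.w_congr {p : Params} {st st' : State K} {x x' : ℕ → Fin K → Vec d}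
    {t s : ℕ} (hE : st.est s = st'.est s)
    (hf : ∀ i ∈ st.est s, st.feat x i = st'.feat x' i) (hx : x t = x' t) :
    st.w p x t s = st'.w p x' t s := by
  funext a
  rw [State.w, State.w, ← hE, design_congr p hf, hx]

/-- Only estimates strictly below level `s` enter. This strictness, against widths up to and
including `s` in the next lemmas, is the origin of the decoupling. -/
theorem armSet_congr {m m' : ℕ → Fin K → ℝ} {s : ℕ} (h : ∀ s' < s, m s' = m' s') :
    armSet m s = armSet m' s := by
  induction s with
  | zero => rfl
  | succ s ih =>
    cases s with
    | zero => rfl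
    | succ s => rw [armSet, armSet, ih fun s' hs => h s' (by omega), h (s + 1) (by omega)]

theorem condA_congr {m m' w w' : ℕ → Fin K → ℝ} {s : ℕ} (h : ∀ s' < s, m s' = m' s')
    (hw : w s = w' s) : condA m w s ↔ condA m' w' s := by
  rw [condA, condA, armSet_congr h, hw]

theorem condB_congr {T : ℕ} {m m' w w' : ℕ → Fin K → ℝ} {s : ℕ} (h : ∀ s' < s, m s' = m' s')
    (hw : w s = w' s) : condB T m w s ↔ condB T m' w' s := by
  rw [condB, condB, armSet_congr h, hw]

theorem stopLevel_mem {p : Params} (hT : 1 ≤ p.T) (m w : ℕ → Fin K → ℝ) :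
    1 ≤ stopLevel p.T m w ∧
      (condA m w (stopLevel p.T m w) ∨ condB p.T m w (stopLevel p.T m w)) :=
  Nat.sInf_mem (s := {s | 1 ≤ s ∧ (condA m w s ∨ condB p.T m w s)})
    ⟨p.S + 1, by omega, loop_stops p hT m w⟩

theorem stopLevel_le_of_congr {p : Params} (hT : 1 ≤ p.T) {m m' w w' : ℕ → Fin K → ℝ} {s : ℕ}
    (h : ∀ s' < s, m s' = m' s') (hw : ∀ s' ≤ s, w s' = w' s')
    (hs : stopLevel p.T m w ≤ s) : stopLevel p.T m' w' ≤ stopLevel p.T m w := by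
  obtain ⟨h1, h2⟩ := stopLevel_mem hT m w
  refine Nat.sInf_le ⟨h1, ?_⟩
  rwa [← condA_congr (fun s' hs' => h s' (by omega)) (hw _ hs),
    ← condB_congr (fun s' hs' => h s' (by omega)) (hw _ hs)]

/-- Agreement up to level `s` does not tell where the loop stops beyond `s`, but such a round leaves
the sets of levels up to `s` untouched anyway. -/
theorem stopLevel_congr {p : Params} (hT : 1 ≤ p.T) {m m' w w' : ℕ → Fin K → ℝ} {s : ℕ}
    (h : ∀ s' < s, m s' = m' s') (hw : ∀ s' ≤ s, w s' = w' s') :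
    stopLevel p.T m w = stopLevel p.T m' w' ∨
      (s < stopLevel p.T m w ∧ s < stopLevel p.T m' w') := by
  have h' : ∀ s' < s, m' s' = m s' := fun s' hs' => (h s' hs').symm
  have hw' : ∀ s' ≤ s, w' s' = w s' := fun s' hs' => (hw s' hs').symm
  by_cases h1 : stopLevel p.T m w ≤ s
  · have h2 := stopLevel_le_of_congr hT h hw h1
    exact Or.inl (le_antisymm (stopLevel_le_of_congr hT h' hw' (h2.trans h1)) h2)
  · by_cases h2 : stopLevel p.T m' w' ≤ s
    · have h3 := stopLevel_le_of_congr hT h' hw' h2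
      omega
    · omega

end Congruence

/-! ### The effect of one round on the state. -/

section Step

variable {d K : ℕ} (p : Params) (tie : ℕ → Finset (Fin K) → Fin K)
  (x : ℕ → Fin K → Vec d) (r : ℕ → ℝ) (t : ℕ) (st : State K)

/-- The level at which round `t` stops. -/
def State.level : ℕ := stopLevel p.T (st.m p x r t) (st.w p x t)

/-- The arm pulled in round `t` if case (a) applies. -/
def State.armA : Fin K :=
  tie t (argmaxSet (armSet (st.m p x r t) (st.level p x r t)) (st.w p x t (st.level p x r t)))

/-- The arm pulled in round `t` if case (b) applies. -/
def State.armB : Fin K :=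
  tie t (argmaxSet (armSet (st.m p x r t) (st.level p x r t)) (st.m p x r t (st.level p x r t)))

/-- Case (a) applies in round `t`. -/
def State.caseA : Prop := condA (st.m p x r t) (st.w p x t) (st.level p x r t)

/-- The squared pilot norm compared with the splitting threshold. -/
def State.pilotNormSq (s : ℕ) (a : Fin K) : ℝ :=
  matNorm (design p (st.feat x) (st.pilot s))⁻¹ (x t a) ^ 2

theorem State.step_of_not_caseA (h : ¬ st.caseA p x r t) :
    State.step p tie x r t st
      = ⟨Function.update st.act t (st.armB p tie x r t), st.pilot, st.est⟩ :=
  if_neg h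

open Classical in
theorem State.step_of_pilot (h : st.caseA p x r t)
    (hτ : p.tau d (st.level p x r t)
      < st.pilotNormSq p x t (st.level p x r t) (st.armA p tie x r t)) :
    State.step p tie x r t st
      = ⟨Function.update st.act t (st.armA p tie x r t),
          Function.update st.pilot (st.level p x r t)
            (insert t (st.pilot (st.level p x r t))), st.est⟩ := by
  refine (if_pos h).trans ((if_pos hτ).trans ?_)
  congr

open Classical in
theorem State.step_of_est (h : st.caseA p x r t)
    (hτ : ¬ p.tau d (st.level p x r t)
      < st.pilotNormSq p x t (st.level p x r t) (st.armA p tie x r t)) :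
    State.step p tie x r t st
      = ⟨Function.update st.act t (st.armA p tie x r t), st.pilot,
          Function.update st.est (st.level p x r t)
            (insert t (st.est (st.level p x r t)))⟩ := by
  refine (if_pos h).trans ((if_neg hτ).trans ?_)
  congr

variable {p tie x r t st}

theorem State.step_act_of_ne {i : ℕ} (h : i ≠ t) :
    (State.step p tie x r t st).act i = st.act i := by
  by_cases hA : st.caseA p x r t
  · by_cases hτ : p.tau d (st.level p x r t)
      < st.pilotNormSq p x t (st.level p x r t) (st.armA p tie x r t)
    · rw [State.step_of_pilot p tie x r t st hA hτ]; exact Function.update_of_ne h _ _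
    · rw [State.step_of_est p tie x r t st hA hτ]; exact Function.update_of_ne h _ _
  · rw [State.step_of_not_caseA p tie x r t st hA]; exact Function.update_of_ne h _ _

/-- How the sets change in one round. -/
theorem State.step_sets (s : ℕ) :
    ((State.step p tie x r t st).pilot s = st.pilot s ∧
        (State.step p tie x r t st).est s = st.est s) ∨
    (s = st.level p x r t ∧ st.caseA p x r t ∧
      (State.step p tie x r t st).act t = st.armA p tie x r t ∧
      ((State.step p tie x r t st).pilot s = insert t (st.pilot s) ∧
          (State.step p tie x r t st).est s = st.est s ∨
       (State.step p tie x r t st).pilot s = st.pilot s ∧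
          (State.step p tie x r t st).est s = insert t (st.est s) ∧
          st.pilotNormSq p x t s (st.armA p tie x r t) ≤ p.tau d s)) := by
  by_cases hA : st.caseA p x r t
  · by_cases hτ : p.tau d (st.level p x r t)
      < st.pilotNormSq p x t (st.level p x r t) (st.armA p tie x r t)
    · rw [State.step_of_pilot p tie x r t st hA hτ]
      by_cases hs : s = st.level p x r t
      · subst hs
        exact Or.inr ⟨rfl, hA, Function.update_self .., Or.inl ⟨Function.update_self .., rfl⟩⟩
      · exact Or.inl ⟨Function.update_of_ne hs _ _, rfl⟩
    · rw [State.step_of_est p tie x r t st hA hτ]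
      by_cases hs : s = st.level p x r t
      · subst hs
        exact Or.inr ⟨rfl, hA, Function.update_self ..,
          Or.inr ⟨rfl, Function.update_self .., not_lt.1 hτ⟩⟩
      · exact Or.inl ⟨rfl, Function.update_of_ne hs _ _⟩
  · rw [State.step_of_not_caseA p tie x r t st hA]
    exact Or.inl ⟨rfl, rfl⟩

theorem argmaxSet_nonempty {A : Finset (Fin K)} (hA : A.Nonempty) (f : Fin K → ℝ) :
    (argmaxSet A f).Nonempty := by
  obtain ⟨a, ha, h⟩ := A.exists_max_image f hA
  exact ⟨a, by rw [argmaxSet, mem_filter]; exact ⟨ha, h⟩⟩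

/-- In case (a) the pulled arm has width larger than `2^{-s}`. -/
theorem State.lt_w_armA (htie : ∀ (t : ℕ) (A : Finset (Fin K)), A.Nonempty → tie t A ∈ A)
    (h : st.caseA p x r t) :
    (1 / 2) ^ (st.level p x r t) < st.w p x t (st.level p x r t) (st.armA p tie x r t) := by
  obtain ⟨a, ha, hlt⟩ := h
  have h1 := htie t _ (argmaxSet_nonempty ⟨a, ha⟩ (st.w p x t (st.level p x r t)))
  rw [argmaxSet, mem_filter] at h1
  exact hlt.trans_le (h1.2 a ha)

end Step

/-! ### Monotonicity and bookkeeping along a run. -/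

section Run

variable {d K : ℕ} [NeZero K] {p : Params} {tie : ℕ → Finset (Fin K) → Fin K}
  {x x' : ℕ → Fin K → Vec d} {r r' : ℕ → ℝ}

theorem run_succ (t : ℕ) :
    run p tie x r (t + 1) = State.step p tie x r (t + 1) (run p tie x r t) := rfl

theorem run_sets_succ (t s : ℕ) :
    ((run p tie x r (t + 1)).pilot s = (run p tie x r t).pilot s ∧
        (run p tie x r (t + 1)).est s = (run p tie x r t).est s) ∨
    ((run p tie x r (t + 1)).pilot s = insert (t + 1) ((run p tie x r t).pilot s) ∧
        (run p tie x r (t + 1)).est s = (run p tie x r t).est s) ∨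
    ((run p tie x r (t + 1)).pilot s = (run p tie x r t).pilot s ∧
        (run p tie x r (t + 1)).est s = insert (t + 1) ((run p tie x r t).est s)) := by
  rw [run_succ]
  rcases State.step_sets (p := p) (tie := tie) (x := x) (r := r) (t := t + 1)
    (st := run p tie x r t) s with h | ⟨-, -, -, h | h⟩
  · exact Or.inl h
  · exact Or.inr (Or.inl h)
  · exact Or.inr (Or.inr ⟨h.1, h.2.1⟩)

theorem pilot_mono_succ (t s : ℕ) : (run p tie x r t).pilot s ⊆ (run p tie x r (t + 1)).pilot s := by
  rcases run_sets_succ (p := p) (tie := tie) (x := x) (r := r) t s with h | h | h <;> rw [h.1]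
  exact subset_insert _ _

theorem est_mono_succ (t s : ℕ) : (run p tie x r t).est s ⊆ (run p tie x r (t + 1)).est s := by
  rcases run_sets_succ (p := p) (tie := tie) (x := x) (r := r) t s with h | h | h <;> rw [h.2]
  exact subset_insert _ _

theorem pilot_mono (s : ℕ) : Monotone fun t => (run p tie x r t).pilot s :=
  monotone_nat_of_le_succ fun t => pilot_mono_succ t s

theorem sets_subset (t s : ℕ) :
    (run p tie x r t).pilot s ⊆ Icc 1 t ∧ (run p tie x r t).est s ⊆ Icc 1 t := by
  induction t with
  | zero => exact ⟨by simp [run, State.init], by simp [run, State.init]⟩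
  | succ t ih =>
    have hsub : Icc 1 t ⊆ Icc 1 (t + 1) := Icc_subset_Icc_right (by omega)
    have hmem : t + 1 ∈ Icc 1 (t + 1) := by simp
    have h1 := ih.1.trans hsub
    have h2 := ih.2.trans hsub
    rcases run_sets_succ (p := p) (tie := tie) (x := x) (r := r) t s with h | h | h <;>
      rw [h.1, h.2]
    · exact ⟨h1, h2⟩
    · exact ⟨insert_subset hmem h1, h2⟩
    · exact ⟨h1, insert_subset hmem h2⟩

theorem succ_notMem_pilot (t s : ℕ) : t + 1 ∉ (run p tie x r t).pilot s := fun h => by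
  have := (sets_subset t s).1 h
  simp at this

theorem succ_notMem_est (t s : ℕ) : t + 1 ∉ (run p tie x r t).est s := fun h => by
  have := (sets_subset t s).2 h
  simp at this

theorem act_eq_of_le {i t : ℕ} (h : i ≤ t) :
    (run p tie x r t).act i = (run p tie x r i).act i := by
  induction t, h using Nat.le_induction with
  | base => rfl
  | succ t h ih => rw [run_succ, State.step_act_of_ne (by omega), ih]

theorem feat_eq_of_le {i k t : ℕ} (hk : i ≤ k) (h : i ≤ t) :
    (run p tie x r t).feat x i = (run p tie x r k).feat x i := by
  rw [State.feat, State.feat, act_eq_of_le h, act_eq_of_le hk]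

theorem mem_pilot_iff_of_le {i k t s : ℕ} (hik : i ≤ k) (h : k ≤ t) :
    i ∈ (run p tie x r t).pilot s ↔ i ∈ (run p tie x r k).pilot s := by
  induction t, h using Nat.le_induction with
  | base => rfl
  | succ t h ih =>
    rw [← ih]
    rcases run_sets_succ (p := p) (tie := tie) (x := x) (r := r) t s with h' | h' | h' <;>
      rw [h'.1]
    rw [mem_insert, or_iff_right (by omega)]

theorem mem_est_iff_of_le {i k t s : ℕ} (hik : i ≤ k) (h : k ≤ t) :
    i ∈ (run p tie x r t).est s ↔ i ∈ (run p tie x r k).est s := by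
  induction t, h using Nat.le_induction with
  | base => rfl
  | succ t h ih =>
    rw [← ih]
    rcases run_sets_succ (p := p) (tie := tie) (x := x) (r := r) t s with h' | h' | h' <;>
      rw [h'.2]
    rw [mem_insert, or_iff_right (by omega)]

/-- Identifies the matrices of the elliptic potential sum with those by which the algorithm computed
the width in round `i`. -/
theorem est_filter_lt {i t s : ℕ} (hi : 1 ≤ i) (h : i ≤ t + 1) :
    ((run p tie x r t).est s).filter (· < i) = (run p tie x r (i - 1)).est s := by
  ext j
  rw [mem_filter]
  constructor
  · rintro ⟨hj, hlt⟩
    exact (mem_est_iff_of_le (by omega) (by omega)).1 hj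
  · intro hj
    have := mem_Icc.1 ((sets_subset _ _).2 hj)
    exact ⟨(mem_est_iff_of_le (by omega) (by omega)).2 hj, by omega⟩

/-- What is known about a round that entered the estimation set. -/
theorem est_entry (htie : ∀ (t : ℕ) (A : Finset (Fin K)), A.Nonempty → tie t A ∈ A)
    {i t s : ℕ} (hi : i ∈ (run p tie x r t).est s) :
    (1 / 2) ^ s < p.alpha K * matNorm (design p ((run p tie x r t).feat x)
        (((run p tie x r t).est s).filter (· < i)))⁻¹ ((run p tie x r t).feat x i) ∧
      matNorm (design p ((run p tie x r t).feat x) ((run p tie x r (i - 1)).pilot s))⁻¹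
        ((run p tie x r t).feat x i) ^ 2 ≤ p.tau d s := by
  have hit := mem_Icc.1 ((sets_subset _ _).2 hi)
  rw [est_filter_lt hit.1 (by omega)]
  have hi' : i ∈ (run p tie x r i).est s := (mem_est_iff_of_le le_rfl hit.2).1 hi
  obtain ⟨k, rfl⟩ : ∃ k, i = k + 1 := ⟨i - 1, by omega⟩
  rw [Nat.add_sub_cancel]
  rcases State.step_sets (p := p) (tie := tie) (x := x) (r := r) (t := k + 1)
    (st := run p tie x r k) s with h | ⟨hs, hA, hact, h | h⟩
  · rw [run_succ, h.2] at hi'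
    exact absurd hi' (succ_notMem_est k s)
  · rw [run_succ, h.2] at hi'
    exact absurd hi' (succ_notMem_est k s)
  · have hf : (run p tie x r t).feat x (k + 1)
        = x (k + 1) ((run p tie x r k).armA p tie x r (k + 1)) := by
      rw [State.feat, act_eq_of_le hit.2, run_succ, hact]
    -- Features of rounds up to `k` are never overwritten, so the final features give the matrices
    -- seen in round `k + 1`.
    have hd : ∀ I : Finset ℕ, I ⊆ Icc 1 k →
        design p ((run p tie x r t).feat x) I = design p ((run p tie x r k).feat x) I := by
      intro I hI
      refine design_congr p fun j hj => ?_
      have := mem_Icc.1 (hI hj)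
      exact feat_eq_of_le (by omega) (by omega)
    rw [hf, hd _ (sets_subset k s).1, hd _ (sets_subset k s).2]
    refine ⟨?_, h.2.2⟩
    have := State.lt_w_armA htie hA
    rw [← hs] at this
    exact this

/-- The state at the end of round `t` depends only on the contexts up to round `t` and the rewards
up to round `t - 1`. -/
theorem run_congr {t : ℕ} (hx : ∀ i ∈ Icc 1 t, x i = x' i) (hr : ∀ i ∈ Icc 1 (t - 1), r i = r' i) :
    run p tie x r t = run p tie x' r' t := by
  induction t with
  | zero => rfl
  | succ t ih =>
    have ih' := ih (fun i hi => hx i (Icc_subset_Icc_right (by omega) hi))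
      (fun i hi => hr i (Icc_subset_Icc_right (by omega) hi))
    rw [run_succ, run_succ, ← ih']
    have hsub := fun s => sets_subset (p := p) (tie := tie) (x := x) (r := r) t s
    set st := run p tie x r t
    have hxt : x (t + 1) = x' (t + 1) := hx _ (by simp)
    have hf : ∀ i ∈ Icc 1 t, st.feat x i = st.feat x' i := fun i hi => by
      rw [State.feat, State.feat, hx i (Icc_subset_Icc_right (by omega) hi)]
    have hm : st.m p x r (t + 1) = st.m p x' r' (t + 1) := by
      funext s
      refine State.m_congr rfl rfl (fun i hi => hf i ?_) (fun i hi => hr i ?_) hxt <;>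
        exact union_subset (hsub s).1 (hsub s).2 hi
    have hw : st.w p x (t + 1) = st.w p x' (t + 1) := by
      funext s
      exact State.w_congr rfl (fun i hi => hf i ((hsub s).2 hi)) hxt
    have hd : ∀ s, design p (st.feat x) (st.pilot s) = design p (st.feat x') (st.pilot s) :=
      fun s => design_congr p fun i hi => hf i ((hsub s).1 hi)
    simp only [State.step, hm, hw, hd, hxt]
    congr 1
    rw [hm, hw]

end Run

/-! ### Decoupling of the levels. -/

section Agreement

variable {d K : ℕ} {p : Params} {tie : ℕ → Finset (Fin K) → Fin K}
  {x : ℕ → Fin K → Vec d} {r r' : ℕ → ℝ}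

/-- Two states agree on all levels up to `s`: same sets, and same arms in the rounds of these
sets. -/
structure State.AgreeUpTo (s : ℕ) (st st' : State K) : Prop where
  pilot : ∀ s' ≤ s, st.pilot s' = st'.pilot s'
  est : ∀ s' ≤ s, st.est s' = st'.est s'
  act : ∀ s' ≤ s, ∀ i ∈ st.pilot s' ∪ st.est s', st.act i = st'.act i

/-- Rewards matter for a round only through the estimates, and at levels up to `s` the sets change
only through case (a), which uses estimates below `s`. Case (b) at level `s` may pull different arms
in the two runs, but such a round joins no set; this is why `AgreeUpTo` compares arms only in the
rounds of the sets. -/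
theorem State.AgreeUpTo.step (hT : 1 ≤ p.T) {s t : ℕ} {st st' : State K}
    (h : st.AgreeUpTo s st') (hr : ∀ s' < s, ∀ i ∈ st.pilot s' ∪ st.est s', r i = r' i)
    (ht : ∀ s' ≤ s, t ∉ st.pilot s' ∪ st.est s') :
    (State.step p tie x r t st).AgreeUpTo s (State.step p tie x r' t st') := by
  have hf : ∀ s' ≤ s, ∀ i ∈ st.pilot s' ∪ st.est s', st.feat x i = st'.feat x i :=
    fun s' hs' i hi => by rw [State.feat, State.feat, h.act s' hs' i hi]
  have hm : ∀ s' < s, st.m p x r t s' = st'.m p x r' t s' := fun s' hs' =>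
    State.m_congr (h.pilot s' hs'.le) (h.est s' hs'.le) (hf s' hs'.le) (hr s' hs') rfl
  have hw : ∀ s' ≤ s, st.w p x t s' = st'.w p x t s' := fun s' hs' =>
    State.w_congr (h.est s' hs') (fun i hi => hf s' hs' i (mem_union_right _ hi)) rfl
  have key : ∀ s' ≤ s,
      (State.step p tie x r t st).pilot s' = (State.step p tie x r' t st').pilot s' ∧
      (State.step p tie x r t st).est s' = (State.step p tie x r' t st').est s' ∧
      (t ∈ (State.step p tie x r t st).pilot s' ∪ (State.step p tie x r t st).est s' →
        (State.step p tie x r t st).act t = (State.step p tie x r' t st').act t) := by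
    have unch : ∀ s' ≤ s, (State.step p tie x r t st).pilot s' = st.pilot s' →
        (State.step p tie x r' t st').pilot s' = st'.pilot s' →
        (State.step p tie x r t st).est s' = st.est s' →
        (State.step p tie x r' t st').est s' = st'.est s' →
        (State.step p tie x r t st).pilot s' = (State.step p tie x r' t st').pilot s' ∧
        (State.step p tie x r t st).est s' = (State.step p tie x r' t st').est s' ∧
        (t ∈ (State.step p tie x r t st).pilot s' ∪ (State.step p tie x r t st).est s' →
          (State.step p tie x r t st).act t = (State.step p tie x r' t st').act t) := by
      intro s' hs' h1 h2 h3 h4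
      rw [h1, h2, h3, h4]
      exact ⟨h.pilot s' hs', h.est s' hs', fun hmem => absurd hmem (ht s' hs')⟩
    -- Either both loops stop at the same level, or both go beyond `s`.
    have hlev : st.level p x r t = st'.level p x r' t ∨
        (s < st.level p x r t ∧ s < st'.level p x r' t) := stopLevel_congr hT hm hw
    intro s' hs'
    rcases hlev with hlev | ⟨h1, h2⟩
    swap
    · rcases State.step_sets (p := p) (tie := tie) (x := x) (r := r) (t := t) (st := st) s'
        with h3 | h3
      swap
      · omega
      rcases State.step_sets (p := p) (tie := tie) (x := x) (r := r') (t := t) (st := st') s'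
        with h4 | h4
      swap
      · omega
      exact unch s' hs' h3.1 h4.1 h3.2 h4.2
    by_cases hs : s' = st.level p x r t
    swap
    · rcases State.step_sets (p := p) (tie := tie) (x := x) (r := r) (t := t) (st := st) s'
        with h3 | h3
      swap
      · exact absurd h3.1 hs
      rcases State.step_sets (p := p) (tie := tie) (x := x) (r := r') (t := t) (st := st') s'
        with h4 | h4
      swap
      · exact absurd (h4.1.trans hlev.symm) hs
      exact unch s' hs' h3.1 h4.1 h3.2 h4.2
    have hL : st.level p x r t ≤ s := hs ▸ hs'
    have hmL : ∀ j < st.level p x r t, st.m p x r t j = st'.m p x r' t j := fun j hj =>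
      hm j (by omega)
    have hA : st.caseA p x r t ↔ st'.caseA p x r' t := by
      rw [State.caseA, State.caseA, ← hlev]
      exact condA_congr hmL (hw _ hL)
    have ha : st.armA p tie x r t = st'.armA p tie x r' t := by
      rw [State.armA, State.armA, ← hlev, armSet_congr hmL, hw _ hL]
    have hn : ∀ a, st.pilotNormSq p x t (st.level p x r t) a
        = st'.pilotNormSq p x t (st.level p x r t) a := fun a => by
      rw [State.pilotNormSq, State.pilotNormSq, ← h.pilot _ hL,
        design_congr p fun i hi => hf _ hL i (mem_union_left _ hi)]
    subst hs
    by_cases hcA : st.caseA p x r t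
    · have hcA' := hA.1 hcA
      by_cases hτ : p.tau d (st.level p x r t)
        < st.pilotNormSq p x t (st.level p x r t) (st.armA p tie x r t)
      · have hτ' : p.tau d (st'.level p x r' t)
            < st'.pilotNormSq p x t (st'.level p x r' t) (st'.armA p tie x r' t) := by
          rwa [← hlev, ← ha, ← hn]
        rw [State.step_of_pilot p tie x r t st hcA hτ, State.step_of_pilot p tie x r' t st' hcA' hτ',
          ← ha, ← hlev]
        simp only [Function.update_self]
        exact ⟨by rw [h.pilot _ hL], h.est _ hL, fun _ => trivial⟩
      · have hτ' : ¬ p.tau d (st'.level p x r' t)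
            < st'.pilotNormSq p x t (st'.level p x r' t) (st'.armA p tie x r' t) := by
          rwa [← hlev, ← ha, ← hn]
        rw [State.step_of_est p tie x r t st hcA hτ, State.step_of_est p tie x r' t st' hcA' hτ',
          ← ha, ← hlev]
        simp only [Function.update_self]
        exact ⟨h.pilot _ hL, by rw [h.est _ hL], fun _ => trivial⟩
    -- Case (b): neither state changes its sets.
    · have hcA' := fun h' => hcA (hA.2 h')
      refine unch _ hs' ?_ ?_ ?_ ?_ <;>
        first
          | rw [State.step_of_not_caseA p tie x r t st hcA]
          | rw [State.step_of_not_caseA p tie x r' t st' hcA']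
  refine ⟨fun s' hs' => (key s' hs').1, fun s' hs' => (key s' hs').2.1, fun s' hs' i hi => ?_⟩
  by_cases hit : i = t
  · subst hit
    exact (key s' hs').2.2 hi
  · rw [State.step_act_of_ne hit, State.step_act_of_ne hit]
    refine h.act s' hs' i ?_
    rcases State.step_sets (p := p) (tie := tie) (x := x) (r := r) (t := t) (st := st) s'
      with h3 | ⟨-, -, -, h3 | h3⟩
    · rwa [h3.1, h3.2] at hi
    · rw [h3.1, h3.2, insert_union, mem_insert] at hi
      exact hi.resolve_left hit
    · rw [h3.1, h3.2.1, union_insert, mem_insert] at hi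
      exact hi.resolve_left hit

end Agreement

section Decoupling

variable {d K : ℕ} [NeZero K] {p : Params} {tie : ℕ → Finset (Fin K) → Fin K}
  {x : ℕ → Fin K → Vec d} {r r' : ℕ → ℝ}

/-- The sets of the levels up to `s`, and the arms pulled in their rounds, are determined by the
contexts and the rewards of the levels below `s`. -/
theorem run_agreeUpTo (hT : 1 ≤ p.T) {s t : ℕ}
    (hr : ∀ s' < s, ∀ i ∈ (run p tie x r t).pilot s' ∪ (run p tie x r t).est s', r i = r' i) :
    (run p tie x r (t + 1)).AgreeUpTo s (run p tie x r' (t + 1)) := by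
  have fresh : ∀ t s', t + 1 ∉ (run p tie x r t).pilot s' ∪ (run p tie x r t).est s' := by
    intro t s' h
    rcases mem_union.1 h with h | h
    · exact succ_notMem_pilot _ _ h
    · exact succ_notMem_est _ _ h
  induction t with
  | zero =>
    refine State.AgreeUpTo.step hT ⟨fun _ _ => rfl, fun _ _ => rfl, fun _ _ _ _ => rfl⟩
      (fun s' hs' i hi => hr s' hs' i hi) (fun s' _ => fresh 0 s')
  | succ t ih =>
    refine State.AgreeUpTo.step hT (ih fun s' hs' i hi => hr s' hs' i ?_) hr
      (fun s' _ => fresh (t + 1) s')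
    exact union_subset_union (pilot_mono_succ t s') (est_mono_succ t s') hi

end Decoupling

/-! ### Adapted binary sequences

A binary sequence of length `n` is encoded by the set `b ⊆ {1, …, n}` of the positions of its ones.
-/

section Tree

/-- The probability of the binary sequence `b` if `q i b` is the conditional probability of a one
in position `i`. -/
def treeWeight (q : ℕ → Finset ℕ → ℝ) (n : ℕ) (b : Finset ℕ) : ℝ :=
  ∏ i ∈ Icc 1 n, if i ∈ b then q i b else 1 - q i b

/-- The expectation of `F` under the law with conditional probabilities `q`. -/
def treeSum (q : ℕ → Finset ℕ → ℝ) (n : ℕ) (F : Finset ℕ → ℝ) : ℝ :=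
  ∑ b ∈ (Icc 1 n).powerset, treeWeight q n b * F b

/-- `q i b` is a probability that depends only on the positions before `i`. -/
structure IsTreeKernel (q : ℕ → Finset ℕ → ℝ) : Prop where
  nonneg : ∀ i b, 0 ≤ q i b
  le_one : ∀ i b, q i b ≤ 1
  congr : ∀ i b b', (∀ j < i, j ∈ b ↔ j ∈ b') → q i b = q i b'

variable {q : ℕ → Finset ℕ → ℝ}

theorem treeWeight_nonneg (hq : IsTreeKernel q) (n : ℕ) (b : Finset ℕ) : 0 ≤ treeWeight q n b := by
  refine prod_nonneg fun i _ => ?_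
  split_ifs
  · exact hq.nonneg i b
  · exact sub_nonneg.2 (hq.le_one i b)

theorem treeWeight_congr (hq : IsTreeKernel q) {n : ℕ} {b b' : Finset ℕ}
    (h : ∀ j ≤ n, j ∈ b ↔ j ∈ b') : treeWeight q n b = treeWeight q n b' := by
  refine prod_congr rfl fun i hi => ?_
  have hin := (mem_Icc.1 hi).2
  rw [hq.congr i b b' fun j hj => h j (by omega)]
  simp only [h i hin]

theorem Icc_one_succ (n : ℕ) : Icc 1 (n + 1) = insert (n + 1) (Icc 1 n) := by
  ext i; simp only [mem_Icc, mem_insert]; omega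

theorem succ_notMem_of_subset {n : ℕ} {b : Finset ℕ} (hb : b ⊆ Icc 1 n) : n + 1 ∉ b := fun h => by
  have := mem_Icc.1 (hb h); omega

theorem treeWeight_succ (n : ℕ) (b : Finset ℕ) :
    treeWeight q (n + 1) b
      = (if n + 1 ∈ b then q (n + 1) b else 1 - q (n + 1) b) * treeWeight q n b := by
  rw [treeWeight, Icc_one_succ, prod_insert (by simp), treeWeight]

theorem treeSum_zero (F : Finset ℕ → ℝ) : treeSum q 0 F = F ∅ := by
  simp [treeSum, treeWeight]

/-- Conditioning on the positions before the last one. -/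
theorem treeSum_succ (hq : IsTreeKernel q) (n : ℕ) (F : Finset ℕ → ℝ) :
    treeSum q (n + 1) F = treeSum q n fun b =>
      q (n + 1) b * F (insert (n + 1) b) + (1 - q (n + 1) b) * F b := by
  rw [treeSum, Icc_one_succ, sum_powerset_insert (by simp), ← sum_add_distrib, treeSum]
  refine sum_congr rfl fun b hb => ?_
  have hb' := succ_notMem_of_subset (mem_powerset.1 hb)
  have hag : ∀ j ≤ n, j ∈ insert (n + 1) b ↔ j ∈ b := fun j hj => by
    rw [mem_insert, or_iff_right (by omega)]
  rw [treeWeight_succ, treeWeight_succ, if_neg hb', if_pos (mem_insert_self _ _),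
    treeWeight_congr hq hag, hq.congr (n + 1) (insert (n + 1) b) b fun j hj => hag j (by omega)]
  ring

theorem treeSum_mono (hq : IsTreeKernel q) {n : ℕ} {F G : Finset ℕ → ℝ}
    (h : ∀ b ⊆ Icc 1 n, F b ≤ G b) : treeSum q n F ≤ treeSum q n G :=
  sum_le_sum fun b hb =>
    mul_le_mul_of_nonneg_left (h b (mem_powerset.1 hb)) (treeWeight_nonneg hq n b)

theorem treeSum_congr {n : ℕ} {F G : Finset ℕ → ℝ}
    (h : ∀ b ⊆ Icc 1 n, F b = G b) : treeSum q n F = treeSum q n G :=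
  sum_congr rfl fun b hb => by rw [h b (mem_powerset.1 hb)]

theorem treeSum_const_mul (n : ℕ) (c : ℝ) (F : Finset ℕ → ℝ) :
    treeSum q n (fun b => c * F b) = c * treeSum q n F := by
  rw [treeSum, treeSum, mul_sum]
  exact sum_congr rfl fun b _ => by ring

theorem treeSum_add (n : ℕ) (F G : Finset ℕ → ℝ) :
    treeSum q n (fun b => F b + G b) = treeSum q n F + treeSum q n G := by
  rw [treeSum, treeSum, treeSum, ← sum_add_distrib]
  exact sum_congr rfl fun b _ => by ring

theorem treeSum_sum {ι : Type*} (s : Finset ι) (n : ℕ) (F : ι → Finset ℕ → ℝ) :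
    treeSum q n (fun b => ∑ i ∈ s, F i b) = ∑ i ∈ s, treeSum q n (F i) := by
  simp only [treeSum, mul_sum]
  exact sum_comm

theorem treeSum_one (hq : IsTreeKernel q) (n : ℕ) : treeSum q n (fun _ => 1) = 1 := by
  induction n with
  | zero => exact treeSum_zero _
  | succ n ih =>
    rw [treeSum_succ hq]
    simpa using ih

open Classical in
/-- Ville's maximal inequality. -/
theorem treeSum_ville (hq : IsTreeKernel q) {n : ℕ} {M : ℕ → Finset ℕ → ℝ} {c : ℝ}
    (hadapt : ∀ k b b', (∀ j ≤ k, j ∈ b ↔ j ∈ b') → M k b = M k b')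
    (hM : ∀ k b, 0 ≤ M k b)
    (hsuper : ∀ k < n, ∀ b ⊆ Icc 1 k,
      q (k + 1) b * M (k + 1) (insert (k + 1) b) + (1 - q (k + 1) b) * M (k + 1) b ≤ M k b) :
    c * treeSum q n (fun b => if ∃ k ≤ n, c ≤ M k b then 1 else 0) ≤ M 0 ∅ := by
  -- The process is frozen at the value `c` once it has reached `c`; the expectation of this stopped
  -- process does not increase.
  have hN : ∀ m ≤ n, treeSum q m (fun b => if ∃ k ≤ m, c ≤ M k b then c else M m b) ≤ M 0 ∅ := by
    intro m hm
    induction m with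
    | zero =>
      rw [treeSum_zero]
      split_ifs with h
      · obtain ⟨k, hk, h⟩ := h
        rwa [Nat.le_zero.1 hk] at h
      · exact le_rfl
    | succ m ih =>
      refine le_trans ?_ (ih (by omega))
      rw [treeSum_succ hq]
      refine treeSum_mono hq fun b hb => ?_
      have hag : ∀ k ≤ m, M k (insert (m + 1) b) = M k b := fun k hk =>
        hadapt k _ _ fun j hj => by rw [mem_insert, or_iff_right (by omega)]
      by_cases h : ∃ k ≤ m, c ≤ M k b
      · obtain ⟨k, hk, hc⟩ := h
        rw [if_pos ⟨k, by omega, by rwa [hag k hk]⟩, if_pos ⟨k, by omega, hc⟩, if_pos ⟨k, hk, hc⟩]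
        linarith
      · rw [if_neg h]
        refine le_trans ?_ (hsuper m (by omega) b hb)
        -- On paths that have not crossed by time `m`, the stopped value at `m + 1` is at most `M (m
        -- + 1)`, even if the crossing occurs at that time.
        have hle : ∀ b', (if ∃ k ≤ m + 1, c ≤ M k b' then c else M (m + 1) b') ≤ M (m + 1) b' ∨
            ∃ k ≤ m, c ≤ M k b' := by
          intro b'
          by_cases h' : ∃ k ≤ m + 1, c ≤ M k b'
          · obtain ⟨k, hk, hc⟩ := h'
            rcases Nat.le_succ_iff.1 hk with hk' | hk'
            · exact Or.inr ⟨k, hk', hc⟩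
            · refine Or.inl ?_
              rw [if_pos ⟨k, hk, hc⟩]
              rwa [hk'] at hc
          · rw [if_neg h']; exact Or.inl le_rfl
        have h1 := (hle (insert (m + 1) b)).resolve_right fun ⟨k, hk, hc⟩ =>
          h ⟨k, hk, by rwa [hag k hk] at hc⟩
        have h2 := (hle b).resolve_right h
        exact add_le_add (mul_le_mul_of_nonneg_left h1 (hq.nonneg _ _))
          (mul_le_mul_of_nonneg_left h2 (sub_nonneg.2 (hq.le_one _ _)))
  refine le_trans ?_ (hN n le_rfl)
  rw [← treeSum_const_mul]
  refine treeSum_mono hq fun b _ => ?_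
  split_ifs
  · simp
  · simpa using hM n b

/-- The positions in `R b` are decided by the values in the earlier positions of `R b`, and so are
the positions in `E b` and the conditional probabilities in the positions of `R b ∪ E b`. -/
structure IsDecoupled (q : ℕ → Finset ℕ → ℝ) (n : ℕ) (R E : Finset ℕ → Finset ℕ) : Prop where
  disjoint : ∀ b, ∀ k ∈ R b, k ∉ E b
  congr : ∀ k ∈ Icc 1 n, ∀ b b', (∀ j ∈ Icc 1 n, j < k → j ∈ R b → (j ∈ b ↔ j ∈ b')) →
    (k ∈ R b ↔ k ∈ R b') ∧ (k ∈ E b ↔ k ∈ E b') ∧ (k ∈ R b ∪ E b → q k b = q k b')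

/-- `b` and `c` agree in the positions of `S` up to `m`. -/
def AgreeOn (S : Finset ℕ) (m : ℕ) (b c : Finset ℕ) : Prop :=
  ∀ j ∈ Icc 1 m, j ∈ S → (j ∈ b ↔ j ∈ c)

-- This is conditioning on the values in the positions of `R`, one class of sequences at a time.
-- Integrating out the last position, a position of `R` gives a fixed factor, one of `E` averages
-- its weight to at most `1`, and any other is summed out.
open Classical in
theorem treeSum_class_le (hq : IsTreeKernel q) {n : ℕ} {R E : Finset ℕ → Finset ℕ}
    (hRE : IsDecoupled q n R E) (c : Finset ℕ) (w : ℕ → Bool → ℝ)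
    (hw0 : ∀ k β, 0 ≤ w k β)
    (hw1 : ∀ k ∈ E c, q k c * w k true + (1 - q k c) * w k false ≤ 1) :
    treeSum q n (fun b => if AgreeOn (R c) n b c then
        ∏ k ∈ Icc 1 n, (if k ∈ E c then w k (decide (k ∈ b)) else 1) else 0)
      ≤ treeSum q n (fun b => if AgreeOn (R c) n b c then 1 else 0) := by
  suffices H : ∀ m ≤ n, treeSum q m (fun b => if AgreeOn (R c) m b c then
        ∏ k ∈ Icc 1 m, (if k ∈ E c then w k (decide (k ∈ b)) else 1) else 0)
      ≤ treeSum q m (fun b => if AgreeOn (R c) m b c then 1 else 0) from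
    H n le_rfl
  intro m hm
  induction m with
  | zero => simp [treeSum_zero, AgreeOn]
  | succ m ih =>
    have hag : ∀ b : Finset ℕ, ∀ j ∈ Icc 1 m, (j ∈ insert (m + 1) b ↔ j ∈ b) := fun b j hj => by
      have := (mem_Icc.1 hj).2
      rw [mem_insert, or_iff_right (by omega)]
    have hcls : ∀ b : Finset ℕ, AgreeOn (R c) (m + 1) b c ↔
        (m + 1 ∈ R c → (m + 1 ∈ b ↔ m + 1 ∈ c)) ∧
          AgreeOn (R c) m b c := fun b => by
      rw [AgreeOn, AgreeOn, Icc_one_succ, forall_mem_insert]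
    have hclsi : ∀ b : Finset ℕ, AgreeOn (R c) m (insert (m + 1) b) c ↔
        AgreeOn (R c) m b c := fun b =>
      forall₂_congr fun j hj => by rw [hag b j hj]
    have hprod : ∀ b : Finset ℕ, ∏ k ∈ Icc 1 (m + 1), (if k ∈ E c then w k (decide (k ∈ b)) else 1)
        = (if m + 1 ∈ E c then w (m + 1) (decide (m + 1 ∈ b)) else 1) *
          ∏ k ∈ Icc 1 m, (if k ∈ E c then w k (decide (k ∈ b)) else 1) := fun b => by
      rw [Icc_one_succ, prod_insert (by simp)]
    have hprodi : ∀ b : Finset ℕ, ∏ k ∈ Icc 1 m, (if k ∈ E c then w k (decide (k ∈ insert (m + 1) b)) else 1)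
        = ∏ k ∈ Icc 1 m, (if k ∈ E c then w k (decide (k ∈ b)) else 1) := fun b =>
      prod_congr rfl fun k hk => by simp only [hag b k hk]
    have hpos : ∀ b : Finset ℕ, 0 ≤ ∏ k ∈ Icc 1 m, (if k ∈ E c then w k (decide (k ∈ b)) else 1) :=
      fun b => prod_nonneg fun k _ => by split_ifs <;> [exact hw0 _ _; exact zero_le_one]
    -- The factor by which position `m + 1` changes the mass of the class; it is `1` when that
    -- position is unconstrained.
    set κ : ℝ := if m + 1 ∈ R c then (if m + 1 ∈ c then q (m + 1) c else 1 - q (m + 1) c) else 1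
      with hκ
    have hκ0 : 0 ≤ κ := by
      rw [hκ]
      split_ifs
      · exact hq.nonneg _ _
      · exact sub_nonneg.2 (hq.le_one _ _)
      · exact zero_le_one
    -- Decoupling: within the class, the conditional probabilities in the positions that matter are
    -- those of `c`.
    have hqc : ∀ b : Finset ℕ, AgreeOn (R c) m b c → m + 1 ∈ R c ∪ E c →
        q (m + 1) b = q (m + 1) c := fun b hb hmem =>
      ((hRE.congr (m + 1) (mem_Icc.2 ⟨by omega, hm⟩) c b fun j hj hjm hjR =>
        (hb j (mem_Icc.2 ⟨(mem_Icc.1 hj).1, by omega⟩) hjR).symm).2.2 hmem).symm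
    rw [treeSum_succ hq, treeSum_succ hq]
    have hF := mul_le_mul_of_nonneg_left (ih (by omega)) hκ0
    rw [← treeSum_const_mul, ← treeSum_const_mul] at hF
    refine le_trans (treeSum_mono hq fun b hb => ?_) (hF.trans (le_of_eq
      (treeSum_congr fun b hb => ?_)))
    · have hb' := succ_notMem_of_subset hb
      simp only [hcls, hclsi, hprod, hprodi, mem_insert_self, true_iff, hb', false_iff,
        decide_true, decide_false]
      by_cases hag' : AgreeOn (R c) m b c
      · simp only [hag', and_true, if_true]
        set W := ∏ k ∈ Icc 1 m, (if k ∈ E c then w k (decide (k ∈ b)) else 1)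
        have hW := hpos b
        by_cases hR : m + 1 ∈ R c
        · rw [hqc b hag' (mem_union_left _ hR), hκ]
          have hE := hRE.disjoint c _ hR
          by_cases hc : m + 1 ∈ c <;> simp [hR, hE, hc]
        · by_cases hE : m + 1 ∈ E c
          · rw [hqc b hag' (mem_union_right _ hE), hκ]
            have := mul_le_mul_of_nonneg_right (hw1 _ hE) hW
            simp only [hR, hE, if_true, if_false, false_imp_iff]
            linarith
          · simp only [hR, hE, hκ, if_true, if_false, false_imp_iff]
            linarith
      · simp only [hag', and_false, if_false, mul_zero, add_zero, le_refl]
    · have hb' := succ_notMem_of_subset hb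
      simp only [hcls, hclsi, mem_insert_self, true_iff, hb', false_iff]
      by_cases hag' : AgreeOn (R c) m b c
      · simp only [hag', and_true, if_true]
        by_cases hR : m + 1 ∈ R c
        · rw [hqc b hag' (mem_union_left _ hR), hκ]
          by_cases hc : m + 1 ∈ c <;> simp [hR, hc]
        · simp only [hR, hκ, if_true, if_false, false_imp_iff]
          ring
      · simp only [hag', and_false, if_false, mul_zero, add_zero]

/-- If, given the values in the positions of `R b`, the weights `w b k` have conditional means at
most `1` in the positions of `E b`, then so has their product. -/
theorem treeSum_prod_le_one (hq : IsTreeKernel q) {n : ℕ} {R E : Finset ℕ → Finset ℕ}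
    (hRE : IsDecoupled q n R E) (hE : ∀ b, E b ⊆ Icc 1 n) (w : Finset ℕ → ℕ → Bool → ℝ)
    (hw0 : ∀ b k β, 0 ≤ w b k β)
    (hw1 : ∀ b, ∀ k ∈ E b, q k b * w b k true + (1 - q k b) * w b k false ≤ 1)
    (hw : ∀ b b', (∀ j ∈ Icc 1 n, j ∈ R b → (j ∈ b ↔ j ∈ b')) → ∀ k ∈ E b, w b k = w b' k) :
    treeSum q n (fun b => ∏ k ∈ E b, w b k (decide (k ∈ b))) ≤ 1 := by
  classical
  -- `mask b` is the canonical representative of the class of `b`. Since `R` itself depends on the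
  -- sequence, it has to be checked that the fibres of `mask` are the classes (`hfib`).
  set mask : Finset ℕ → Finset ℕ := fun b => b.filter (· ∈ R b) with hmask
  have hagree : ∀ b, ∀ j ∈ Icc 1 n, j ∈ R b → (j ∈ b ↔ j ∈ mask b) := fun b j _ hj => by
    simp [hmask, hj]
  have hRcongr : ∀ b b', (∀ j ∈ Icc 1 n, j ∈ R b → (j ∈ b ↔ j ∈ b')) → ∀ k ∈ Icc 1 n,
      (k ∈ R b ↔ k ∈ R b') ∧ (k ∈ E b ↔ k ∈ E b') := fun b b' h k hk =>
    ⟨(hRE.congr k hk b b' fun j hj _ => h j hj).1, (hRE.congr k hk b b' fun j hj _ => h j hj).2.1⟩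
  rw [treeSum, ← sum_fiberwise_of_maps_to (t := ((Icc 1 n).powerset).image mask)
    (g := mask) (fun b hb => mem_image_of_mem _ hb)]
  have hone := treeSum_one hq n
  rw [treeSum, ← sum_fiberwise_of_maps_to (t := ((Icc 1 n).powerset).image mask)
    (g := mask) (fun b hb => mem_image_of_mem _ hb)] at hone
  rw [← hone]
  refine sum_le_sum fun c hc => ?_
  obtain ⟨b₀, hb₀, rfl⟩ := mem_image.1 hc
  set c := mask b₀ with hcdef
  have hb₀c := hRcongr b₀ c (hagree b₀)
  have hcR : ∀ j ∈ c, j ∈ R c := fun j hj => by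
    have hj' := mem_filter.1 hj
    exact (hb₀c j (mem_powerset.1 hb₀ hj'.1)).1.1 hj'.2
  have hfib : ∀ b ⊆ Icc 1 n, AgreeOn (R c) n b c ↔ mask b = c := by
    intro b hb
    constructor
    · intro h
      have hR := hRcongr c b fun j hj hjR => (h j hj hjR).symm
      ext j
      rw [hmask, mem_filter]
      constructor
      · rintro ⟨h1, h2⟩
        exact (h j (hb h1) ((hR j (hb h1)).1.2 h2)).1 h1
      · intro hj
        have hjn : j ∈ Icc 1 n := mem_powerset.1 hb₀ (mem_filter.1 hj).1
        exact ⟨(h j hjn (hcR j hj)).2 hj, (hR j hjn).1.1 (hcR j hj)⟩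
    · rintro h j hj hjR
      rw [← h] at hjR ⊢
      exact hagree b j hj (((hRcongr b (mask b) (hagree b)) j hj).1.2 hjR)
  have key := treeSum_class_le hq hRE c (w c) (hw0 c) (hw1 c)
  rw [treeSum, treeSum] at key
  refine le_trans ?_ (key.trans (le_of_eq ?_))
  · rw [sum_filter]
    refine sum_le_sum fun b hb => ?_
    by_cases h : mask b = c
    · rw [if_pos h, if_pos ((hfib b (mem_powerset.1 hb)).2 h)]
      have hbc := hRcongr b c (h ▸ hagree b)
      have hEeq : E b = E c := by
        ext k
        constructor
        · exact fun hk => (hbc k (hE b hk)).2.1 hk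
        · exact fun hk => (hbc k (hE c hk)).2.2 hk
      rw [prod_congr rfl fun k hk => by rw [hw b c (h ▸ hagree b) k hk], hEeq, prod_ite_mem, inter_eq_right.2 (hE c)]
    · rw [if_neg h]
      refine mul_nonneg (treeWeight_nonneg hq n b) ?_
      split_ifs
      · exact prod_nonneg fun k _ => by split_ifs <;> [exact hw0 _ _ _; exact zero_le_one]
      · exact le_rfl
  · rw [sum_filter]
    refine sum_congr rfl fun b hb => ?_
    by_cases h : mask b = c
    · rw [if_pos h, if_pos ((hfib b (mem_powerset.1 hb)).2 h)]
    · rw [if_neg h, if_neg fun h' => h ((hfib b (mem_powerset.1 hb)).1 h'), mul_zero]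

end Tree

/-! ### Optimization of the Bernstein exponent. -/

section Bernstein

/-- The exponent in Bernstein's inequality, with the optimal choice of `η`. -/
theorem bernstein_exponent {v V b ℓ X : ℝ} (hv : 0 < v) (hb : 0 ≤ b) (hℓ : 0 < ℓ)
    (hV : V ≤ v) (hX : √(2 * v * ℓ) + b * ℓ / 3 < X) :
    ℓ ≤ (b / 3 + √(v / (2 * ℓ)))⁻¹ * X
      - (b / 3 + √(v / (2 * ℓ)))⁻¹ ^ 2 * V / (2 * (1 - (b / 3 + √(v / (2 * ℓ)))⁻¹ * b / 3)) := by
  -- With `η = 1 / (b / 3 + u)` the denominator `1 - η b / 3` is `η u`. So the variance term is at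
  -- most `η ℓ u`, while `η X ≥ η (2 ℓ u + b ℓ / 3)`; the difference of these two bounds is exactly
  -- `ℓ`.
  set u := √(v / (2 * ℓ)) with hu
  have hu0 : 0 < u := Real.sqrt_pos.2 (by positivity)
  have hu2 : v = 2 * ℓ * u ^ 2 := by
    rw [hu, Real.sq_sqrt (by positivity)]; field_simp
  have h2 : √(2 * v * ℓ) = 2 * ℓ * u := by
    rw [hu2, show 2 * (2 * ℓ * u ^ 2) * ℓ = (2 * ℓ * u) ^ 2 by ring]
    exact Real.sqrt_sq (by positivity)
  have hs : 0 < b / 3 + u := by positivity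
  have h1 : 1 - (b / 3 + u)⁻¹ * b / 3 = u / (b / 3 + u) := by field_simp; ring
  have h3 : (b / 3 + u)⁻¹ ^ 2 * V / (2 * (u / (b / 3 + u)))
      ≤ (b / 3 + u)⁻¹ ^ 2 * v / (2 * (u / (b / 3 + u))) := by gcongr
  have h4 : (b / 3 + u)⁻¹ ^ 2 * v / (2 * (u / (b / 3 + u))) = (b / 3 + u)⁻¹ * (ℓ * u) := by
    rw [hu2]; field_simp
  rw [h1]
  have h5 : (b / 3 + u)⁻¹ * (2 * ℓ * u + b * ℓ / 3) ≤ (b / 3 + u)⁻¹ * X := by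
    gcongr; rw [← h2]; exact hX.le
  have h6 : (b / 3 + u)⁻¹ * (2 * ℓ * u + b * ℓ / 3) - (b / 3 + u)⁻¹ * (ℓ * u) = ℓ := by
    field_simp; ring
  linarith

end Bernstein

/-! ### The reward law for a fixed context sequence, and its decoupling. -/

section FixedContexts

variable {d K : ℕ} [NeZero K]

/-- The reward sequence with ones exactly in the rounds of `b`. -/
def rewardOf (b : Finset ℕ) : ℕ → ℝ := fun i => if i ∈ b then 1 else 0

theorem rewardOf_eq {b b' : Finset ℕ} {i : ℕ} (h : i ∈ b ↔ i ∈ b') :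
    rewardOf b i = rewardOf b' i := by
  simp only [rewardOf, h]

/-- The mean reward in round `i`. -/
def rewardMean (p : Params) (tie : ℕ → Finset (Fin K) → Fin K) (x : ℕ → Fin K → Vec d)
    (θs : Vec d) (i : ℕ) (b : Finset ℕ) : ℝ :=
  Real.sigmoid ⟪x i (action p tie x (rewardOf b) i), θs⟫

theorem isTreeKernel_rewardMean (p : Params) (tie : ℕ → Finset (Fin K) → Fin K)
    (x : ℕ → Fin K → Vec d) (θs : Vec d) : IsTreeKernel (rewardMean p tie x θs) where
  nonneg _ _ := Real.sigmoid_nonneg _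
  le_one _ _ := Real.sigmoid_le_one _
  congr i b b' h := by
    have : run p tie x (rewardOf b) i = run p tie x (rewardOf b') i := by
      refine run_congr (fun _ _ => rfl) fun j hj => rewardOf_eq (h j ?_)
      have := mem_Icc.1 hj
      omega
    rw [rewardMean, rewardMean, action, action, this]

/-- The standing assumptions, for a fixed context sequence. -/
structure Admissible (p : Params) (x : ℕ → Fin K → Vec d) (θs : Vec d) : Prop where
  T_pos : 1 ≤ p.T
  B_pos : 0 < p.B
  κ_pos : 0 < p.κ
  Lmu_pos : 0 < p.Lmu
  one_le : 1 ≤ p.κ * p.lam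
  δ_pos : 0 < p.δ
  δ_lt : p.δ < 1
  norm_le : ∀ t ∈ Icc 1 p.T, ∀ a, ‖x t a‖ ≤ 1
  norm_param_le : ‖θs‖ ≤ p.B
  curv : ∀ t ∈ Icc 1 p.T, ∀ a, ∀ θ : Vec d, ‖θ‖ ≤ p.B →
      1 / p.κ ≤ deriv Real.sigmoid ⟪x t a, θ⟫ ∧ deriv Real.sigmoid ⟪x t a, θ⟫ ≤ p.Lmu

variable {p : Params} {tie : ℕ → Finset (Fin K) → Fin K} {x : ℕ → Fin K → Vec d} {θs : Vec d}

omit [NeZero K] in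
theorem Admissible.lam_pos (h : Admissible p x θs) : 0 < p.lam :=
  pos_of_mul_pos_right (zero_lt_one.trans_le h.one_le) h.κ_pos.le

/-- A round can be filed only while it is played, and then in a single set of a single level. This
separates the determining rounds from the estimation rounds. -/
theorem mem_est_unique {r : ℕ → ℝ} {i t s : ℕ} (h : i ∈ (run p tie x r t).est s) (s' : ℕ) :
    i ∉ (run p tie x r t).pilot s' ∧ (s' ≠ s → i ∉ (run p tie x r t).est s') := by
  have hit := mem_Icc.1 ((sets_subset _ _).2 h)
  rw [mem_pilot_iff_of_le le_rfl hit.2, mem_est_iff_of_le le_rfl hit.2]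
  rw [mem_est_iff_of_le le_rfl hit.2] at h
  obtain ⟨k, rfl⟩ : ∃ k, i = k + 1 := ⟨i - 1, by omega⟩
  have hP := succ_notMem_pilot (p := p) (tie := tie) (x := x) (r := r) k s'
  have hE := succ_notMem_est (p := p) (tie := tie) (x := x) (r := r) k s'
  have hE' := succ_notMem_est (p := p) (tie := tie) (x := x) (r := r) k s
  rcases State.step_sets (p := p) (tie := tie) (x := x) (r := r) (t := k + 1)
    (st := run p tie x r k) s with h1 | ⟨hs, -, -, h1 | h1⟩ <;> rw [← run_succ] at h1
  · rw [h1.2] at h; exact absurd h hE'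
  · rw [h1.2] at h; exact absurd h hE'
  rcases State.step_sets (p := p) (tie := tie) (x := x) (r := r) (t := k + 1)
    (st := run p tie x r k) s' with h2 | ⟨hs', -, -, h2 | h2⟩ <;> rw [← run_succ] at h2
  · rw [h2.1, h2.2]; exact ⟨hP, fun _ => hE⟩
  · have : s' = s := hs'.trans hs.symm
    subst this
    rw [h2.2] at h; exact absurd h hE
  · rw [h2.1]
    exact ⟨hP, fun hne => absurd (hs'.trans hs.symm) hne⟩

/-- The rounds up to `k` whose rewards determine the level-`s` pilot estimator and the level-`s`
sets: those of the lower levels and of the pilot set. -/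
def determiningRounds (p : Params) (tie : ℕ → Finset (Fin K) → Fin K) (x : ℕ → Fin K → Vec d)
    (s k : ℕ) (b : Finset ℕ) : Finset ℕ :=
  (range s).biUnion (fun s' => (run p tie x (rewardOf b) k).pilot s' ∪
    (run p tie x (rewardOf b) k).est s') ∪ (run p tie x (rewardOf b) k).pilot s

theorem mem_determiningRounds {s k i : ℕ} {b : Finset ℕ} :
    i ∈ determiningRounds p tie x s k b ↔
      (∃ s' < s, i ∈ (run p tie x (rewardOf b) k).pilot s' ∪ (run p tie x (rewardOf b) k).est s') ∨
        i ∈ (run p tie x (rewardOf b) k).pilot s := by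
  simp [determiningRounds]

theorem mem_Icc_of_mem_determiningRounds {s k i : ℕ} {b : Finset ℕ}
    (h : i ∈ determiningRounds p tie x s k b) : i ∈ Icc 1 k := by
  rcases mem_determiningRounds.1 h with ⟨s', -, h⟩ | h
  · exact union_subset (sets_subset _ _).1 (sets_subset _ _).2 h
  · exact (sets_subset _ _).1 h

theorem mem_determiningRounds_iff_of_le {s j k i : ℕ} {b : Finset ℕ} (hij : i ≤ j) (hjk : j ≤ k) :
    i ∈ determiningRounds p tie x s k b ↔ i ∈ determiningRounds p tie x s j b := by
  rw [mem_determiningRounds, mem_determiningRounds, mem_pilot_iff_of_le hij hjk]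
  simp only [mem_union, mem_pilot_iff_of_le hij hjk, mem_est_iff_of_le hij hjk]

/-- `run_agreeUpTo` for binary sequences. The rewards consulted for the state after round `j` come
from earlier rounds, hence `i < j`. -/
theorem agreeUpTo_of_determiningRounds (hT : 1 ≤ p.T) {s j k : ℕ} (hjk : j ≤ k) {b b' : Finset ℕ}
    (h : ∀ i < j, i ∈ determiningRounds p tie x s k b → (i ∈ b ↔ i ∈ b')) :
    (run p tie x (rewardOf b) j).AgreeUpTo s (run p tie x (rewardOf b') j) := by
  cases j with
  | zero => exact ⟨fun _ _ => rfl, fun _ _ => rfl, fun _ _ _ _ => rfl⟩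
  | succ j =>
    refine run_agreeUpTo hT fun s' hs' i hi => rewardOf_eq (h i ?_ ?_)
    · have := mem_Icc.1 (union_subset (sets_subset _ _).1 (sets_subset _ _).2 hi)
      omega
    · have := mem_Icc.1 (union_subset (sets_subset _ _).1 (sets_subset _ _).2 hi)
      rw [mem_determiningRounds_iff_of_le this.2 (by omega)]
      exact mem_determiningRounds.2 (Or.inl ⟨s', hs', hi⟩)

theorem State.AgreeUpTo.mem_determiningRounds_iff {s k : ℕ} {b b' : Finset ℕ}
    (h : (run p tie x (rewardOf b) k).AgreeUpTo s (run p tie x (rewardOf b') k)) (i : ℕ) :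
    i ∈ determiningRounds p tie x s k b ↔ i ∈ determiningRounds p tie x s k b' := by
  rw [mem_determiningRounds, mem_determiningRounds, h.pilot s le_rfl]
  refine or_congr (exists_congr fun s' => and_congr_right fun hs' => ?_) Iff.rfl
  rw [h.pilot s' hs'.le, h.est s' hs'.le]

/-- Lower-level rewards of earlier rounds decide whether round `i` belongs to these sets and, if it
does, which arm it pulls, hence its mean. The level-`s` pilot rounds are counted as determining so
that the pilot estimator too can be held fixed. Rounds after `k` lie in neither set. -/
theorem isDecoupled_rewardMean (hT : 1 ≤ p.T) (s k : ℕ) (n : ℕ) :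
    IsDecoupled (rewardMean p tie x θs) n (determiningRounds p tie x s k)
      (fun b => (run p tie x (rewardOf b) k).est s) where
  disjoint b i hi hE := by
    rcases mem_determiningRounds.1 hi with ⟨s', hs', h⟩ | h
    · rcases mem_union.1 h with h | h
      · exact (mem_est_unique hE s').1 h
      · exact (mem_est_unique hE s').2 hs'.ne h
    · exact (mem_est_unique hE s).1 h
  congr i hi b b' h := by
    by_cases hik : i ≤ k
    · have hag := agreeUpTo_of_determiningRounds (p := p) (tie := tie) (x := x) hT (s := s)
        (b := b) (b' := b') hik fun j hj hjR => by
          have := mem_Icc.1 (mem_Icc_of_mem_determiningRounds hjR)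
          have := mem_Icc.1 hi
          exact h j (mem_Icc.2 ⟨by omega, by omega⟩) hj hjR
      rw [mem_union, mem_determiningRounds_iff_of_le le_rfl hik,
        mem_determiningRounds_iff_of_le le_rfl hik, mem_est_iff_of_le le_rfl hik,
        mem_est_iff_of_le le_rfl hik, hag.est s le_rfl]
      refine ⟨hag.mem_determiningRounds_iff i, Iff.rfl, fun hmem => ?_⟩
      have : ∃ s' ≤ s, i ∈ (run p tie x (rewardOf b) i).pilot s' ∪
          (run p tie x (rewardOf b) i).est s' := by
        rw [← hag.est s le_rfl] at hmem
        rcases hmem with hm | hm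
        · rcases mem_determiningRounds.1 hm with ⟨s', hs', hm⟩ | hm
          · exact ⟨s', hs'.le, hm⟩
          · exact ⟨s, le_rfl, mem_union_left _ hm⟩
        · exact ⟨s, le_rfl, mem_union_right _ hm⟩
      obtain ⟨s', hs', hm⟩ := this
      rw [rewardMean, rewardMean, action, action, hag.act s' hs' i hm]
    · have h1 : ∀ b, i ∉ determiningRounds p tie x s k b := fun b hm => by
        have := mem_Icc.1 (mem_Icc_of_mem_determiningRounds hm)
        omega
      have h2 : ∀ b, i ∉ (run p tie x (rewardOf b) k).est s := fun b hm => by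
        have := mem_Icc.1 ((sets_subset _ _).2 hm)
        omega
      simp [h1, h2]

end FixedContexts

/-! ### Bernstein bound for the noise of the one-step estimator. -/

section Concentration

variable {d K : ℕ} [NeZero K]

/-- `H⁻¹ v` for the level-`s` matrix `H` at the end of round `k`, on the reward sequence `b`. -/
def correction (p : Params) (tie : ℕ → Finset (Fin K) → Fin K) (x : ℕ → Fin K → Vec d)
    (s k : ℕ) (v : Vec d) (b : Finset ℕ) : Vec d :=
  hessianInvVec p ((run p tie x (rewardOf b) k).feat x) ((run p tie x (rewardOf b) k).est s)
    (pilotEstimator p ((run p tie x (rewardOf b) k).feat x) (rewardOf b)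
      ((run p tie x (rewardOf b) k).pilot s)) v

/-- The noise part of the error of the one-step estimator in direction `v`. -/
def estNoise (p : Params) (tie : ℕ → Finset (Fin K) → Fin K) (x : ℕ → Fin K → Vec d) (θs : Vec d)
    (s k : ℕ) (v : Vec d) (b : Finset ℕ) : ℝ :=
  ∑ i ∈ (run p tie x (rewardOf b) k).est s,
    ⟪(run p tie x (rewardOf b) k).feat x i, correction p tie x s k v b⟫ *
      (rewardOf b i - Real.sigmoid ⟪(run p tie x (rewardOf b) k).feat x i, θs⟫)

/-- `‖v‖` in the norm of the inverse level-`s` design matrix of the estimation set. -/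
def estNorm (p : Params) (tie : ℕ → Finset (Fin K) → Fin K) (x : ℕ → Fin K → Vec d)
    (s k : ℕ) (v : Vec d) (b : Finset ℕ) : ℝ :=
  matNorm (design p ((run p tie x (rewardOf b) k).feat x)
    ((run p tie x (rewardOf b) k).est s))⁻¹ v

variable {p : Params} {tie : ℕ → Finset (Fin K) → Fin K} {x : ℕ → Fin K → Vec d} {θs : Vec d}

/-- The weights of the noise do not involve the rewards they multiply: apart from the agreeing sets
and arms, only the pilot rewards enter. -/
theorem correction_congr {s k : ℕ} {b b' : Finset ℕ}
    (h : (run p tie x (rewardOf b) k).AgreeUpTo s (run p tie x (rewardOf b') k))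
    (hb : ∀ i ∈ (run p tie x (rewardOf b) k).pilot s, i ∈ b ↔ i ∈ b') (v : Vec d) :
    correction p tie x s k v b = correction p tie x s k v b' := by
  have hf : ∀ i ∈ (run p tie x (rewardOf b) k).pilot s ∪ (run p tie x (rewardOf b) k).est s,
      (run p tie x (rewardOf b) k).feat x i = (run p tie x (rewardOf b') k).feat x i :=
    fun i hi => by rw [State.feat, State.feat, h.act s le_rfl i hi]
  rw [correction, correction, ← h.est s le_rfl, ← h.pilot s le_rfl,
    pilotEstimator_congr p (fun i hi => hf i (mem_union_left _ hi))
      (fun i hi => rewardOf_eq (hb i hi)), hessianInvVec, hessianInvVec,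
    hessian_congr p fun i hi => hf i (mem_union_right _ hi)]

theorem estNorm_congr {s k : ℕ} {b b' : Finset ℕ}
    (h : (run p tie x (rewardOf b) k).AgreeUpTo s (run p tie x (rewardOf b') k)) (v : Vec d) :
    estNorm p tie x s k v b = estNorm p tie x s k v b' := by
  rw [estNorm, estNorm, ← h.est s le_rfl, design_congr p fun i hi => ?_]
  rw [State.feat, State.feat, h.act s le_rfl i (mem_union_right _ hi)]

theorem Admissible.norm_feat_le (h : Admissible p x θs) {r : ℕ → ℝ} {k i : ℕ}
    (hi : i ∈ Icc 1 p.T) : ‖(run p tie x r k).feat x i‖ ≤ 1 :=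
  h.norm_le i hi _

theorem Admissible.est_subset (_ : Admissible p x θs) {r : ℕ → ℝ} {k s : ℕ} (hk : k ≤ p.T) :
    (run p tie x r k).est s ⊆ Icc 1 p.T :=
  (sets_subset _ _).2.trans (Icc_subset_Icc_right hk)

theorem Admissible.pilot_subset (_ : Admissible p x θs) {r : ℕ → ℝ} {k s : ℕ} (hk : k ≤ p.T) :
    (run p tie x r k).pilot s ⊆ Icc 1 p.T :=
  (sets_subset _ _).1.trans (Icc_subset_Icc_right hk)

theorem rewardMean_eq {k i : ℕ} (hik : i ≤ k) (b : Finset ℕ) :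
    rewardMean p tie x θs i b = Real.sigmoid ⟪(run p tie x (rewardOf b) k).feat x i, θs⟫ := by
  rw [rewardMean, action, State.feat, act_eq_of_le hik]

/-- Bounds on the weights of the noise. -/
theorem Admissible.correction_bounds (h : Admissible p x θs) {s k : ℕ} (hk : k ≤ p.T) (v : Vec d)
    (b : Finset ℕ) :
    (∀ i ∈ (run p tie x (rewardOf b) k).est s,
      |⟪(run p tie x (rewardOf b) k).feat x i, correction p tie x s k v b⟫|
        ≤ √(p.κ / p.lam) * estNorm p tie x s k v b) ∧
    ∑ i ∈ (run p tie x (rewardOf b) k).est s,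
      ⟪(run p tie x (rewardOf b) k).feat x i, correction p tie x s k v b⟫ ^ 2 *
        deriv Real.sigmoid ⟪(run p tie x (rewardOf b) k).feat x i, θs⟫
      ≤ p.Lmu * p.κ ^ 2 * estNorm p tie x s k v b ^ 2 := by
  have hθ := (isPilotMin_pilotEstimator p h.B_pos.le ((run p tie x (rewardOf b) k).feat x)
    (rewardOf b) ((run p tie x (rewardOf b) k).pilot s)).1
  have hsub := h.est_subset (tie := tie) (r := rewardOf b) (s := s) hk
  have hκ := h.κ_pos
  have hlam := h.lam_pos
  have hLmu := h.Lmu_pos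
  have hc : ∀ i ∈ (run p tie x (rewardOf b) k).est s, 1 / p.κ ≤ deriv Real.sigmoid
      ⟪(run p tie x (rewardOf b) k).feat x i, pilotEstimator p ((run p tie x (rewardOf b) k).feat x)
        (rewardOf b) ((run p tie x (rewardOf b) k).pilot s)⟫ :=
    fun i hi => (h.curv i (hsub hi) ((run p tie x (rewardOf b) k).act i) _ hθ).1
  have hform := hessianInvVec_form_le h.κ_pos h.lam_pos hc v
  change p.lam * ‖correction p tie x s k v b‖ ^ 2 + ∑ i ∈ _, _ *
    ⟪(run p tie x (rewardOf b) k).feat x i, correction p tie x s k v b⟫ ^ 2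
      ≤ p.κ * estNorm p tie x s k v b ^ 2 at hform
  have hN : 0 ≤ estNorm p tie x s k v b := matNorm_nonneg _ _
  set y := correction p tie x s k v b
  set N := estNorm p tie x s k v b
  set z := (run p tie x (rewardOf b) k).feat x
  set J := (run p tie x (rewardOf b) k).est s
  -- The lower curvature bound at the pilot estimator turns the `H`-form into `∑ ⟨z_i, y⟩² ≤ κ² N²`;
  -- the upper bound `Lmu` at `θs` then bounds the variance.
  have hterm : ∀ i ∈ J, (1 / p.κ) * ⟪z i, y⟫ ^ 2 ≤ deriv Real.sigmoid ⟪z i, pilotEstimator p z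
      (rewardOf b) ((run p tie x (rewardOf b) k).pilot s)⟫ * ⟪z i, y⟫ ^ 2 := fun i hi =>
    mul_le_mul_of_nonneg_right (hc i hi) (sq_nonneg _)
  have hsum := sum_le_sum hterm
  rw [← mul_sum] at hsum
  have hS0 : 0 ≤ ∑ i ∈ J, ⟪z i, y⟫ ^ 2 := sum_nonneg fun i _ => sq_nonneg _
  have hy0 : 0 ≤ p.lam * ‖y‖ ^ 2 := by positivity
  constructor
  · intro i hi
    have h1 : |⟪z i, y⟫| ≤ ‖y‖ := (abs_real_inner_le_norm _ _).trans
      (mul_le_of_le_one_left (norm_nonneg _) (h.norm_feat_le (hsub hi)))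
    refine h1.trans ?_
    refine abs_le_of_sq_le_sq' ?_ (by positivity) |>.2
    rw [mul_pow, Real.sq_sqrt (by positivity), div_mul_eq_mul_div, le_div_iff₀ hlam]
    have : 0 ≤ (1 / p.κ) * ∑ i ∈ J, ⟪z i, y⟫ ^ 2 := by positivity
    linarith
  · have h1 : (1 / p.κ) * ∑ i ∈ J, ⟪z i, y⟫ ^ 2 ≤ p.κ * N ^ 2 := by linarith
    have h2 : ∑ i ∈ J, ⟪z i, y⟫ ^ 2 ≤ p.κ ^ 2 * N ^ 2 := by
      rw [one_div_mul_eq_div, div_le_iff₀ hκ] at h1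
      linarith
    calc _ ≤ ∑ i ∈ J, ⟪z i, y⟫ ^ 2 * p.Lmu := sum_le_sum fun i hi =>
          mul_le_mul_of_nonneg_left (h.curv i (hsub hi) _ θs h.norm_param_le).2 (sq_nonneg _)
      _ = p.Lmu * ∑ i ∈ J, ⟪z i, y⟫ ^ 2 := by rw [← sum_mul, mul_comm]
      _ ≤ p.Lmu * (p.κ ^ 2 * N ^ 2) := by gcongr
      _ = _ := by ring

open Classical in
/-- Bernstein bound for the noise of the one-step estimator (one side, selected by `σ = ±1`). -/
theorem Admissible.treeSum_estNoise_le (h : Admissible p x θs) {s k : ℕ} (hk : k ≤ p.T) (v : Vec d)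
    {σ : ℝ} (hσ : |σ| = 1) (hℓ : 0 < p.logTerm K) :
    treeSum (rewardMean p tie x θs) p.T (fun b =>
        if p.alpha1 K * estNorm p tie x s k v b < σ * estNoise p tie x θs s k v b then 1 else 0)
      ≤ Real.exp (-p.logTerm K) := by
  have hq := isTreeKernel_rewardMean p tie x θs
  have hκ := h.κ_pos
  have hlam := h.lam_pos
  have hLmu := h.Lmu_pos
  -- For `v = 0` both sides of the strict inequality vanish. Otherwise the variance proxy `V` is
  -- positive, as the choice of `η` requires.
  by_cases hv0 : v = 0
  · have hzero : ∀ b, correction p tie x s k v b = 0 := fun b => by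
      rw [correction, hessianInvVec, hv0]; simp
    have hNz : ∀ b, estNorm p tie x s k v b = 0 := fun b => by
      rw [estNorm, hv0]; simp [matNorm]
    have : ∀ b, ¬ (p.alpha1 K * estNorm p tie x s k v b < σ * estNoise p tie x θs s k v b) :=
      fun b => by rw [hNz, estNoise, hzero]; simp
    simp only [this, if_false]
    simp only [treeSum, mul_zero, sum_const_zero]
    positivity
  set ℓ := p.logTerm K with hℓdef
  have hNpos : ∀ b, 0 < estNorm p tie x s k v b := fun b =>
    matNorm_pos (design_posDef (mul_pos hκ hlam) _ _).inv hv0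
  set N := estNorm p tie x s k v with hN
  set B : Finset ℕ → ℝ := fun b => √(p.κ / p.lam) * N b with hB
  set V : Finset ℕ → ℝ := fun b => p.Lmu * p.κ ^ 2 * N b ^ 2 with hV
  -- The optimal Bernstein parameter may depend on `b`, since `N` is constant on each class of
  -- sequences with equal determining rewards.
  set η : Finset ℕ → ℝ := fun b => (B b / 3 + √(V b / (2 * ℓ)))⁻¹ with hη
  have hB0 : ∀ b, 0 ≤ B b := fun b => mul_nonneg (Real.sqrt_nonneg _) (hNpos b).le
  have hV0 : ∀ b, 0 < V b := fun b => by have := hNpos b; positivity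
  have hu0 : ∀ b, 0 < √(V b / (2 * ℓ)) := fun b =>
    Real.sqrt_pos.2 (div_pos (hV0 b) (by positivity))
  have hη0 : ∀ b, 0 ≤ η b := fun b => inv_nonneg.2 (add_nonneg (by linarith [hB0 b]) (hu0 b).le)
  have hηB : ∀ b, η b * B b < 3 := fun b => by
    rw [hη, inv_mul_lt_iff₀ (by linarith [hB0 b, hu0 b])]
    linarith [hu0 b]
  set c : Finset ℕ → ℕ → ℝ := fun b i =>
    σ * ⟪(run p tie x (rewardOf b) k).feat x i, correction p tie x s k v b⟫ with hc
  set μ : Finset ℕ → ℕ → ℝ := fun b i =>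
    Real.sigmoid ⟪(run p tie x (rewardOf b) k).feat x i, θs⟫ with hμ
  set g : Finset ℕ → ℕ → ℝ := fun b i =>
    η b ^ 2 * (c b i ^ 2 * (μ b i * (1 - μ b i))) / (2 * (1 - η b * B b / 3)) with hg
  set w : Finset ℕ → ℕ → Bool → ℝ := fun b i β =>
    Real.exp (η b * (c b i * ((if β then 1 else 0) - μ b i)) - g b i) with hw
  have hsub : ∀ b, (run p tie x (rewardOf b) k).est s ⊆ Icc 1 p.T := fun b => h.est_subset hk
  have habsc : ∀ b, ∀ i ∈ (run p tie x (rewardOf b) k).est s, |c b i| ≤ B b := fun b i hi => by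
    rw [hc, abs_mul, hσ, one_mul]
    exact (h.correction_bounds hk v b).1 i hi
  have hsqc : ∀ b, ∑ i ∈ (run p tie x (rewardOf b) k).est s, c b i ^ 2 * (μ b i * (1 - μ b i))
      ≤ V b := fun b => by
    refine le_trans (le_of_eq (sum_congr rfl fun i _ => ?_)) (h.correction_bounds hk v b).2
    rw [Real.deriv_sigmoid, hc, mul_pow, ← sq_abs σ, hσ, one_pow, one_mul]
  have hprod := treeSum_prod_le_one hq
    (isDecoupled_rewardMean (tie := tie) (x := x) (θs := θs) h.T_pos s k p.T) hsub w
    (fun b i β => (Real.exp_pos _).le) ?_ ?_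
  rotate_left
  · intro b i hi
    have hik := (mem_Icc.1 ((sets_subset _ _).2 hi)).2
    rw [rewardMean_eq hik]
    have := bernoulli_bernstein (q := μ b i) (Real.sigmoid_nonneg _) (Real.sigmoid_le_one _)
      (hη0 b) (habsc b i hi) (hηB b)
    simp only [hw, Real.exp_sub, if_true]
    rw [mul_div_assoc', mul_div_assoc', ← add_div, div_le_one (Real.exp_pos _)]
    simpa using this
  -- The weights are functions of the determining rewards alone.
  · intro b b' hbb' i hi
    have hag := agreeUpTo_of_determiningRounds (p := p) (tie := tie) (x := x) h.T_pos (s := s)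
        (b := b) (b' := b') (le_refl k) fun j hj hjR => by
          have := mem_Icc.1 (mem_Icc_of_mem_determiningRounds hjR)
          exact hbb' j (mem_Icc.2 ⟨by omega, by omega⟩) hjR
    have hN' : N b = N b' := estNorm_congr hag v
    have hcor := correction_congr hag (fun j hj => hbb' j (h.pilot_subset hk hj)
      (mem_determiningRounds.2 (Or.inr hj))) v
    have hf : (run p tie x (rewardOf b) k).feat x i = (run p tie x (rewardOf b') k).feat x i := by
      rw [State.feat, State.feat, hag.act s le_rfl i (mem_union_right _ hi)]
    funext β
    simp only [hw, hg, hη, hB, hV, hc, hμ, hN', hcor, hf]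
  -- Exponential Markov inequality: on the event the product of the weights is at least `exp ℓ`, and
  -- its mean is at most `1`.
  have hprod' := mul_le_mul_of_nonneg_left hprod (Real.exp_pos (-ℓ)).le
  rw [mul_one, ← treeSum_const_mul] at hprod'
  refine (treeSum_mono hq fun b _ => ?_).trans hprod'
  split_ifs with hlt
  · have hX : √(2 * V b * ℓ) + B b * ℓ / 3 < σ * estNoise p tie x θs s k v b := by
      refine lt_of_eq_of_lt ?_ hlt
      have e1 : √(2 * V b * ℓ) = √(2 * p.Lmu * p.κ ^ 2 * ℓ) * N b := by
        rw [show 2 * V b * ℓ = (2 * p.Lmu * p.κ ^ 2 * ℓ) * N b ^ 2 by rw [hV]; ring,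
          Real.sqrt_mul (by positivity), Real.sqrt_sq (hNpos b).le]
      have e2 : √(p.κ / (9 * p.lam)) = √(p.κ / p.lam) / 3 := by
        rw [show p.κ / (9 * p.lam) = (p.κ / p.lam) / 3 ^ 2 by field_simp; norm_num,
          Real.sqrt_div (by positivity), Real.sqrt_sq (by norm_num)]
      rw [e1, Params.alpha1, ← hℓdef, e2, hB]
      ring
    have hexp := bernstein_exponent (hV0 b) (hB0 b) hℓ (hsqc b) hX
    rw [← Real.exp_sum, ← Real.exp_add]
    refine Real.one_le_exp ?_
    have e3 : ∑ i ∈ (run p tie x (rewardOf b) k).est s,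
        (η b * (c b i * ((if decide (i ∈ b) = true then 1 else 0) - μ b i)) - g b i)
        = η b * (σ * estNoise p tie x θs s k v b) - η b ^ 2 *
          (∑ i ∈ (run p tie x (rewardOf b) k).est s, c b i ^ 2 * (μ b i * (1 - μ b i)))
            / (2 * (1 - η b * B b / 3)) := by
      rw [sum_sub_distrib, estNoise, mul_sum, mul_sum, mul_sum, sum_div]
      congr 1
      refine sum_congr rfl fun i _ => ?_
      simp only [hc, hμ, rewardOf, decide_eq_true_eq]
      ring
    rw [e3]
    linarith
  · exact mul_nonneg (Real.exp_pos _).le (prod_nonneg fun i _ => (Real.exp_pos _).le)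

end Concentration

/-! ### Method of mixtures for the pilot score. -/

section PilotConcentration

variable {d K : ℕ} [NeZero K]

/-- The level-`s` pilot design matrix at the end of round `k`. -/
def pilotDesign (p : Params) (tie : ℕ → Finset (Fin K) → Fin K) (x : ℕ → Fin K → Vec d)
    (s k : ℕ) (b : Finset ℕ) : Matrix (Fin d) (Fin d) ℝ :=
  design p ((run p tie x (rewardOf b) k).feat x) ((run p tie x (rewardOf b) k).pilot s)

/-- The level-`s` pilot score at the true parameter at the end of round `k`. -/
def pilotScore (p : Params) (tie : ℕ → Finset (Fin K) → Fin K) (x : ℕ → Fin K → Vec d)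
    (θs : Vec d) (s k : ℕ) (b : Finset ℕ) : Vec d :=
  score ((run p tie x (rewardOf b) k).feat x) (rewardOf b) θs
    ((run p tie x (rewardOf b) k).pilot s)

/-- `exp (2 ‖S_k‖²_{V_k⁻¹}) det V_0 / det V_k`. -/
def mixture (p : Params) (tie : ℕ → Finset (Fin K) → Fin K) (x : ℕ → Fin K → Vec d)
    (θs : Vec d) (s k : ℕ) (b : Finset ℕ) : ℝ :=
  Real.exp (2 * ((pilotScore p tie x θs s k b).ofLp ⬝ᵥ
    (pilotDesign p tie x s k b)⁻¹.mulVec (pilotScore p tie x θs s k b).ofLp)) *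
    ((p.κ * p.lam) ^ d / (pilotDesign p tie x s k b).det)

variable {p : Params} {tie : ℕ → Finset (Fin K) → Fin K} {x : ℕ → Fin K → Vec d} {θs : Vec d}

theorem score_congr {z z' : ℕ → Vec d} {r r' : ℕ → ℝ} {I : Finset ℕ} (θ : Vec d)
    (hz : ∀ i ∈ I, z i = z' i) (hr : ∀ i ∈ I, r i = r' i) : score z r θ I = score z' r' θ I := by
  rw [score, score, sum_congr rfl fun i hi => by rw [hz i hi, hr i hi]]

theorem run_rewardOf_congr {k : ℕ} {b b' : Finset ℕ} (h : ∀ j < k, j ∈ b ↔ j ∈ b') :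
    run p tie x (rewardOf b) k = run p tie x (rewardOf b') k := by
  refine run_congr (fun _ _ => rfl) fun j hj => rewardOf_eq (h j ?_)
  have := mem_Icc.1 hj
  omega

theorem mixture_congr {s k : ℕ} {b b' : Finset ℕ} (h : ∀ j ≤ k, j ∈ b ↔ j ∈ b') :
    mixture p tie x θs s k b = mixture p tie x θs s k b' := by
  have hrun : run p tie x (rewardOf b) k = run p tie x (rewardOf b') k :=
    run_rewardOf_congr fun j hj => h j hj.le
  have hsc : pilotScore p tie x θs s k b = pilotScore p tie x θs s k b' := by
    rw [pilotScore, pilotScore, ← hrun]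
    refine score_congr θs (fun _ _ => rfl) fun i hi => rewardOf_eq (h i ?_)
    exact (mem_Icc.1 ((sets_subset _ _).1 hi)).2
  rw [mixture, mixture, hsc, pilotDesign, pilotDesign, ← hrun]

theorem Admissible.pilotDesign_posDef (h : Admissible p x θs) (s k : ℕ) (b : Finset ℕ) :
    (pilotDesign p tie x s k b).PosDef :=
  design_posDef (zero_lt_one.trans_le h.one_le) _ _

theorem Admissible.mixture_nonneg (h : Admissible p x θs) (s k : ℕ) (b : Finset ℕ) :
    0 ≤ mixture p tie x θs s k b :=
  mul_nonneg (Real.exp_pos _).le (div_nonneg (pow_nonneg (zero_le_one.trans h.one_le) _)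
    (h.pilotDesign_posDef s k b).det_pos.le)

theorem Admissible.mixture_zero (h : Admissible p x θs) (s : ℕ) (b : Finset ℕ) :
    mixture p tie x θs s 0 b = 1 := by
  have hp : p.κ * p.lam ≠ 0 := (zero_lt_one.trans_le h.one_le).ne'
  have h1 : pilotScore p tie x θs s 0 b = 0 := by simp [pilotScore, score, run, State.init]
  have h2 : (pilotDesign p tie x s 0 b).det = (p.κ * p.lam) ^ d := by
    simp [pilotDesign, run, State.init, det_design_empty]
  rw [mixture, h1, h2]
  simp [div_self (pow_ne_zero d hp)]

theorem pilot_run_succ_eq (s k : ℕ) (b : Finset ℕ)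
    (h : (run p tie x (rewardOf b) (k + 1)).pilot s = (run p tie x (rewardOf b) k).pilot s) :
    mixture p tie x θs s (k + 1) b = mixture p tie x θs s k b := by
  have hf : ∀ i ∈ (run p tie x (rewardOf b) k).pilot s,
      (run p tie x (rewardOf b) (k + 1)).feat x i = (run p tie x (rewardOf b) k).feat x i :=
    fun i hi => by
      have := (mem_Icc.1 ((sets_subset _ _).1 hi)).2
      exact feat_eq_of_le this (by omega)
  rw [mixture, mixture, pilotDesign, pilotDesign, pilotScore, pilotScore, h, design_congr p hf,
    score_congr θs hf fun _ _ => rfl]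

/-- The rank-one updates of the inverse form and of the determinant make the one-step ratio a
function of the reward deviation and of two scalars known before the reward, the form needed for
`bernoulli_mixture`. -/
theorem Admissible.mixture_succ (h : Admissible p x θs) {s k : ℕ} {b : Finset ℕ}
    (hk : (run p tie x (rewardOf b) (k + 1)).pilot s
      = insert (k + 1) ((run p tie x (rewardOf b) k).pilot s)) (z : Fin d → ℝ)
    (hz : z = (x (k + 1) (action p tie x (rewardOf b) (k + 1))).ofLp) :
    mixture p tie x θs s (k + 1) b = mixture p tie x θs s k b *
      (Real.exp (2 * ((2 * (rewardOf b (k + 1) - rewardMean p tie x θs (k + 1) b) *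
          (z ⬝ᵥ (pilotDesign p tie x s k b)⁻¹.mulVec (pilotScore p tie x θs s k b).ofLp)
        + (rewardOf b (k + 1) - rewardMean p tie x θs (k + 1) b) ^ 2 *
          (z ⬝ᵥ (pilotDesign p tie x s k b)⁻¹.mulVec z)
        - (z ⬝ᵥ (pilotDesign p tie x s k b)⁻¹.mulVec (pilotScore p tie x θs s k b).ofLp) ^ 2) /
          (1 + z ⬝ᵥ (pilotDesign p tie x s k b)⁻¹.mulVec z)))
        / (1 + z ⬝ᵥ (pilotDesign p tie x s k b)⁻¹.mulVec z)) := by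
  have hV := h.pilotDesign_posDef (tie := tie) s k b
  have hnot : k + 1 ∉ (run p tie x (rewardOf b) k).pilot s := succ_notMem_pilot k s
  have hf : ∀ i ∈ (run p tie x (rewardOf b) k).pilot s,
      (run p tie x (rewardOf b) (k + 1)).feat x i = (run p tie x (rewardOf b) k).feat x i :=
    fun i hi => by
      have := (mem_Icc.1 ((sets_subset _ _).1 hi)).2
      exact feat_eq_of_le this (by omega)
  have hD : pilotDesign p tie x s (k + 1) b = pilotDesign p tie x s k b + Matrix.vecMulVec z z := by
    rw [pilotDesign, hk, design_insert p _ hnot, design_congr p hf, hz]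
    rfl
  have hS : (pilotScore p tie x θs s (k + 1) b).ofLp = (pilotScore p tie x θs s k b).ofLp +
      (rewardOf b (k + 1) - rewardMean p tie x θs (k + 1) b) • z := by
    have : pilotScore p tie x θs s (k + 1) b
        = (rewardOf b (k + 1) - rewardMean p tie x θs (k + 1) b) •
          x (k + 1) (action p tie x (rewardOf b) (k + 1)) + pilotScore p tie x θs s k b := by
      rw [pilotScore, hk, score, sum_insert hnot, pilotScore]
      congr 1
      exact score_congr θs hf fun _ _ => rfl
    rw [this, hz, add_comm]
    rfl
  have hh : 0 ≤ z ⬝ᵥ (pilotDesign p tie x s k b)⁻¹.mulVec z := quadForm_nonneg hV.inv.posSemidef z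
  rw [mixture, mixture, hD, hS, quadForm_inv_update hV, det_add_vecMulVec_self hV, mul_add,
    Real.exp_add]
  have := hV.det_pos
  field_simp

/-- In a pilot round the ratio has conditional mean at most `√(1 + h) / (1 + h) ≤ 1` by
`bernoulli_mixture`; in any other round nothing changes. Since the arm is chosen before the reward,
adaptivity does no harm. -/
theorem Admissible.mixture_supermartingale (h : Admissible p x θs) (s k : ℕ) (b : Finset ℕ)
    (hb : b ⊆ Icc 1 k) :
    rewardMean p tie x θs (k + 1) b * mixture p tie x θs s (k + 1) (insert (k + 1) b)
      + (1 - rewardMean p tie x θs (k + 1) b) * mixture p tie x θs s (k + 1) b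
      ≤ mixture p tie x θs s k b := by
  have hq := isTreeKernel_rewardMean p tie x θs
  have hag : ∀ j < k + 1, j ∈ insert (k + 1) b ↔ j ∈ b := fun j hj => by
    rw [mem_insert, or_iff_right (by omega)]
  have hrun := run_rewardOf_congr (p := p) (tie := tie) (x := x) hag
  have hrun' := run_rewardOf_congr (p := p) (tie := tie) (x := x) (k := k) fun j hj =>
    hag j (by omega)
  have hmean := hq.congr (k + 1) _ _ hag
  have hmix := mixture_congr (p := p) (tie := tie) (x := x) (θs := θs) (s := s) (k := k)
    fun j hj => hag j (by omega)
  have hM := h.mixture_nonneg (tie := tie) s k b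
  rcases run_sets_succ (p := p) (tie := tie) (x := x) (r := rewardOf b) k s with h1 | h1 | h1
  · rw [pilot_run_succ_eq s k b h1.1, pilot_run_succ_eq s k _ (by rw [hrun, hrun', h1.1]), hmix]
    linarith
  · set z := (x (k + 1) (action p tie x (rewardOf b) (k + 1))).ofLp with hz
    have hD : pilotDesign p tie x s k (insert (k + 1) b) = pilotDesign p tie x s k b := by
      rw [pilotDesign, pilotDesign, hrun']
    have hS : pilotScore p tie x θs s k (insert (k + 1) b) = pilotScore p tie x θs s k b := by
      rw [pilotScore, pilotScore, hrun']
      refine score_congr θs (fun _ _ => rfl) fun i hi => rewardOf_eq (hag i ?_)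
      have := (mem_Icc.1 ((sets_subset _ _).1 hi)).2
      omega
    have e1 := h.mixture_succ (s := s) (b := insert (k + 1) b) (by rw [hrun, hrun', h1.1]) z
      (by rw [hz, action, action, hrun])
    have e0 := h.mixture_succ h1.1 z hz
    have hr1 : rewardOf (insert (k + 1) b) (k + 1) = 1 := by simp [rewardOf]
    have hr0 : rewardOf b (k + 1) = 0 := by simp [rewardOf, succ_notMem_of_subset hb]
    rw [hD, hS, hr1, hmean, hmix] at e1
    rw [hr0] at e0
    rw [e1, e0]
    have hh : 0 ≤ z ⬝ᵥ (pilotDesign p tie x s k b)⁻¹.mulVec z :=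
      quadForm_nonneg (h.pilotDesign_posDef s k b).inv.posSemidef z
    have key := bernoulli_mixture (hq.nonneg (k + 1) b) (hq.le_one (k + 1) b) hh
      (a := z ⬝ᵥ (pilotDesign p tie x s k b)⁻¹.mulVec (pilotScore p tie x θs s k b).ofLp)
    set hv := z ⬝ᵥ (pilotDesign p tie x s k b)⁻¹.mulVec z
    -- The square root is given away: `β` leaves room for the full determinant ratio instead of its
    -- root.
    have hsq : √(1 + hv) ≤ 1 + hv := by
      rw [Real.sqrt_le_left (by linarith)]
      nlinarith
    have key2 := key.trans hsq
    set M := mixture p tie x θs s k b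
    set q := rewardMean p tie x θs (k + 1) b
    have hpos : 0 < 1 + hv := by linarith
    have : ∀ A C : ℝ, q * A + (1 - q) * C ≤ 1 + hv →
        q * (M * (A / (1 + hv))) + (1 - q) * (M * (C / (1 + hv))) ≤ M := fun A C hAC => by
      have e : q * (M * (A / (1 + hv))) + (1 - q) * (M * (C / (1 + hv)))
          = M * ((q * A + (1 - q) * C) / (1 + hv)) := by ring
      rw [e]
      exact mul_le_of_le_one_right hM ((div_le_one hpos).2 hAC)
    exact this _ _ key2
  · rw [pilot_run_succ_eq s k b h1.1, pilot_run_succ_eq s k _ (by rw [hrun, hrun', h1.1]), hmix]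
    linarith

open Classical in
theorem Admissible.treeSum_mixture_le (h : Admissible p x θs) (s : ℕ) {c : ℝ} (hc : 0 < c) :
    treeSum (rewardMean p tie x θs) p.T
        (fun b => if ∃ k ≤ p.T, c ≤ mixture p tie x θs s k b then 1 else 0) ≤ 1 / c := by
  have := treeSum_ville (isTreeKernel_rewardMean p tie x θs) (n := p.T)
    (M := mixture p tie x θs s) (c := c) (fun k b b' hbb' => mixture_congr hbb')
    (fun k b => h.mixture_nonneg s k b) (fun k _ b hb => h.mixture_supermartingale s k b hb)
  rw [h.mixture_zero] at this
  rwa [le_div_iff₀ hc, mul_comm]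

omit [NeZero K] in
theorem Admissible.dimTerm_pos [NeZero d] (h : Admissible p x θs) : 0 < p.dimTerm d := by
  have hd : (0 : ℝ) < d := by exact_mod_cast Nat.pos_of_ne_zero (NeZero.ne d)
  have hT : (0 : ℝ) < p.T := by exact_mod_cast h.T_pos
  have := h.κ_pos
  have := h.lam_pos
  refine mul_pos hd (Real.log_pos ?_)
  have : 0 < (p.T : ℝ) / (p.κ * p.lam * d) := by positivity
  linarith

omit [NeZero K] in
theorem Admissible.beta_pos (h : Admissible p x θs) : 0 < p.beta d := by
  have := h.κ_pos
  have := h.lam_pos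
  have := h.B_pos
  rw [Params.beta]
  positivity

/-- If the mixture stays below `2S/δ`, the pilot estimator is within `β` of the parameter. -/
theorem Admissible.pilot_error_le [NeZero d] (h : Admissible p x θs) {s k : ℕ} (hk : k ≤ p.T)
    {b : Finset ℕ} (hb : mixture p tie x θs s k b < 2 * p.S / p.δ) :
    (pilotEstimator p ((run p tie x (rewardOf b) k).feat x) (rewardOf b)
        ((run p tie x (rewardOf b) k).pilot s) - θs).ofLp ⬝ᵥ
      (pilotDesign p tie x s k b).mulVec
        (pilotEstimator p ((run p tie x (rewardOf b) k).feat x) (rewardOf b)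
        ((run p tie x (rewardOf b) k).pilot s) - θs).ofLp ≤ p.beta d ^ 2 := by
  have hkl : 0 < p.κ * p.lam := zero_lt_one.trans_le h.one_le
  have hV := h.pilotDesign_posDef (tie := tie) s k b
  have hsub := h.pilot_subset (tie := tie) (r := rewardOf b) (s := s) hk
  have herr := (isPilotMin_pilotEstimator p h.B_pos.le ((run p tie x (rewardOf b) k).feat x)
    (rewardOf b) ((run p tie x (rewardOf b) k).pilot s)).error_le h.B_pos.le h.κ_pos h.lam_pos
    h.norm_param_le fun i hi θ hθ => (h.curv i (hsub hi) _ θ hθ).1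
  refine (Real.sqrt_le_left h.beta_pos.le).1 (herr.trans ?_)
  rw [Params.beta]
  refine add_le_add_left (mul_le_mul_of_nonneg_left (Real.sqrt_le_sqrt ?_) h.κ_pos.le) _
  have hdet := log_det_design_sub_le hkl ((run p tie x (rewardOf b) k).feat x)
    ((run p tie x (rewardOf b) k).pilot s) (fun i hi => h.norm_feat_le (hsub hi))
    (by simpa using card_le_card hsub)
  have hmix0 : 0 < mixture p tie x θs s k b :=
    mul_pos (Real.exp_pos _) (div_pos (pow_pos hkl _) hV.det_pos)
  -- Logarithms give `2 ‖S‖²_{V⁻¹} ≤ log (2S / δ) + log (det V / det V₀)`, which is the radicand of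
  -- `β` after halving.
  have hlog := (Real.log_lt_log hmix0 hb).le
  rw [mixture, Real.log_mul (Real.exp_pos _).ne' (div_pos (pow_pos hkl _) hV.det_pos).ne',
    Real.log_exp, Real.log_div (pow_pos hkl _).ne' hV.det_pos.ne'] at hlog
  rw [det_design_empty] at hdet
  change Real.log (pilotDesign p tie x s k b).det - _ ≤ _ at hdet
  change (pilotScore p tie x θs s k b).ofLp ⬝ᵥ (pilotDesign p tie x s k b)⁻¹.mulVec
    (pilotScore p tie x θs s k b).ofLp ≤ _
  linarith

end PilotConcentration

/-! ### The error bound and the union bound for fixed contexts. -/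

section FixedContextBound

variable {d K : ℕ} [NeZero K] {p : Params} {tie : ℕ → Finset (Fin K) → Fin K}
  {x : ℕ → Fin K → Vec d} {θs : Vec d}

theorem Admissible.logTerm_pos (h : Admissible p x θs) (hS : 1 ≤ p.S) :
    0 < p.logTerm K := by
  have hT : (1 : ℝ) ≤ p.T := by exact_mod_cast h.T_pos
  have hS' : (1 : ℝ) ≤ p.S := by exact_mod_cast hS
  have hK : (1 : ℝ) ≤ K := by exact_mod_cast Nat.pos_of_ne_zero (NeZero.ne K)
  refine Real.log_pos ?_
  rw [lt_div_iff₀ h.δ_pos, one_mul]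
  have h1 : (1 : ℝ) ≤ p.T * p.S := one_le_mul_of_one_le_of_one_le hT hS'
  have h2 : (1 : ℝ) ≤ p.T * p.S * K := one_le_mul_of_one_le_of_one_le h1 hK
  have := h.δ_lt
  nlinarith

/-- The error bound holds unless the noise or the pilot score is large. -/
theorem Admissible.estimate_error_le [NeZero d] (h : Admissible p x θs)
    (htie : ∀ (t : ℕ) (A : Finset (Fin K)), A.Nonempty → tie t A ∈ A) (hS : 1 ≤ p.S)
    {t s : ℕ} (ht : t ∈ Icc 1 p.T) (a : Fin K) {b : Finset ℕ}
    (hmix : mixture p tie x θs s (t - 1) b < 2 * p.S / p.δ)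
    (hnoise : |estNoise p tie x θs s (t - 1) (x t a) b|
      ≤ p.alpha1 K * estNorm p tie x s (t - 1) (x t a) b) :
    |estimate p tie x (rewardOf b) t s a - ⟪x t a, θs⟫| ≤ width p tie x (rewardOf b) t s a := by
  have hκ := h.κ_pos
  have hlam := h.lam_pos
  have hLmu := h.Lmu_pos
  have hBpos := h.B_pos
  have hD := h.dimTerm_pos
  have hβ := h.beta_pos
  have hkl : 0 < p.κ * p.lam := mul_pos hκ hlam
  have hℓ := h.logTerm_pos hS
  have hk : t - 1 ≤ p.T := by have := mem_Icc.1 ht; omega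
  have hpil := h.pilot_error_le hk hmix
  rw [estimate, width, State.m, State.w]
  change _ ≤ p.alpha K * estNorm p tie x s (t - 1) (x t a) b
  have hN : 0 ≤ estNorm p tie x s (t - 1) (x t a) b := matNorm_nonneg _ _
  have hα1 : 0 ≤ p.alpha1 K := by rw [Params.alpha1]; positivity
  have hα2 : 0 ≤ p.alpha2 := by rw [Params.alpha2]; positivity
  have hα : p.alpha K = 2 * (p.alpha1 K + p.alpha2) := rfl
  have hsubE := h.est_subset (tie := tie) (r := rewardOf b) (s := s) hk
  have hentry := fun i hi => est_entry (p := p) (x := x) (r := rewardOf b) (t := t - 1) (s := s)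
    (i := i) htie hi
  set ε : ℝ := (1 / 2) ^ s / √(32 * p.Lmu * p.κ * p.dimTerm d) with hε
  have hε0 : 0 ≤ ε := by positivity
  -- Here `min 1 ε = τ β²` bounds the squared pilot deviations. Noise and ridge use `α₁ + α₂ = α /
  -- 2` and the remainder `α / 4`.
  have hbound := abs_inner_oneStep_sub_le (p := p) hκ hlam hBpos.le
    (z := (run p tie x (rewardOf b) (t - 1)).feat x) (r := rewardOf b)
    (I := (run p tie x (rewardOf b) (t - 1)).pilot s)
    (J := (run p tie x (rewardOf b) (t - 1)).est s) (θs := θs) (x := x t a) h.norm_param_le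
    (fun i hi θ hθ => h.curv i (hsubE hi) _ θ hθ) (e := min 1 ε) (A := p.alpha K / 4)
    (a := p.alpha1 K) (min_le_left _ _) (by rw [hα]; positivity) ?_ ?_ hnoise
  · refine hbound.trans (mul_le_mul_of_nonneg_right ?_ hN)
    change p.alpha1 K + p.alpha K / 4 + p.alpha2 ≤ _
    linarith
  -- The entry test in round `i` used the pilot set of round `i - 1`; the pilot set only grows, so
  -- the norm tested there dominates the present one.
  · intro i hi
    have hI := (sets_subset (p := p) (tie := tie) (x := x) (r := rewardOf b) (t - 1) s).2 hi
    have h1 := sq_dotProduct_le (h.pilotDesign_posDef (tie := tie) s (t - 1) b)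
      ((run p tie x (rewardOf b) (t - 1)).feat x i).ofLp
      (pilotEstimator p ((run p tie x (rewardOf b) (t - 1)).feat x) (rewardOf b)
        ((run p tie x (rewardOf b) (t - 1)).pilot s) - θs).ofLp
    rw [← inner_eq_dotProduct] at h1
    have h2 := (hentry i hi).2
    rw [matNorm_sq (design_posDef hkl _ _).inv.posSemidef] at h2
    have h3 := quadForm_design_inv_anti hkl ((run p tie x (rewardOf b) (t - 1)).feat x)
      (pilot_mono (p := p) (tie := tie) (x := x) (r := rewardOf b) s
        (show i - 1 ≤ t - 1 by have := mem_Icc.1 hI; omega))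
      ((run p tie x (rewardOf b) (t - 1)).feat x i).ofLp
    have h4 : p.tau d s * p.beta d ^ 2 = min 1 ε := by
      rw [Params.tau, ← hε]; field_simp
    rw [← h4]
    refine h1.trans (mul_le_mul (h3.trans h2) hpil
      (quadForm_nonneg (h.pilotDesign_posDef s (t - 1) b).posSemidef _) ?_)
    rw [Params.tau]; positivity
  · set J := (run p tie x (rewardOf b) (t - 1)).est s with hJ
    set z := (run p tie x (rewardOf b) (t - 1)).feat x with hz
    have hpot := sum_quadForm_design_inv_le h.one_le z J fun i hi => h.norm_feat_le (hsubE hi)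
    have hdet := log_det_design_sub_le hkl z J (fun i hi => h.norm_feat_le (hsubE hi))
      (by simpa using card_le_card hsubE)
    -- Every round of the estimation set had width above `2^{-s}` when it entered, and the squared
    -- norms sum to at most `2 D`.
    have hcard : (J.card : ℝ) * ((1 / 2) ^ s) ^ 2 ≤ p.alpha K ^ 2 * (2 * p.dimTerm d) := by
      rw [← nsmul_eq_mul, ← sum_const]
      calc ∑ i ∈ J, ((1 / 2 : ℝ) ^ s) ^ 2 ≤ ∑ i ∈ J, p.alpha K ^ 2 *
            ((z i).ofLp ⬝ᵥ (design p z (J.filter (· < i)))⁻¹.mulVec (z i).ofLp) := by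
            refine sum_le_sum fun i hi => ?_
            rw [← matNorm_sq (design_posDef hkl _ _).inv.posSemidef, ← mul_pow]
            exact pow_le_pow_left₀ (by positivity) (hentry i hi).1.le 2
        _ ≤ _ := by
            rw [← mul_sum]
            refine mul_le_mul_of_nonneg_left ?_ (sq_nonneg _)
            linarith
    have hmin : min 1 ε ^ 2 ≤ ε ^ 2 :=
      pow_le_pow_left₀ (le_min zero_le_one hε0) (min_le_right _ _) 2
    have hε2 : ε ^ 2 = ((1 / 2) ^ s) ^ 2 / (32 * p.Lmu * p.κ * p.dimTerm d) := by
      rw [hε, div_pow, Real.sq_sqrt (by positivity)]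
    -- The 32 in `τ` is chosen for this: `2 / 32 = (1 / 4)²`.
    calc p.κ * (p.Lmu * J.card * min 1 ε ^ 2) ≤ p.κ * (p.Lmu * J.card * ε ^ 2) := by gcongr
      _ = (J.card * ((1 / 2) ^ s) ^ 2) / (32 * p.dimTerm d) := by rw [hε2]; field_simp
      _ ≤ (p.alpha K ^ 2 * (2 * p.dimTerm d)) / (32 * p.dimTerm d) := by gcongr
      _ = (p.alpha K / 4) ^ 2 := by field_simp; ring

open Classical in
/-- For every fixed context sequence, the probability of a violated error bound is at most `δ`. -/
theorem Admissible.treeSum_bad_le [NeZero d] (h : Admissible p x θs)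
    (htie : ∀ (t : ℕ) (A : Finset (Fin K)), A.Nonempty → tie t A ∈ A) (hS : 1 ≤ p.S) :
    treeSum (rewardMean p tie x θs) p.T (fun b =>
      if ∃ t ∈ Icc 1 p.T, ∃ s ∈ Icc 1 p.S, ∃ a : Fin K, width p tie x (rewardOf b) t s a
        < |estimate p tie x (rewardOf b) t s a - ⟪x t a, θs⟫| then 1 else 0) ≤ p.δ := by
  have hq := isTreeKernel_rewardMean p tie x θs
  have hℓ := h.logTerm_pos hS
  have hδ := h.δ_pos
  have hT' : (1 : ℝ) ≤ p.T := by exact_mod_cast h.T_pos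
  have hS' : (1 : ℝ) ≤ p.S := by exact_mod_cast hS
  have hK' : (1 : ℝ) ≤ K := by exact_mod_cast Nat.pos_of_ne_zero (NeZero.ne K)
  have hc : (0 : ℝ) < 2 * p.S / p.δ := by positivity
  set N : ℝ → ℕ → ℕ → Fin K → Finset ℕ → ℝ := fun σ t s a b =>
    if p.alpha1 K * estNorm p tie x s (t - 1) (x t a) b
      < σ * estNoise p tie x θs s (t - 1) (x t a) b then 1 else 0 with hN
  set M : ℕ → Finset ℕ → ℝ := fun s b =>
    if ∃ k ≤ p.T, 2 * p.S / p.δ ≤ mixture p tie x θs s k b then 1 else 0 with hM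
  have hN0 : ∀ σ t s a b, 0 ≤ N σ t s a b := fun σ t s a b => by
    simp only [hN]; split_ifs <;> simp
  have hM0 : ∀ s b, 0 ≤ M s b := fun s b => by simp only [hM]; split_ifs <;> simp
  have hpt : ∀ b ⊆ Icc 1 p.T, (if ∃ t ∈ Icc 1 p.T, ∃ s ∈ Icc 1 p.S, ∃ a : Fin K,
      width p tie x (rewardOf b) t s a
        < |estimate p tie x (rewardOf b) t s a - ⟪x t a, θs⟫| then (1 : ℝ) else 0)
      ≤ ∑ s ∈ Icc 1 p.S, (M s b + ∑ t ∈ Icc 1 p.T, ∑ a, (N 1 t s a b + N (-1) t s a b)) := by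
    intro b _
    have hin : ∀ s, 0 ≤ ∑ t ∈ Icc 1 p.T, ∑ a, (N 1 t s a b + N (-1) t s a b) := fun s =>
      sum_nonneg fun t _ => sum_nonneg fun a _ => add_nonneg (hN0 _ _ _ _ _) (hN0 _ _ _ _ _)
    split_ifs with hbad
    · obtain ⟨t, ht, s, hs, a, hlt⟩ := hbad
      refine le_trans ?_ (single_le_sum (f := fun s => M s b + ∑ t ∈ Icc 1 p.T, ∑ a,
        (N 1 t s a b + N (-1) t s a b)) (fun s _ => add_nonneg (hM0 s b) (hin s)) hs)
      by_cases hm : ∃ k ≤ p.T, 2 * p.S / p.δ ≤ mixture p tie x θs s k b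
      · have : M s b = 1 := if_pos hm
        simp only [this]
        linarith [hin s]
      · have hnoise : ¬ |estNoise p tie x θs s (t - 1) (x t a) b|
            ≤ p.alpha1 K * estNorm p tie x s (t - 1) (x t a) b := fun hno => by
          push Not at hm
          have := h.estimate_error_le htie hS ht a
            (hm (t - 1) (by have := mem_Icc.1 ht; omega)) hno
          linarith
        have h1 : 1 ≤ N 1 t s a b + N (-1) t s a b := by
          rw [not_le, lt_abs] at hnoise
          rcases hnoise with h1 | h1
          · have : N 1 t s a b = 1 := if_pos (by rwa [one_mul])
            linarith [hN0 (-1) t s a b]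
          · have : N (-1) t s a b = 1 := if_pos (by rwa [neg_one_mul])
            linarith [hN0 1 t s a b]
        have h2 := single_le_sum (f := fun a => N 1 t s a b + N (-1) t s a b)
          (fun a _ => add_nonneg (hN0 1 t s a b) (hN0 (-1) t s a b)) (mem_univ a)
        have h3 := single_le_sum (f := fun t => ∑ a, (N 1 t s a b + N (-1) t s a b))
          (fun t _ => sum_nonneg fun a _ => add_nonneg (hN0 1 t s a b) (hN0 (-1) t s a b)) ht
        have := hM0 s b
        beta_reduce at h2 h3 ⊢
        linarith
    · exact sum_nonneg fun s _ => add_nonneg (hM0 s b) (hin s)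
  refine (treeSum_mono hq hpt).trans ?_
  rw [treeSum_sum]
  have hexp : Real.exp (-p.logTerm K) = p.δ / (4 * p.T * p.S * K) := by
    rw [Params.logTerm, Real.exp_neg, Real.exp_log (by positivity), inv_div]
  -- Each level costs `δ / (2S)` for the mixture and `2 T K · δ / (4TSK) = δ / (2S)` for the
  -- two-sided noise bounds.
  have hterm : ∀ s ∈ Icc 1 p.S, treeSum (rewardMean p tie x θs) p.T (fun b => M s b +
      ∑ t ∈ Icc 1 p.T, ∑ a, (N 1 t s a b + N (-1) t s a b)) ≤ p.δ / p.S := by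
    intro s _
    rw [treeSum_add, treeSum_sum]
    have hMs := h.treeSum_mixture_le (tie := tie) s hc
    have hNs : ∀ t ∈ Icc 1 p.T, treeSum (rewardMean p tie x θs) p.T
        (fun b => ∑ a, (N 1 t s a b + N (-1) t s a b)) ≤ p.δ / (2 * p.T * p.S) := by
      intro t ht
      rw [treeSum_sum]
      have : ∀ a ∈ (univ : Finset (Fin K)), treeSum (rewardMean p tie x θs) p.T
          (fun b => N 1 t s a b + N (-1) t s a b) ≤ p.δ / (2 * p.T * p.S * K) := fun a _ => by
        rw [treeSum_add]
        have hk : t - 1 ≤ p.T := by have := mem_Icc.1 ht; omega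
        have h1 := h.treeSum_estNoise_le (tie := tie) (s := s) hk (x t a) (σ := 1) (by simp) hℓ
        have h2 := h.treeSum_estNoise_le (tie := tie) (s := s) hk (x t a) (σ := -1) (by simp) hℓ
        rw [hexp] at h1 h2
        refine (add_le_add h1 h2).trans (le_of_eq ?_)
        field_simp
        norm_num
      refine (sum_le_sum this).trans (le_of_eq ?_)
      rw [sum_const, card_univ, Fintype.card_fin, nsmul_eq_mul]
      field_simp
    refine (add_le_add hMs (sum_le_sum hNs)).trans (le_of_eq ?_)
    rw [sum_const, Nat.card_Icc, nsmul_eq_mul]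
    push_cast
    field_simp
    norm_num
  refine (sum_le_sum hterm).trans (le_of_eq ?_)
  rw [sum_const, Nat.card_Icc, nsmul_eq_mul]
  push_cast
  field_simp

end FixedContextBound

/-! ### Measurability -/

section Discrete

variable {Ω : Type*} [MeasurableSpace Ω] {β γ : Type*}

/-- `g` takes countably many values, and all its level sets are measurable. -/
structure IsDiscrete (g : Ω → β) : Prop where
  countable : (Set.range g).Countable
  fiber : ∀ b, MeasurableSet {ω | g ω = b}

theorem isDiscrete_of_countable [Countable β] {g : Ω → β}
    (hg : ∀ b, MeasurableSet {ω | g ω = b}) : IsDiscrete g :=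
  ⟨Set.to_countable _, hg⟩

theorem isDiscrete_const (b : β) : IsDiscrete fun _ : Ω => b :=
  ⟨(Set.countable_singleton b).mono (by rintro _ ⟨ω, rfl⟩; rfl), fun c => by
    by_cases h : b = c <;> simp [h]⟩

theorem isDiscrete_prop {P : Ω → Prop} (hP : MeasurableSet {ω | P ω}) : IsDiscrete P := by
  refine isDiscrete_of_countable fun b => ?_
  by_cases hb : b
  · convert hP using 3 with ω
    simp [hb]
  · convert hP.compl using 1
    ext ω
    simp [hb]

theorem IsDiscrete.measurableSet {P : Ω → Prop} (hP : IsDiscrete P) : MeasurableSet {ω | P ω} := by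
  convert hP.fiber True using 3
  simp

/-- A function that is pieced together along countably many measurable sets. -/
theorem IsDiscrete.measurable_comp [MeasurableSpace γ] {g : Ω → β}
    (hg : IsDiscrete g) (F : β → Ω → γ) (hF : ∀ ω, Measurable (F (g ω))) :
    Measurable fun ω => F (g ω) ω := by
  intro S hS
  have : (fun ω => F (g ω) ω) ⁻¹' S = ⋃ b ∈ Set.range g, ({ω | g ω = b} ∩ (F b) ⁻¹' S) := by
    ext ω
    simp only [Set.mem_preimage, Set.biUnion_range, Set.mem_iUnion, Set.mem_inter_iff,
      Set.mem_ofPred_eq]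
    exact ⟨fun h => ⟨ω, rfl, h⟩, fun ⟨i, h1, h2⟩ => by rwa [h1]⟩
  rw [this]
  refine MeasurableSet.biUnion hg.countable ?_
  rintro _ ⟨ω, rfl⟩
  exact (hg.fiber _).inter (hF ω hS)

/-- Allows staged definitions: the countably valued first stage is frozen, and the second needs
checking only at values actually taken. So each round is treated with a fixed state before it. -/
theorem IsDiscrete.bind {g : Ω → β} (hg : IsDiscrete g) (F : β → Ω → γ)
    (hF : ∀ ω, IsDiscrete (F (g ω))) : IsDiscrete fun ω => F (g ω) ω := by
  constructor
  · refine (hg.countable.biUnion (t := fun b _ => Set.range (F b)) ?_).mono ?_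
    · rintro _ ⟨ω, rfl⟩
      exact (hF ω).countable
    · rintro _ ⟨ω, rfl⟩
      exact Set.mem_biUnion ⟨ω, rfl⟩ ⟨ω, rfl⟩
  · intro c
    have : {ω | F (g ω) ω = c} = ⋃ b ∈ Set.range g, ({ω | g ω = b} ∩ {ω | F b ω = c}) := by
      ext ω
      simp only [Set.biUnion_range, Set.mem_iUnion, Set.mem_inter_iff, Set.mem_ofPred_eq]
      exact ⟨fun h => ⟨ω, rfl, h⟩, fun ⟨i, h1, h2⟩ => by rwa [h1]⟩
    rw [this]
    refine MeasurableSet.biUnion hg.countable ?_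
    rintro _ ⟨ω, rfl⟩
    exact (hg.fiber _).inter ((hF ω).fiber c)

theorem IsDiscrete.map {g : Ω → β} (hg : IsDiscrete g) (f : β → γ) :
    IsDiscrete fun ω => f (g ω) :=
  hg.bind (fun b _ => f b) fun _ => isDiscrete_const _

theorem IsDiscrete.prodMk {g : Ω → β} {g' : Ω → γ} (hg : IsDiscrete g) (hg' : IsDiscrete g') :
    IsDiscrete fun ω => (g ω, g' ω) :=
  hg.bind (fun b ω => (b, g' ω)) fun _ => hg'.map _

theorem isDiscrete_filter {α : Type*} [Finite α] (A : Finset α) (P : Ω → α → Prop)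
    [∀ ω, DecidablePred (P ω)]
    (hP : ∀ a, MeasurableSet {ω | P ω a}) : IsDiscrete fun ω => A.filter (P ω) := by
  refine isDiscrete_of_countable fun C => ?_
  have : {ω | A.filter (P ω) = C} = ⋂ a, {ω | (a ∈ A ∧ P ω a) ↔ a ∈ C} := by
    ext ω; simp [Finset.ext_iff]
  rw [this]
  exact MeasurableSet.iInter fun a =>
    (measurableSet_setOfPred.2 (((measurable_const (a := a ∈ A)).and (measurableSet_setOfPred.1 (hP a))).iff
      (measurable_const (a := a ∈ C))))

end Discrete

section MatrixMeasurability

variable {Ω : Type*} [MeasurableSpace Ω] {d : ℕ}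

/-- The inverse is the adjugate divided by the determinant, both polynomial in the entries, so no
invertibility is needed. -/
theorem measurable_inv_mulVec {A : Ω → Matrix (Fin d) (Fin d) ℝ} {v : Ω → Fin d → ℝ}
    (hA : Measurable fun ω => (fun i j => A ω i j : Fin d → Fin d → ℝ)) (hv : Measurable v) :
    Measurable fun ω => (A ω)⁻¹.mulVec (v ω) := by
  have hdet : Measurable fun ω => (A ω).det := by
    have : Continuous fun M : Fin d → Fin d → ℝ => (Matrix.of M).det :=
      Continuous.matrix_det continuous_id
    exact this.measurable.comp hA
  have hadj : Measurable fun ω => (fun i j => (A ω).adjugate i j : Fin d → Fin d → ℝ) := by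
    have : Continuous fun M : Fin d → Fin d → ℝ =>
        (fun i j => (Matrix.of M).adjugate i j : Fin d → Fin d → ℝ) :=
      Continuous.matrix_adjugate (A := fun M : Fin d → Fin d → ℝ => Matrix.of M) continuous_id
    exact this.measurable.comp hA
  rw [measurable_pi_iff]
  intro i
  simp only [Matrix.mulVec, dotProduct, Matrix.inv_def, Ring.inverse_eq_inv', Matrix.smul_apply,
    smul_eq_mul]
  refine Finset.measurable_fun_sum _ fun j _ => (hdet.inv.mul ?_).mul ?_
  · exact (measurable_pi_iff.1 (measurable_pi_iff.1 hadj i)) j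
  · exact measurable_pi_iff.1 hv j

theorem measurable_ofLp_comp {z : Ω → Vec d} (hz : Measurable z) (i : Fin d) :
    Measurable fun ω => (z ω).ofLp i :=
  (measurable_pi_iff.1 (WithLp.measurable_ofLp 2 _ |>.comp hz)) i

theorem measurable_smul_one_add_sum (c : ℝ) {I : Finset ℕ} {γ : ℕ → Ω → ℝ} {z : ℕ → Ω → Vec d}
    (hγ : ∀ i ∈ I, Measurable (γ i)) (hz : ∀ i ∈ I, Measurable (z i)) :
    Measurable fun ω => (fun j k => (c • (1 : Matrix (Fin d) (Fin d) ℝ)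
      + ∑ i ∈ I, γ i ω • outer (z i ω)) j k : Fin d → Fin d → ℝ) := by
  rw [measurable_pi_iff]
  intro j
  rw [measurable_pi_iff]
  intro k
  simp only [Matrix.add_apply, Matrix.sum_apply, Matrix.smul_apply, outer, Matrix.vecMulVec_apply,
    smul_eq_mul]
  refine measurable_const.add (Finset.measurable_fun_sum _ fun i hi => ?_)
  exact (hγ i hi).mul ((measurable_ofLp_comp (hz i hi) j).mul (measurable_ofLp_comp (hz i hi) k))

theorem measurable_design (p : Params) {I : Finset ℕ} {z : ℕ → Ω → Vec d}
    (hz : ∀ i ∈ I, Measurable (z i)) :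
    Measurable fun ω => (fun j k => design p (fun i => z i ω) I j k : Fin d → Fin d → ℝ) := by
  have := measurable_smul_one_add_sum (p.κ * p.lam) (γ := fun _ _ => 1)
    (fun _ _ => measurable_const) hz
  simpa [design] using this

theorem measurable_matNorm_inv {A : Ω → Matrix (Fin d) (Fin d) ℝ} {v : Ω → Vec d}
    (hA : Measurable fun ω => (fun i j => A ω i j : Fin d → Fin d → ℝ)) (hv : Measurable v) :
    Measurable fun ω => matNorm (A ω)⁻¹ (v ω) := by
  have h := measurable_inv_mulVec hA (WithLp.measurable_ofLp 2 _ |>.comp hv)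
  refine Measurable.sqrt (Finset.measurable_fun_sum _ fun i _ => ?_)
  exact (measurable_ofLp_comp hv i).mul (measurable_pi_iff.1 h i)

end MatrixMeasurability

/-! ### Continuity and measurability of the estimators. -/

section EstimatorMeasurability

variable {d : ℕ}

theorem continuous_pilotLoss (p : Params) (I : Finset ℕ) :
    Continuous fun q : ((ℕ → Vec d) × (ℕ → ℝ)) × Vec d => pilotLoss p q.1.1 q.1.2 I q.2 := by
  unfold pilotLoss
  have hs : ∀ i, Continuous fun q : ((ℕ → Vec d) × (ℕ → ℝ)) × Vec d =>
      Real.sigmoid ⟪q.1.1 i, q.2⟫ := fun i =>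
    continuous_sigmoid.comp (((continuous_apply i).comp
      (continuous_fst.comp continuous_fst)).inner continuous_snd)
  have hr : ∀ i, Continuous fun q : ((ℕ → Vec d) × (ℕ → ℝ)) × Vec d => q.1.2 i := fun i =>
    (continuous_apply i).comp (continuous_snd.comp continuous_fst)
  refine Continuous.add (continuous_finsetSum _ fun i _ => ?_) (by fun_prop)
  refine ((hr i).neg.mul ((hs i).log fun q => (Real.sigmoid_pos _).ne')).sub
    ((continuous_const.sub (hr i)).mul ((continuous_const.sub (hs i)).log fun q => ?_))
  exact (sub_pos.2 (Real.sigmoid_lt_one _)).ne'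

/-- The minimizer depends continuously on the data, since it is unique. -/
theorem continuous_pilotEstimator {p : Params} (hB : 0 ≤ p.B) (hlam : 0 < p.lam) (I : Finset ℕ) :
    Continuous fun q : (ℕ → Vec d) × (ℕ → ℝ) => pilotEstimator p q.1 q.2 I := by
  rw [continuous_iff_continuousAt]
  intro q₀
  -- By compactness it is enough that every cluster point of nearby minimizers minimizes the
  -- limiting loss; uniqueness then identifies it.
  refine (isCompact_closedBall (0 : Vec d) p.B).tendsto_nhds_of_unique_mapClusterPt
    (.of_forall fun q => by simpa using (isPilotMin_pilotEstimator p hB q.1 q.2 I).1) ?_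
  intro θ hθ hcl
  refine IsPilotMin.unique (p := p) hlam (z := q₀.1) (r := q₀.2) (I := I)
    ⟨by simpa using hθ, fun θ' hθ' => ?_⟩ (isPilotMin_pilotEstimator p hB q₀.1 q₀.2 I)
  by_contra hlt
  rw [not_le] at hlt
  -- A strictly better competitor at the limit would remain strictly better for nearby data and
  -- parameters, contradicting minimality there.
  have hopen : IsOpen {q : ((ℕ → Vec d) × (ℕ → ℝ)) × Vec d |
      pilotLoss p q.1.1 q.1.2 I θ' < pilotLoss p q.1.1 q.1.2 I q.2} :=
    isOpen_lt ((continuous_pilotLoss p I).comp (continuous_fst.prodMk continuous_const))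
      (continuous_pilotLoss p I)
  obtain ⟨U, V, hU, hV, hqU, hθV, hUV⟩ := isOpen_prod_iff.1 hopen q₀ θ hlt
  have hfreq := (mapClusterPt_iff_frequently.1 hcl) V (hV.mem_nhds hθV)
  obtain ⟨q, hq1, hq2⟩ := (hfreq.and_eventually (hU.mem_nhds hqU)).exists
  have h1 : pilotLoss p q.1 q.2 I θ' < _ := hUV (Set.mk_mem_prod hq2 hq1)
  exact absurd ((isPilotMin_pilotEstimator p hB q.1 q.2 I).2 θ' hθ') (not_le.2 h1)

variable {Ω : Type*} [MeasurableSpace Ω]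

theorem measurable_pilotEstimator {p : Params} (hB : 0 ≤ p.B) (hlam : 0 < p.lam) {I : Finset ℕ}
    {z : ℕ → Ω → Vec d} {r : ℕ → Ω → ℝ} (hz : ∀ i ∈ I, Measurable (z i))
    (hr : ∀ i ∈ I, Measurable (r i)) :
    Measurable fun ω => pilotEstimator p (fun i => z i ω) (fun i => r i ω) I := by
  -- Data outside `I` are set to zero, since measurability is known only on `I`.
  have h1 : Measurable fun ω => ((fun i => if i ∈ I then z i ω else 0,
      fun i => if i ∈ I then r i ω else 0) : (ℕ → Vec d) × (ℕ → ℝ)) := by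
    refine Measurable.prodMk (measurable_pi_iff.2 fun i => ?_) (measurable_pi_iff.2 fun i => ?_)
    · by_cases hi : i ∈ I
      · simpa [hi] using hz i hi
      · simp [hi]
    · by_cases hi : i ∈ I
      · simpa [hi] using hr i hi
      · simp [hi]
  have h2 := (continuous_pilotEstimator (d := d) hB hlam I).measurable.comp h1
  convert h2 using 2 with ω
  exact pilotEstimator_congr p (fun i hi => by simp [hi]) (fun i hi => by simp [hi])

theorem measurable_oneStep {p : Params} (hB : 0 ≤ p.B) (hlam : 0 < p.lam) {I J : Finset ℕ}
    {z : ℕ → Ω → Vec d} {r : ℕ → Ω → ℝ} (hz : ∀ i ∈ I ∪ J, Measurable (z i))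
    (hr : ∀ i ∈ I ∪ J, Measurable (r i)) :
    Measurable fun ω => oneStep p (fun i => z i ω) (fun i => r i ω) I J := by
  have hθ := measurable_pilotEstimator (p := p) hB hlam
    (fun i hi => hz i (mem_union_left J hi)) (fun i hi => hr i (mem_union_left J hi))
  set θ : Ω → Vec d := fun ω => pilotEstimator p (fun i => z i ω) (fun i => r i ω) I
  have hzJ := fun i (hi : i ∈ J) => hz i (mem_union_right I hi)
  have hin : ∀ i ∈ J, Measurable fun ω => ⟪z i ω, θ ω⟫ := fun i hi => (hzJ i hi).inner hθ
  have hσ : Measurable Real.sigmoid := continuous_sigmoid.measurable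
  have hdσ : Measurable (deriv Real.sigmoid) := measurable_deriv _
  have hg : Measurable fun ω => gradTerm p (fun i => z i ω) (fun i => r i ω) J (θ ω) := by
    unfold gradTerm
    have hs : Measurable fun ω => p.lam • θ ω := hθ.const_smul p.lam
    refine Measurable.sub (Finset.measurable_fun_sum _ fun i hi => ?_) hs
    exact ((hr i (mem_union_right I hi)).sub (hσ.comp (hin i hi))).smul (hzJ i hi)
  have hH : Measurable fun ω => (fun j k => hessian p (fun i => z i ω) J (θ ω) j k :
      Fin d → Fin d → ℝ) :=
    measurable_smul_one_add_sum p.lam (γ := fun i ω => deriv Real.sigmoid ⟪z i ω, θ ω⟫)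
      (fun i hi => hdσ.comp (hin i hi)) hzJ
  exact hθ.add ((WithLp.measurable_toLp 2 _).comp
    (measurable_inv_mulVec hH ((WithLp.measurable_ofLp 2 _).comp hg)))

end EstimatorMeasurability

/-! ### Measurability of the loop and of the run. -/

section LoopMeasurability

variable {Ω : Type*} [MeasurableSpace Ω] {K : ℕ} {m w : Ω → ℕ → Fin K → ℝ}

open Classical in
theorem isDiscrete_armSet (hm : ∀ s a, Measurable fun ω => m ω s a) (s : ℕ) :
    IsDiscrete fun ω => armSet (m ω) s := by
  induction s with
  | zero => exact isDiscrete_const _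
  | succ s ih =>
    cases s with
    | zero => exact isDiscrete_const _
    | succ s =>
      simp only [armSet]
      refine ih.bind (fun A ω => A.filter fun a =>
        ∀ b ∈ A, m ω (s + 1) b - 2 * (1 / 2) ^ (s + 1) ≤ m ω (s + 1) a) fun ω₀ => ?_
      refine isDiscrete_filter _ (fun ω a => ∀ b ∈ armSet (m ω₀) (s + 1),
        m ω (s + 1) b - 2 * (1 / 2) ^ (s + 1) ≤ m ω (s + 1) a) fun a => ?_
      simp only [Set.ofPred_forall]
      exact MeasurableSet.iInter fun b => MeasurableSet.iInter fun _ =>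
        measurableSet_le ((hm _ b).sub measurable_const) (hm _ a)

open Classical in
theorem isDiscrete_argmaxSet {A : Ω → Finset (Fin K)} {f : Ω → Fin K → ℝ} (hA : IsDiscrete A)
    (hf : ∀ a, Measurable fun ω => f ω a) : IsDiscrete fun ω => argmaxSet (A ω) (f ω) := by
  refine hA.bind (fun A ω => argmaxSet A (f ω)) fun ω₀ =>
    isDiscrete_filter (A ω₀) (fun ω a => ∀ b ∈ A ω₀, f ω b ≤ f ω a) fun a => ?_
  simp only [Set.ofPred_forall]
  exact MeasurableSet.iInter fun b => MeasurableSet.iInter fun _ => measurableSet_le (hf b) (hf a)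

theorem isDiscrete_condA (hm : ∀ s a, Measurable fun ω => m ω s a)
    (hw : ∀ s a, Measurable fun ω => w ω s a) (s : ℕ) :
    IsDiscrete fun ω => condA (m ω) (w ω) s := by
  refine (isDiscrete_armSet hm s).bind (fun A ω => ∃ a ∈ A, (1 / 2) ^ s < w ω s a) fun _ => ?_
  refine isDiscrete_prop ?_
  simp only [Set.ofPred_exists, Set.ofPred_and]
  exact MeasurableSet.iUnion fun a =>
    (MeasurableSet.const _).inter (measurableSet_lt measurable_const (hw s a))

theorem isDiscrete_condB (T : ℕ) (hm : ∀ s a, Measurable fun ω => m ω s a)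
    (hw : ∀ s a, Measurable fun ω => w ω s a) (s : ℕ) :
    IsDiscrete fun ω => condB T (m ω) (w ω) s := by
  refine (isDiscrete_armSet hm s).bind (fun A ω => ∀ a ∈ A, w ω s a ≤ 1 / √(T : ℝ)) fun _ => ?_
  refine isDiscrete_prop ?_
  simp only [Set.ofPred_forall]
  exact MeasurableSet.iInter fun a => MeasurableSet.iInter fun _ =>
    measurableSet_le (hw s a) measurable_const

theorem isDiscrete_stopLevel {p : Params} (hT : 1 ≤ p.T)
    (hm : ∀ s a, Measurable fun ω => m ω s a) (hw : ∀ s a, Measurable fun ω => w ω s a) :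
    IsDiscrete fun ω => stopLevel p.T (m ω) (w ω) := by
  refine isDiscrete_of_countable fun l => ?_
  have hQ : ∀ s, MeasurableSet {ω | 1 ≤ s ∧ (condA (m ω) (w ω) s ∨ condB p.T (m ω) (w ω) s)} :=
    fun s => (MeasurableSet.const _).inter
      ((isDiscrete_condA hm hw s).measurableSet.union (isDiscrete_condB p.T hm hw s).measurableSet)
  have : {ω | stopLevel p.T (m ω) (w ω) = l}
      = {ω | 1 ≤ l ∧ (condA (m ω) (w ω) l ∨ condB p.T (m ω) (w ω) l)} ∩
        ⋂ j ∈ Set.Iio l, {ω | 1 ≤ j ∧ (condA (m ω) (w ω) j ∨ condB p.T (m ω) (w ω) j)}ᶜ := by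
    ext ω
    simp only [Set.mem_ofPred_eq, Set.mem_inter_iff, Set.mem_iInter, Set.mem_compl_iff, Set.mem_Iio]
    constructor
    · rintro rfl
      exact ⟨stopLevel_mem hT _ _, fun j hj => Nat.notMem_of_lt_sInf hj⟩
    · rintro ⟨h1, h2⟩
      refine le_antisymm (Nat.sInf_le h1) (not_lt.1 fun h => h2 _ h (stopLevel_mem hT _ _))
  rw [this]
  exact (hQ l).inter (MeasurableSet.biInter (Set.to_countable _) fun j _ => (hQ j).compl)

end LoopMeasurability

section RunMeasurability

variable {Ω : Type*} [MeasurableSpace Ω] {d K : ℕ} {p : Params}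
  {x : ℕ → Fin K → Ω → Vec d} {r : ℕ → Ω → ℝ} {n : ℕ}

theorem State.measurable_m (hB : 0 ≤ p.B) (hlam : 0 < p.lam)
    (hx : ∀ i ∈ Icc 1 n, ∀ a, Measurable (x i a)) (hr : ∀ i ∈ Icc 1 n, Measurable (r i))
    {t : ℕ} (ht : t ∈ Icc 1 n) {st : State K} {s : ℕ} (hs : st.pilot s ∪ st.est s ⊆ Icc 1 n)
    (a : Fin K) :
    Measurable fun ω => st.m p (fun i a => x i a ω) (fun i => r i ω) t s a :=
  (hx t ht a).inner (measurable_oneStep (z := fun i => x i (st.act i)) hB hlam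
    (fun i hi => hx i (hs hi) _) (fun i hi => hr i (hs hi)))

theorem State.measurable_w (hx : ∀ i ∈ Icc 1 n, ∀ a, Measurable (x i a))
    {t : ℕ} (ht : t ∈ Icc 1 n) {st : State K} {s : ℕ} (hs : st.est s ⊆ Icc 1 n) (a : Fin K) :
    Measurable fun ω => st.w p (fun i a => x i a ω) t s a :=
  measurable_const.mul (measurable_matNorm_inv
    (measurable_design p (z := fun i => x i (st.act i)) fun i hi => hx i (hs hi) _) (hx t ht a))

/-- A round, for a fixed state before it. -/
theorem State.isDiscrete_step (hT : 1 ≤ p.T) (hB : 0 ≤ p.B) (hlam : 0 < p.lam)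
    (tie : ℕ → Finset (Fin K) → Fin K)
    (hx : ∀ i ∈ Icc 1 n, ∀ a, Measurable (x i a)) (hr : ∀ i ∈ Icc 1 n, Measurable (r i))
    {t : ℕ} (ht : t ∈ Icc 1 n) {st : State K} (hs : ∀ s, st.pilot s ∪ st.est s ⊆ Icc 1 n) :
    IsDiscrete fun ω => State.step p tie (fun i a => x i a ω) (fun i => r i ω) t st := by
  classical
  have hm := fun s => State.measurable_m (p := p) hB hlam hx hr ht (hs s)
  have hw := fun s => State.measurable_w (p := p) hx ht (subset_union_right.trans (hs s))
  have hl : IsDiscrete fun ω => st.level p (fun i a => x i a ω) (fun i => r i ω) t :=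
    isDiscrete_stopLevel hT hm hw
  have hA : IsDiscrete fun ω => st.caseA p (fun i a => x i a ω) (fun i => r i ω) t :=
    hl.bind (fun l ω => condA (st.m p (fun i a => x i a ω) (fun i => r i ω) t)
      (st.w p (fun i a => x i a ω) t) l) fun _ => isDiscrete_condA hm hw _
  have ha : IsDiscrete fun ω => st.armA p tie (fun i a => x i a ω) (fun i => r i ω) t :=
    (hl.bind (fun l ω => argmaxSet (armSet (st.m p (fun i a => x i a ω) (fun i => r i ω) t) l)
      (st.w p (fun i a => x i a ω) t l)) fun _ =>
        isDiscrete_argmaxSet (isDiscrete_armSet hm _) (hw _)).map (tie t)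
  have hb : IsDiscrete fun ω => st.armB p tie (fun i a => x i a ω) (fun i => r i ω) t :=
    (hl.bind (fun l ω => argmaxSet (armSet (st.m p (fun i a => x i a ω) (fun i => r i ω) t) l)
      (st.m p (fun i a => x i a ω) (fun i => r i ω) t l)) fun _ =>
        isDiscrete_argmaxSet (isDiscrete_armSet hm _) (hm _)).map (tie t)
  have hq : IsDiscrete fun ω => p.tau d (st.level p (fun i a => x i a ω) (fun i => r i ω) t)
      < st.pilotNormSq p (fun i a => x i a ω) t
        (st.level p (fun i a => x i a ω) (fun i => r i ω) t)
        (st.armA p tie (fun i a => x i a ω) (fun i => r i ω) t) := by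
    refine (hl.prodMk ha).bind (fun q ω => p.tau d q.1
      < st.pilotNormSq p (fun i a => x i a ω) t q.1 q.2) fun _ => isDiscrete_prop ?_
    exact measurableSet_lt measurable_const ((measurable_matNorm_inv
      (measurable_design p (z := fun i => x i (st.act i))
        fun i hi => hx i (hs _ (mem_union_left _ hi)) _) (hx t ht _)).pow_const 2)
  -- For a fixed previous state, the new state is a function of five discrete quantities: two case
  -- distinctions, the level and the two candidate arms.
  have h := ((hA.prodMk hq).prodMk (hl.prodMk (ha.prodMk hb))).map
    (fun q : (Prop × Prop) × ℕ × Fin K × Fin K =>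
      if q.1.1 then
        if q.1.2 then (⟨Function.update st.act t q.2.2.1,
            Function.update st.pilot q.2.1 (insert t (st.pilot q.2.1)), st.est⟩ : State K)
        else ⟨Function.update st.act t q.2.2.1, st.pilot,
            Function.update st.est q.2.1 (insert t (st.est q.2.1))⟩
      else ⟨Function.update st.act t q.2.2.2, st.pilot, st.est⟩)
  convert h using 2 with ω
  split_ifs with h1 h2
  · rw [State.step_of_pilot _ _ _ _ _ _ h1 h2]
  · rw [State.step_of_est _ _ _ _ _ _ h1 h2]
  · rw [State.step_of_not_caseA _ _ _ _ _ _ h1]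

variable [NeZero K]

theorem isDiscrete_run (hT : 1 ≤ p.T) (hB : 0 ≤ p.B) (hlam : 0 < p.lam)
    (tie : ℕ → Finset (Fin K) → Fin K)
    (hx : ∀ i ∈ Icc 1 n, ∀ a, Measurable (x i a)) (hr : ∀ i ∈ Icc 1 n, Measurable (r i))
    {t : ℕ} (ht : t ≤ n) :
    IsDiscrete fun ω => run p tie (fun i a => x i a ω) (fun i => r i ω) t := by
  induction t with
  | zero => exact isDiscrete_const _
  | succ t ih =>
    refine (ih (by omega)).bind (fun st ω => State.step p tie (fun i a => x i a ω)
      (fun i => r i ω) (t + 1) st) fun ω => ?_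
    refine State.isDiscrete_step hT hB hlam tie hx hr (mem_Icc.2 ⟨by omega, ht⟩) fun s => ?_
    have := sets_subset (p := p) (tie := tie) (x := fun i a => x i a ω) (r := fun i => r i ω) t s
    exact (union_subset this.1 this.2).trans (Icc_subset_Icc_right (by omega))

theorem isDiscrete_action (hT : 1 ≤ p.T) (hB : 0 ≤ p.B) (hlam : 0 < p.lam)
    (tie : ℕ → Finset (Fin K) → Fin K)
    (hx : ∀ i ∈ Icc 1 n, ∀ a, Measurable (x i a)) (hr : ∀ i ∈ Icc 1 n, Measurable (r i))
    {t : ℕ} (ht : t ≤ n) :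
    IsDiscrete fun ω => action p tie (fun i a => x i a ω) (fun i => r i ω) t :=
  (isDiscrete_run hT hB hlam tie hx hr ht).map fun st => st.act t

theorem measurable_estimate (hT : 1 ≤ p.T) (hB : 0 ≤ p.B) (hlam : 0 < p.lam)
    (tie : ℕ → Finset (Fin K) → Fin K)
    (hx : ∀ i ∈ Icc 1 n, ∀ a, Measurable (x i a)) (hr : ∀ i ∈ Icc 1 n, Measurable (r i))
    {t : ℕ} (ht : t ∈ Icc 1 n) (s : ℕ) (a : Fin K) :
    Measurable fun ω => estimate p tie (fun i a => x i a ω) (fun i => r i ω) t s a := by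
  have ht' := mem_Icc.1 ht
  refine (isDiscrete_run hT hB hlam tie hx hr (t := t - 1) (by omega)).measurable_comp
    (fun st ω => st.m p (fun i a => x i a ω) (fun i => r i ω) t s a) fun ω => ?_
  have := sets_subset (p := p) (tie := tie) (x := fun i a => x i a ω) (r := fun i => r i ω)
    (t - 1) s
  exact State.measurable_m hB hlam hx hr ht
    ((union_subset this.1 this.2).trans (Icc_subset_Icc_right (by omega))) a

theorem measurable_width (hT : 1 ≤ p.T) (hB : 0 ≤ p.B) (hlam : 0 < p.lam)
    (tie : ℕ → Finset (Fin K) → Fin K)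
    (hx : ∀ i ∈ Icc 1 n, ∀ a, Measurable (x i a)) (hr : ∀ i ∈ Icc 1 n, Measurable (r i))
    {t : ℕ} (ht : t ∈ Icc 1 n) (s : ℕ) (a : Fin K) :
    Measurable fun ω => width p tie (fun i a => x i a ω) (fun i => r i ω) t s a := by
  have ht' := mem_Icc.1 ht
  refine (isDiscrete_run hT hB hlam tie hx hr (t := t - 1) (by omega)).measurable_comp
    (fun st ω => st.w p (fun i a => x i a ω) t s a) fun ω => ?_
  have := sets_subset (p := p) (tie := tie) (x := fun i a => x i a ω) (r := fun i => r i ω)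
    (t - 1) s
  exact State.measurable_w hx ht (this.2.trans (Icc_subset_Icc_right (by omega))) a

end RunMeasurability

/-! ### Conditional centering given all contexts. -/

section CondExp

variable {Ω : Type*} {mΩ : MeasurableSpace Ω} {P : Measure Ω} [IsProbabilityMeasure P]

theorem integrable_of_bounded {f : Ω → ℝ} (hf : Measurable f) {c : ℝ} (hc : ∀ ω, |f ω| ≤ c) :
    Integrable f P :=
  Integrable.of_bound hf.aestronglyMeasurable c (.of_forall hc)

/-- If events of `mX` are conditionally independent of `m'` given `mc`, then a variable that is
`m'`-measurable and centered given `mF ⊇ mc` is centered given `mX`. -/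
theorem condExp_eq_zero_of_oblivious {Ω : Type*} {mX mc mF m' mΩ : MeasurableSpace Ω}
    {P : Measure Ω} [IsProbabilityMeasure P] (hcF : mc ≤ mF)
    (hF' : mF ≤ m') (h' : m' ≤ mΩ) (hX : mX ≤ mΩ) {F : Ω → ℝ} (hF : Measurable[m'] F) {c : ℝ}
    (hc : ∀ ω, |F ω| ≤ c) (hzero : P[F | mF] =ᵐ[P] 0)
    (hobl : ∀ C : Set Ω, MeasurableSet[mX] C →
      P[C.indicator (fun _ => (1 : ℝ)) | m'] =ᵐ[P] P[C.indicator (fun _ => (1 : ℝ)) | mc]) :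
    P[F | mX] =ᵐ[P] 0 := by
  have hFm : Measurable F := hF.mono h' le_rfl
  have hFi : Integrable F P := integrable_of_bounded hFm hc
  symm
  refine ae_eq_condExp_of_forall_setIntegral_eq hX hFi (fun _ _ _ => integrableOn_zero)
    (fun C hC _ => ?_) aestronglyMeasurable_const
  have hCm : MeasurableSet C := hX C hC
  set e : Ω → ℝ := C.indicator fun _ => (1 : ℝ) with he
  have he1 : ∀ ω, |e ω| ≤ 1 := fun ω => by
    by_cases hω : ω ∈ C <;> simp [he, hω]
  have hem : Measurable e := measurable_const.indicator hCm
  have hei : Integrable e P := integrable_of_bounded hem he1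
  have hmul : ∀ {f : Ω → ℝ}, Integrable f P → Integrable (f * F) P := fun {f} hf =>
    hf.mul_bdd hFm.aestronglyMeasurable (.of_forall hc)
  -- For `C` in `mX`: `E[1_C F] = E[P(C | m') F] = E[P(C | mc) F] = E[P(C | mc) E[F | mF]] = 0`. The
  -- first equality uses that `F` is `m'`-measurable, the second obliviousness, the third `mc ≤ mF`.
  have h1 : ∫ ω in C, F ω ∂P = ∫ ω, (e * F) ω ∂P := by
    rw [← integral_indicator hCm]
    congr 1
    funext ω
    by_cases hω : ω ∈ C <;> simp [he, hω]
  have h2 : ∫ ω, (e * F) ω ∂P = ∫ ω, (P[e | mc] * F) ω ∂P := by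
    rw [← integral_condExp h']
    refine integral_congr_ae ?_
    refine (condExp_mul_of_stronglyMeasurable_right hF.stronglyMeasurable (hmul hei) hei).trans ?_
    filter_upwards [hobl C hC] with ω hω
    simp only [Pi.mul_apply, hω, he]
  have h3 : ∫ ω, (P[e | mc] * F) ω ∂P = 0 := by
    rw [← integral_condExp (hF'.trans h')]
    refine (integral_congr_ae ?_).trans (integral_zero Ω ℝ)
    refine (condExp_mul_of_stronglyMeasurable_left (stronglyMeasurable_condExp.mono hcF)
      (hmul integrable_condExp) hFi).trans ?_
    filter_upwards [hzero] with ω hω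
    simp [hω]
  rw [h1, h2, h3]
  simp

end CondExp

/-! ### Transfer from fixed contexts to the probability space. -/

section Environment

variable {Ω : Type*} {mΩ : MeasurableSpace Ω} {d K : ℕ}

theorem rewardSigma_mono (r : ℕ → Ω → ℝ) {n n' : ℕ} (h : n ≤ n') :
    rewardSigma r n ≤ rewardSigma r n' :=
  biSup_mono fun _ hi => Icc_subset_Icc_right h hi

theorem measurable_context (x : ℕ → Fin K → Ω → Vec d) {n i : ℕ} (hi : i ∈ Icc 1 n) (a : Fin K) :
    Measurable[contextSigma x n] (x i a) :=
  Measurable.mono (comap_measurable (x i a))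
    ((le_iSup (fun a => MeasurableSpace.comap (x i a) inferInstance) a).trans
      (le_iSup₂ (f := fun i (_ : i ∈ Icc 1 n) =>
        ⨆ a, MeasurableSpace.comap (x i a) inferInstance) i hi)) le_rfl

theorem measurable_reward (r : ℕ → Ω → ℝ) {n i : ℕ} (hi : i ∈ Icc 1 n) :
    Measurable[rewardSigma r n] (r i) :=
  Measurable.mono (comap_measurable (r i))
    (le_iSup₂ (f := fun i (_ : i ∈ Icc 1 n) => MeasurableSpace.comap (r i) inferInstance) i hi)
    le_rfl

theorem measurableSet_action (act : ℕ → Ω → Fin K) {n i : ℕ} (hi : i ∈ Icc 1 n) (a : Fin K) :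
    MeasurableSet[actionSigma act n] {ω | act i ω = a} :=
  le_iSup₂ (f := fun i (_ : i ∈ Icc 1 n) => MeasurableSpace.comap (act i) ⊤) i hi _
    ⟨{a}, trivial, rfl⟩

theorem contextSigma_le {x : ℕ → Fin K → Ω → Vec d} {n : ℕ}
    (hx : ∀ i ∈ Icc 1 n, ∀ a, Measurable (x i a)) : contextSigma x n ≤ mΩ :=
  iSup₂_le fun i hi => iSup_le fun a => (hx i hi a).comap_le

theorem rewardSigma_le {r : ℕ → Ω → ℝ} {n : ℕ} (hr : ∀ i ∈ Icc 1 n, Measurable (r i)) :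
    rewardSigma r n ≤ mΩ :=
  iSup₂_le fun i hi => (hr i hi).comap_le

theorem actionSigma_le {act : ℕ → Ω → Fin K} {n : ℕ} (h : ∀ i ∈ Icc 1 n, IsDiscrete (act i)) :
    actionSigma act n ≤ mΩ := by
  refine iSup₂_le fun i hi => ?_
  rintro _ ⟨S, -, rfl⟩
  exact ((h i hi).map fun a => a ∈ S).measurableSet

theorem measurable_mean_of_isDiscrete {x : ℕ → Fin K → Ω → Vec d} {t : ℕ}
    (hx : ∀ a, Measurable (x t a)) {A : Ω → Fin K} (hA : IsDiscrete A) (θs : Vec d) :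
    Measurable fun ω => Real.sigmoid ⟪x t (A ω) ω, θs⟫ :=
  hA.measurable_comp (fun a ω => Real.sigmoid ⟪x t a ω, θs⟫) fun _ =>
    continuous_sigmoid.measurable.comp ((hx _).inner measurable_const)

variable [NeZero K] {p : Params} {tie : ℕ → Finset (Fin K) → Fin K}
  {x : ℕ → Fin K → Ω → Vec d} {r : ℕ → Ω → ℝ} {θs : Vec d}

theorem measurable_rewardMean (hT : 1 ≤ p.T) (hB : 0 ≤ p.B) (hlam : 0 < p.lam)
    (hx : ∀ i ∈ Icc 1 p.T, ∀ a, Measurable (x i a)) (b : Finset ℕ) {t : ℕ} (ht : t ∈ Icc 1 p.T) :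
    Measurable fun ω => rewardMean p tie (fun i a => x i a ω) θs t b :=
  measurable_mean_of_isDiscrete (hx t ht) (isDiscrete_action hT hB hlam tie hx
    (r := fun i _ => rewardOf b i) (fun _ _ => measurable_const) (mem_Icc.1 ht).2) θs

theorem measurable_treeWeight (hT : 1 ≤ p.T) (hB : 0 ≤ p.B) (hlam : 0 < p.lam)
    (hx : ∀ i ∈ Icc 1 p.T, ∀ a, Measurable (x i a)) (b : Finset ℕ) {t : ℕ} (ht : t ≤ p.T) :
    Measurable fun ω => treeWeight (rewardMean p tie (fun i a => x i a ω) θs) t b := by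
  refine Finset.measurable_fun_prod _ fun i hi => ?_
  have := measurable_rewardMean (tie := tie) (θs := θs) hT hB hlam hx b
    (Icc_subset_Icc_right ht hi)
  split_ifs
  · exact this
  · exact measurable_const.sub this

/-- The event that some confidence interval misses. -/
def badEvent (p : Params) (tie : ℕ → Finset (Fin K) → Fin K) (x : ℕ → Fin K → Ω → Vec d)
    (r : ℕ → Ω → ℝ) (θs : Vec d) : Set Ω :=
  {ω | ∃ t ∈ Icc 1 p.T, ∃ s ∈ Icc 1 p.S, ∃ a : Fin K,
    width p tie (fun i a => x i a ω) (fun i => r i ω) t s a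
      < |estimate p tie (fun i a => x i a ω) (fun i => r i ω) t s a - ⟪x t a ω, θs⟫|}

theorem measurableSet_badEvent (hT : 1 ≤ p.T) (hB : 0 ≤ p.B) (hlam : 0 < p.lam)
    (hx : ∀ i ∈ Icc 1 p.T, ∀ a, Measurable (x i a)) (hr : ∀ i ∈ Icc 1 p.T, Measurable (r i)) :
    MeasurableSet (badEvent p tie x r θs) := by
  unfold badEvent
  simp only [Set.ofPred_exists, Set.ofPred_and]
  refine MeasurableSet.iUnion fun t => ?_
  by_cases ht : t ∈ Icc 1 p.T
  · refine (MeasurableSet.const _).inter (MeasurableSet.iUnion fun s =>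
      (MeasurableSet.const _).inter (MeasurableSet.iUnion fun a => ?_))
    exact measurableSet_lt (measurable_width hT hB hlam tie hx hr ht s a)
      ((measurable_estimate hT hB hlam tie hx hr ht s a).sub
        ((hx t ht a).inner measurable_const)).abs
  · simp [ht]

variable {P : Measure Ω} [IsProbabilityMeasure P]

/-- The event that the first `t` rewards are those of `b`. -/
def history (r : ℕ → Ω → ℝ) (t : ℕ) (b : Finset ℕ) : Set Ω :=
  {ω | ∀ i ∈ Icc 1 t, r i ω = rewardOf b i}

theorem measurableSet_history (hr : ∀ i ∈ Icc 1 p.T, Measurable (r i)) {t : ℕ} (ht : t ≤ p.T)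
    (b : Finset ℕ) : MeasurableSet (history r t b) := by
  unfold history
  simp only [Set.ofPred_forall]
  exact MeasurableSet.iInter fun i => MeasurableSet.iInter fun hi =>
    measurableSet_eq_fun (hr i (Icc_subset_Icc_right ht hi)) measurable_const

theorem measurableSet_history_rewardSigma (r : ℕ → Ω → ℝ) (t : ℕ) (b : Finset ℕ) :
    MeasurableSet[rewardSigma r t] (history r t b) := by
  unfold history
  simp only [Set.ofPred_forall]
  exact MeasurableSet.iInter fun i => MeasurableSet.iInter fun hi =>
    measurableSet_eq_fun (measurable_reward r hi) measurable_const

/-- The mean reward in the next round, on a given reward history. -/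
theorem mean_eq_rewardMean_of_history {t : ℕ} {b : Finset ℕ} {ω : Ω} (h : ω ∈ history r t b) :
    Real.sigmoid ⟪x (t + 1) (action p tie (fun i a => x i a ω) (fun i => r i ω) (t + 1)) ω, θs⟫
      = rewardMean p tie (fun i a => x i a ω) θs (t + 1) b := by
  have : run p tie (fun i a => x i a ω) (fun i => r i ω) (t + 1)
      = run p tie (fun i a => x i a ω) (rewardOf b) (t + 1) :=
    run_congr (fun _ _ => rfl) fun i hi => h i hi
  rw [rewardMean, action, action, this]

/-- The reward deviation in round `t + 1` on a reward history is centered given all contexts. -/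
theorem condExp_deviation_eq_zero (hT : 1 ≤ p.T) (hB : 0 ≤ p.B) (hlam : 0 < p.lam)
    (hx : ∀ i ∈ Icc 1 p.T, ∀ a, Measurable (x i a)) (hr : ∀ i ∈ Icc 1 p.T, Measurable (r i))
    {act : ℕ → Ω → Fin K}
    (hact : act = fun t ω => action p tie (fun i a => x i a ω) (fun i => r i ω) t)
    (hrew : BernoulliRewards P p.T x act r θs) (hctx : ObliviousContexts P p.T x act r)
    {t : ℕ} (ht : t + 1 ≤ p.T) (b : Finset ℕ) :
    P[(history r t b).indicator fun ω =>
      r (t + 1) ω - Real.sigmoid ⟪x (t + 1) (act (t + 1) ω) ω, θs⟫ | contextSigma x p.T]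
      =ᵐ[P] 0 := by
  have hmem : t + 1 ∈ Icc 1 p.T := mem_Icc.2 ⟨by omega, ht⟩
  have hmem' : t + 1 ∈ Icc 1 (t + 1) := mem_Icc.2 ⟨by omega, le_rfl⟩
  have hsub : Icc 1 (t + 1) ⊆ Icc 1 p.T := Icc_subset_Icc_right ht
  obtain ⟨h01, hmean⟩ := hrew _ hmem
  rw [Nat.add_sub_cancel] at hmean
  have hdisc : ∀ i ∈ Icc 1 p.T, IsDiscrete (act i) := fun i hi => by
    rw [hact]
    exact isDiscrete_action hT hB hlam tie hx hr (mem_Icc.1 hi).2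
  -- `mF` is the information just before the reward of round `t + 1` and `m'` that just after it.
  -- The Bernoulli assumption centers the deviation given `mF`; obliviousness is available for `m'`.
  set mc := contextSigma x (t + 1) with hmc
  set ma := actionSigma act (t + 1) with hma
  set mF := mc ⊔ ma ⊔ rewardSigma r t with hmF
  set m' := mc ⊔ ma ⊔ rewardSigma r (t + 1) with hm'
  have hcF : mc ≤ mF := le_sup_left.trans le_sup_left
  have hF' : mF ≤ m' := sup_le_sup_left (rewardSigma_mono r (by omega)) _
  have h' : m' ≤ mΩ := sup_le (sup_le (contextSigma_le fun i hi => hx i (hsub hi))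
    (actionSigma_le fun i hi => hdisc i (hsub hi))) (rewardSigma_le fun i hi => hr i (hsub hi))
  have hμ : Measurable[mF] fun ω => Real.sigmoid ⟪x (t + 1) (act (t + 1) ω) ω, θs⟫ := by
    refine measurable_mean_of_isDiscrete (mΩ := mF) (fun a => ?_) ?_ θs
    · exact (measurable_context x hmem' a).mono hcF le_rfl
    · exact @isDiscrete_of_countable Ω mF _ _ _ fun a =>
        (le_sup_right.trans le_sup_left : ma ≤ mF) _ (measurableSet_action act hmem' a)
  have hH : MeasurableSet[mF] (history r t b) :=
    (le_sup_right : rewardSigma r t ≤ mF) _ (measurableSet_history_rewardSigma r t b)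
  have hrm : Measurable[m'] (r (t + 1)) :=
    (measurable_reward r hmem').mono le_sup_right le_rfl
  have hrb : ∀ ω, |r (t + 1) ω| ≤ 1 := fun ω => by
    rcases h01 ω with h | h <;> simp [h]
  have hμb : ∀ ω, |Real.sigmoid ⟪x (t + 1) (act (t + 1) ω) ω, θs⟫| ≤ 1 := fun ω => by
    rw [abs_of_nonneg (Real.sigmoid_nonneg _)]
    exact Real.sigmoid_le_one _
  have hri : Integrable (r (t + 1)) P := integrable_of_bounded (hrm.mono h' le_rfl) hrb
  have hμi : Integrable (fun ω => Real.sigmoid ⟪x (t + 1) (act (t + 1) ω) ω, θs⟫) P :=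
    integrable_of_bounded (hμ.mono (hF'.trans h') le_rfl) hμb
  refine condExp_eq_zero_of_oblivious hcF hF' h' (contextSigma_le hx) (c := 2) ?_ (fun ω => ?_) ?_
    (hctx _ hmem)
  · exact (hrm.sub (hμ.mono hF' le_rfl)).indicator (hF' _ hH)
  · by_cases hω : ω ∈ history r t b
    · rw [Set.indicator_of_mem hω]
      exact (abs_sub _ _).trans (by linarith [hrb ω, hμb ω])
    · simp [Set.indicator_of_notMem hω]
  · refine (condExp_indicator (hri.sub hμi) hH).trans ?_
    have h1 := condExp_sub hri hμi mF
    rw [condExp_of_stronglyMeasurable (hF'.trans h') hμ.stronglyMeasurable hμi] at h1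
    filter_upwards [h1, hmean] with ω h1 h2
    by_cases hω : ω ∈ history r t b
    · rw [Set.indicator_of_mem hω]
      refine h1.trans ?_
      simp [h2]
    · simp [Set.indicator_of_notMem hω]

/-- Given all contexts, the rewards have the law described by `rewardMean`. -/
theorem condExp_history (hT : 1 ≤ p.T) (hB : 0 ≤ p.B) (hlam : 0 < p.lam)
    (hx : ∀ i ∈ Icc 1 p.T, ∀ a, Measurable (x i a)) (hr : ∀ i ∈ Icc 1 p.T, Measurable (r i))
    {act : ℕ → Ω → Fin K}
    (hact : act = fun t ω => action p tie (fun i a => x i a ω) (fun i => r i ω) t)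
    (hrew : BernoulliRewards P p.T x act r θs) (hctx : ObliviousContexts P p.T x act r)
    {t : ℕ} (ht : t ≤ p.T) (b : Finset ℕ) :
    P[(history r t b).indicator fun _ => (1 : ℝ) | contextSigma x p.T]
      =ᵐ[P] fun ω => treeWeight (rewardMean p tie (fun i a => x i a ω) θs) t b := by
  have hX := contextSigma_le hx
  induction t with
  | zero =>
    have h0 : history r 0 b = Set.univ := by ext; simp [history]
    rw [h0, Set.indicator_univ, condExp_const hX]
    refine .of_forall fun ω => ?_
    simp [treeWeight]
  | succ t ih =>
    have hmem : t + 1 ∈ Icc 1 p.T := mem_Icc.2 ⟨by omega, ht⟩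
    have ih := ih (by omega)
    have hdev := condExp_deviation_eq_zero (P := P) hT hB hlam hx hr hact hrew hctx ht b
    have h01 := (hrew _ hmem).1
    set e : Ω → ℝ := (history r t b).indicator fun _ => (1 : ℝ) with he
    set F : Ω → ℝ := (history r t b).indicator fun ω =>
      r (t + 1) ω - Real.sigmoid ⟪x (t + 1) (act (t + 1) ω) ω, θs⟫ with hF
    set v : Ω → ℝ := fun ω => if t + 1 ∈ b then rewardMean p tie (fun i a => x i a ω) θs (t + 1) b
      else 1 - rewardMean p tie (fun i a => x i a ω) θs (t + 1) b with hv
    set σ : ℝ := if t + 1 ∈ b then 1 else -1 with hσ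
    have hHm := measurableSet_history hr (t := t) (by omega) b
    have hvm : Measurable[contextSigma x p.T] v := by
      have := measurable_rewardMean (mΩ := contextSigma x p.T) (tie := tie) (θs := θs)
        hT hB hlam (fun i hi a => measurable_context x hi a) b hmem
      rw [hv]
      split_ifs
      · exact this
      · exact measurable_const.sub this
    have hvb : ∀ ω, |v ω| ≤ 1 := fun ω => by
      have h0 := Real.sigmoid_nonneg ⟪x (t + 1)
        (action p tie (fun i a => x i a ω) (rewardOf b) (t + 1)) ω, θs⟫
      have h1 := Real.sigmoid_le_one ⟪x (t + 1)
        (action p tie (fun i a => x i a ω) (rewardOf b) (t + 1)) ω, θs⟫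
      simp only [hv, rewardMean]
      split_ifs <;> rw [abs_le] <;> constructor <;> linarith
    have hem : Measurable e := measurable_const.indicator hHm
    have hei : Integrable e P := integrable_of_bounded (c := 1) hem fun ω => by
      by_cases hω : ω ∈ history r t b <;> simp [he, hω]
    have hvei : Integrable (v * e) P :=
      hei.bdd_mul (hvm.mono hX le_rfl).aestronglyMeasurable (.of_forall hvb)
    have hFi : Integrable F P := by
      have hμm : Measurable fun ω => Real.sigmoid ⟪x (t + 1) (act (t + 1) ω) ω, θs⟫ := by
        rw [hact]
        exact measurable_mean_of_isDiscrete (hx _ hmem)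
          (isDiscrete_action hT hB hlam tie hx hr ht) θs
      refine integrable_of_bounded (c := 1) (((hr _ hmem).sub hμm).indicator hHm) fun ω => ?_
      by_cases hω : ω ∈ history r t b
      · have h0 := Real.sigmoid_nonneg ⟪x (t + 1) (act (t + 1) ω) ω, θs⟫
        have h1 := Real.sigmoid_le_one ⟪x (t + 1) (act (t + 1) ω) ω, θs⟫
        rw [hF, Set.indicator_of_mem hω, abs_le]
        rcases h01 ω with h | h <;> rw [h] <;> constructor <;> linarith
      · simp [hF, hω]
    -- For a binary reward, the indicator of the prescribed value is its probability `v` plus or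
    -- minus the deviation. On the history `v` is a function of the contexts alone, and the
    -- deviation is centered given them.
    have hdecomp : (history r (t + 1) b).indicator (fun _ => (1 : ℝ)) = v * e + σ • F := by
      funext ω
      have hiff : ω ∈ history r (t + 1) b ↔
          r (t + 1) ω = rewardOf b (t + 1) ∧ ω ∈ history r t b := by
        simp only [history, Set.mem_ofPred_eq, Icc_one_succ, forall_mem_insert]
      by_cases hω : ω ∈ history r t b
      · have hme := mean_eq_rewardMean_of_history (p := p) (tie := tie) (x := x) (θs := θs) hω
        simp only [Pi.add_apply, Pi.mul_apply, Pi.smul_apply, he, hF, Set.indicator_of_mem hω, hact,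
          hme, hv, hσ, smul_eq_mul]
        by_cases hb : t + 1 ∈ b <;> rcases h01 ω with h | h <;>
          simp [Set.indicator, hiff, h, hb, hω, rewardOf]
      · simp [he, hF, hω, hiff]
    rw [hdecomp]
    refine (condExp_add hvei (hFi.smul σ) _).trans ?_
    filter_upwards [condExp_mul_of_stronglyMeasurable_left hvm.stronglyMeasurable hvei hei,
      condExp_smul σ F (contextSigma x p.T) (μ := P), hdev, ih] with ω h1 h2 h3 h4
    rw [Pi.add_apply, h1, h2, Pi.mul_apply, Pi.smul_apply, h3, h4, treeWeight_succ]
    simp [hv]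

/-- On a reward history, the bad event is that of the fixed reward sequence. -/
theorem mem_badEvent_iff_of_history {b : Finset ℕ} {ω : Ω} (h : ω ∈ history r p.T b) :
    ω ∈ badEvent p tie x r θs ↔ ω ∈ badEvent p tie x (fun i _ => rewardOf b i) θs := by
  have key : ∀ t ∈ Icc 1 p.T, ∀ s a,
      width p tie (fun i a => x i a ω) (fun i => r i ω) t s a
        = width p tie (fun i a => x i a ω) (rewardOf b) t s a ∧
      estimate p tie (fun i a => x i a ω) (fun i => r i ω) t s a
        = estimate p tie (fun i a => x i a ω) (rewardOf b) t s a := by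
    intro t ht s a
    have ht := mem_Icc.1 ht
    have hrun : run p tie (fun i a => x i a ω) (fun i => r i ω) (t - 1)
        = run p tie (fun i a => x i a ω) (rewardOf b) (t - 1) :=
      run_congr (fun _ _ => rfl) fun i hi => h i (Icc_subset_Icc_right (by omega) hi)
    refine ⟨by rw [width, width, hrun], ?_⟩
    rw [estimate, estimate, hrun]
    refine congrFun (State.m_congr rfl rfl (fun _ _ => rfl) (fun i hi => h i ?_) rfl) a
    have := sets_subset (p := p) (tie := tie) (x := fun i a => x i a ω) (r := rewardOf b) (t - 1) s
    exact Icc_subset_Icc_right (by omega) (union_subset this.1 this.2 hi)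
  simp only [badEvent, Set.mem_ofPred_eq]
  refine exists_congr fun t => and_congr_right fun ht => exists_congr fun s =>
    and_congr_right fun _ => exists_congr fun a => ?_
  rw [(key t ht s a).1, (key t ht s a).2]

/-- Split by the realized reward sequence. On each history the bad event is an event of the
contexts, so the history indicator may be replaced by its conditional expectation, the tree weight.
The resulting integrand is the fixed-context failure probability, at most `δ` pointwise. -/
theorem measureReal_badEvent_le [NeZero d]
    (htie : ∀ (t : ℕ) (A : Finset (Fin K)), A.Nonempty → tie t A ∈ A)
    (hS : 1 ≤ p.S) (hadm : ∀ ω, Admissible p (fun i a => x i a ω) θs)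
    (hT : 1 ≤ p.T) (hB : 0 ≤ p.B) (hlam : 0 < p.lam)
    (hx : ∀ i ∈ Icc 1 p.T, ∀ a, Measurable (x i a)) (hr : ∀ i ∈ Icc 1 p.T, Measurable (r i))
    {act : ℕ → Ω → Fin K}
    (hact : act = fun t ω => action p tie (fun i a => x i a ω) (fun i => r i ω) t)
    (hrew : BernoulliRewards P p.T x act r θs) (hctx : ObliviousContexts P p.T x act r) :
    P.real (badEvent p tie x r θs) ≤ p.δ := by
  classical
  have hX := contextSigma_le hx
  set bad : Finset ℕ → Set Ω := fun b => badEvent p tie x (fun i _ => rewardOf b i) θs with hbad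
  have hbadX : ∀ b, MeasurableSet[contextSigma x p.T] (bad b) := fun b =>
    measurableSet_badEvent (mΩ := contextSigma x p.T) hT hB hlam
      (fun i hi a => measurable_context x hi a) fun _ _ => measurable_const
  have hint : ∀ b, Integrable ((history r p.T b).indicator fun _ => (1 : ℝ)) P := fun b =>
    (integrable_const 1).indicator (measurableSet_history hr le_rfl b)
  have hterm : ∀ b, P.real (history r p.T b ∩ bad b)
      = ∫ ω, treeWeight (rewardMean p tie (fun i a => x i a ω) θs) p.T b
          * (bad b).indicator (fun _ => (1 : ℝ)) ω ∂P := by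
    intro b
    have hi : ∀ {f : Ω → ℝ}, (fun ω => f ω * (bad b).indicator (fun _ => (1 : ℝ)) ω)
        = (bad b).indicator f := by
      intro f
      funext ω
      by_cases hω : ω ∈ bad b <;> simp [hω]
    rw [hi, integral_indicator (hX _ (hbadX b)),
      ← setIntegral_congr_ae (hX _ (hbadX b))
        ((condExp_history hT hB hlam hx hr hact hrew hctx le_rfl b).mono fun ω h _ => h),
      setIntegral_condExp hX (hint b) (hbadX b), ← integral_indicator (hX _ (hbadX b)),
      Set.indicator_indicator, Set.inter_comm (bad b),
      integral_indicator_const _ ((measurableSet_history hr le_rfl b).inter (hX _ (hbadX b)))]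
    simp
  -- Rewards are binary, so every outcome lies in the history of the set of its rounds with reward
  -- one.
  have hcover : badEvent p tie x r θs ⊆
      ⋃ b ∈ (Icc 1 p.T).powerset, (history r p.T b ∩ bad b) := by
    intro ω hω
    have hh : ω ∈ history r p.T ((Icc 1 p.T).filter fun i => r i ω = 1) := by
      intro i hi
      rcases (hrew i hi).1 ω with h | h <;> simp [rewardOf, h, mem_Icc.1 hi]
    exact Set.mem_biUnion (mem_powerset.2 (filter_subset _ _))
      ⟨hh, (mem_badEvent_iff_of_history hh).1 hω⟩
  have hwi : ∀ b, Integrable (fun ω => treeWeight (rewardMean p tie (fun i a => x i a ω) θs) p.T b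
          * (bad b).indicator (fun _ => (1 : ℝ)) ω) P := by
    intro b
    refine integrable_of_bounded (c := 1) ((measurable_treeWeight hT hB hlam hx b le_rfl).mul
      (measurable_const.indicator (hX _ (hbadX b)))) fun ω => ?_
    have h0 := treeWeight_nonneg (isTreeKernel_rewardMean p tie (fun i a => x i a ω) θs) p.T b
    have h1 : treeWeight (rewardMean p tie (fun i a => x i a ω) θs) p.T b ≤ 1 := by
      refine prod_le_one (fun i _ => ?_) fun i _ => ?_ <;> split_ifs <;>
        linarith [(isTreeKernel_rewardMean p tie (fun i a => x i a ω) θs).nonneg i b,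
          (isTreeKernel_rewardMean p tie (fun i a => x i a ω) θs).le_one i b]
    rw [abs_of_nonneg (mul_nonneg h0 (Set.indicator_nonneg (fun _ _ => zero_le_one) _))]
    by_cases hω : ω ∈ bad b <;> simp [hω, h1]
  calc P.real (badEvent p tie x r θs)
      ≤ P.real (⋃ b ∈ (Icc 1 p.T).powerset, (history r p.T b ∩ bad b)) :=
        measureReal_mono hcover (measure_ne_top _ _)
    _ ≤ ∑ b ∈ (Icc 1 p.T).powerset, P.real (history r p.T b ∩ bad b) :=
        measureReal_biUnion_finset_le _ _
    _ = ∫ ω, treeSum (rewardMean p tie (fun i a => x i a ω) θs) p.T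
          (fun b => (bad b).indicator (fun _ => (1 : ℝ)) ω) ∂P := by
        simp only [treeSum]
        rw [integral_finsetSum _ fun b _ => hwi b]
        exact sum_congr rfl fun b _ => hterm b
    _ ≤ ∫ _, p.δ ∂P := by
        refine integral_mono (integrable_finsetSum _ fun b _ => hwi b) (integrable_const _)
          fun ω => ?_
        exact le_of_eq_of_le (by congr 1) ((hadm ω).treeSum_bad_le htie hS)
    _ = p.δ := by simp

end Environment

end SupSplitLog

end

theorem theorem2 {d K : ℕ} [NeZero d] [NeZero K]
    {Ω : Type*} [MeasurableSpace Ω] (P : Measure Ω) [IsProbabilityMeasure P]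
    (p : SupSplitLog.Params)
    (hB : 0 < p.B) (hκ : 0 < p.κ) (hL : 0 < p.Lmu) (hlam : 1 / p.κ ≤ p.lam)
    (hδ0 : 0 < p.δ) (hδ1 : p.δ < 1)
    -- a fixed rule that selects one of the maximizers in each argmax
    (tie : ℕ → Finset (Fin K) → Fin K)
    (htie : ∀ (t : ℕ) (A : Finset (Fin K)), A.Nonempty → tie t A ∈ A)
    -- contexts, rewards, true parameter
    (x : ℕ → Fin K → Ω → SupSplitLog.Vec d) (r : ℕ → Ω → ℝ) (θstar : SupSplitLog.Vec d)
    (hxmeas : ∀ t ∈ Finset.Icc 1 p.T, ∀ a, Measurable (x t a))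
    (hrmeas : ∀ t ∈ Finset.Icc 1 p.T, Measurable (r t))
    -- bounded features and parameter
    (hx : ∀ t ∈ Finset.Icc 1 p.T, ∀ a ω, ‖x t a ω‖ ≤ 1)
    (hθ : ‖θstar‖ ≤ p.B)
    -- curvature bounds
    (hcurv : ∀ t ∈ Finset.Icc 1 p.T, ∀ a ω, ∀ θ : SupSplitLog.Vec d, ‖θ‖ ≤ p.B →
      1 / p.κ ≤ deriv Real.sigmoid (inner ℝ (x t a ω) θ) ∧
        deriv Real.sigmoid (inner ℝ (x t a ω) θ) ≤ p.Lmu)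
    -- the arms are pulled by the algorithm
    (act : ℕ → Ω → Fin K)
    (hact : act = fun t ω => SupSplitLog.action p tie (fun i a => x i a ω) (fun i => r i ω) t)
    (hrew : SupSplitLog.BernoulliRewards P p.T x act r θstar)
    (hctx : SupSplitLog.ObliviousContexts P p.T x act r) :
    ∃ G : Set Ω, MeasurableSet G ∧ ENNReal.ofReal (1 - p.δ) ≤ P G ∧
      ∀ ω ∈ G, ∀ t ∈ Finset.Icc 1 p.T, ∀ s ∈ Finset.Icc 1 p.S, ∀ a : Fin K,
        |SupSplitLog.estimate p tie (fun i b => x i b ω) (fun i => r i ω) t s a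
            - inner ℝ (x t a ω) θstar|
          ≤ SupSplitLog.width p tie (fun i b => x i b ω) (fun i => r i ω) t s a := by
  -- Without levels the claim is vacuous; `S ≥ 1` is needed for `2S / δ` and the logarithmic term to
  -- be positive.
  by_cases hS : 1 ≤ p.S
  swap
  · refine ⟨Set.univ, MeasurableSet.univ, ?_, fun ω _ t _ s hs => ?_⟩
    · rw [measure_univ, ← ENNReal.ofReal_one]
      exact ENNReal.ofReal_le_ofReal (by linarith)
    · have := mem_Icc.1 hs
      omega
  -- As `Real.logb 2 0 = 0`, the horizon `T = 0` would force `S = 0`.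
  have hT : 1 ≤ p.T := by
    by_contra h
    have h0 : p.T = 0 := by omega
    simp [SupSplitLog.Params.S, h0] at hS
  have hlam0 : 0 < p.lam := (one_div_pos.2 hκ).trans_le hlam
  have hadm : ∀ ω, SupSplitLog.Admissible p (fun i a => x i a ω) θstar := fun ω =>
    ⟨hT, hB, hκ, hL, by rw [div_le_iff₀ hκ] at hlam; linarith, hδ0, hδ1,
      fun t ht a => hx t ht a ω, hθ, fun t ht a => hcurv t ht a ω⟩
  have hbad : MeasurableSet (SupSplitLog.badEvent p tie x r θstar) :=
    SupSplitLog.measurableSet_badEvent hT hB.le hlam0 hxmeas hrmeas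
  refine ⟨(SupSplitLog.badEvent p tie x r θstar)ᶜ, hbad.compl, ?_, fun ω hω t ht s hs a => ?_⟩
  · rw [← ofReal_measureReal, measureReal_compl hbad, probReal_univ]
    refine ENNReal.ofReal_le_ofReal (sub_le_sub_left ?_ 1)
    exact SupSplitLog.measureReal_badEvent_le htie hS hadm hT hB.le hlam0 hxmeas hrmeas hact hrew hctx
  · by_contra h
    exact hω ⟨t, ht, s, hs, a, not_le.1 h⟩
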